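/- Let $n\ge 1$ be an integer. A dyadic cube in $\mathbb{R}^n$ is a cube $\prod_{i=1}^n 2^k\big[a_i+\tfrac{v_i}{3},\,a_i+1+\tfrac{v_i}{3}\big)$ with $k\in\mathbb{Z}$, $a\in\mathbb{Z}^n$, $v\in\{0,1,2\}^n$ (i.e. a cube of one of the $3^n$ standard shifted dyadic grids). For $0<\eta<1$, a collection $\mathcal{S}$ of dyadic cubes is $\eta$-sparse if there are pairwise disjoint measurable sets $E_Q\subset Q$, $Q\in\mathcal{S}$, with $|E_Q|>\eta|Q|$. For $1\le p<\infty$ let $\langle f\rangle_{p,Q}=\big(|Q|^{-1}\int_Q|f|^p\big)^{1/p}$, let $\langle f\rangle_{\infty,Q}$ be the essential supremum of $|f|$ on $Q$, and let $$\Lambda_{\mathcal{S},p,q}(f,g)=\sum_{Q\in\mathcal{S}}|Q|\,\langle f\rangle_{p,Q}\,\langle g\rangle_{q,Q},\qquad 1\le p,q\le\infty .$$ For $1\le p\le\infty$, $p'$ denotes the conjugate exponent, $1/p+1/p'=1$. Theorem. There is $\eta\in(0,1)$, depending only on $n$, such that the following holds. Let $\alpha,\beta\in\mathbb{R}$ with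 $\alpha\ne0$ and $\alpha\beta>0$, and let $m:\mathbb{R}^n\to\mathbb{C}$ be smooth on $\mathbb{R}^n\setminus\{0\}$, vanish at all $\xi\neq 0$ with $|\xi|^\alpha<1$, and satisfy, for every multi-index $\gamma\in\mathbb{N}^n$, $$|D^\gamma m(\xi)|\le A_{|\gamma|}\,|\xi|^{-\beta+|\gamma|(\alpha-1)},\qquad \xi\ne0 .$$ Let $T_m$ be the Fourier multiplier operator on $L^2(\mathbb{R}^n)$ with multiplier $m$, so that $T_mf(x)=(2\pi)^{-n}\int e^{ix\cdot\xi}m(\xi)\widehat f(\xi)\,d\xi$ with $\widehat f(\xi)=\int e^{-iy\cdot\xi}f(y)\,dy$, and let $\langle T_mf,g\rangle=\int T_mf\,\overline{g}$. Then for any compactly supported bounded functions $f,g:\mathbb{R}^n\to\mathbb{C}$ there exist $\eta$-sparse collections $\mathcal{S}$ and $\widetilde{\mathcal{S}}$ of dyadic cubes such that $$|\langle T_mf,g\rangle|\le C\,\Lambda_{\mathcal{S},r,s'}(f,g)<\infty\qquad\text{and}\qquad|\langle T_mf,g\rangle|\le C\,\Lambda_{\widetilde{\mathcal{S}},s',r}(f,g)<\infty$$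 for all $r,s\in[1,\infty]$ such that either $$1\le r\le s\le2\quad\text{and}\quad|\beta|>n|\alpha|\Big(\frac1r-\frac12\Big),$$ or $$1\le r\le2\le s\le r'\quad\text{and}\quad|\beta|>n|\alpha|\Big(\frac1r-\frac1s\Big).$$ Here $C=C(n,\alpha,\beta,r,s,(A_k)_{k\ge0})$ depends neither on $f,g$ nor otherwise on $m$. -/

import Mathlib

open MeasureTheory Real FourierTransform
open scoped ENNReal NNReal ComplexConjugate

/-! ### Dyadic cubes, sparse collections and sparse forms -/

/-- The cubes `2 ^ k * ∏ i, [a i + v i / 3, a i + 1 + v i / 3)`, with `k : ℤ` and `a : Fin n → ℤ`,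
with shift parameter `v ∈ {0, 1, 2} ^ n`. The choice `v = 0` gives the standard dyadic cubes. -/
def shiftedGrid (n : ℕ) (v : Fin n → Fin 3) : Set (Set (EuclideanSpace ℝ (Fin n))) :=
  {Q | ∃ (k : ℤ) (a : Fin n → ℤ), Q = {x | ∀ i,
    (2 : ℝ) ^ k * ((a i : ℝ) + ((v i : ℕ) : ℝ) / 3) ≤ x i ∧
    x i < (2 : ℝ) ^ k * ((a i : ℝ) + 1 + ((v i : ℕ) : ℝ) / 3)}}

/-- A dyadic cube is a cube of one of the `3 ^ n` universal shifted dyadic grids. -/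
def IsDyadicCube {n : ℕ} (Q : Set (EuclideanSpace ℝ (Fin n))) : Prop :=
  ∃ v : Fin n → Fin 3, Q ∈ shiftedGrid n v

/-- `η`-sparse collections of dyadic cubes. -/
def IsSparse {n : ℕ} (η : ℝ) (S : Set (Set (EuclideanSpace ℝ (Fin n)))) : Prop :=
  (∀ Q ∈ S, IsDyadicCube Q) ∧
  ∃ E : Set (EuclideanSpace ℝ (Fin n)) → Set (EuclideanSpace ℝ (Fin n)),
    S.PairwiseDisjoint E ∧
    ∀ Q ∈ S, MeasurableSet (E Q) ∧ E Q ⊆ Q ∧ ENNReal.ofReal η * volume Q < volume (E Q)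

/-- The average `⟨f⟩_{p,Q}`, that is `(|Q|⁻¹ ∫_Q |f| ^ p) ^ (1 / p)` for finite `p`, and the
essential supremum of `|f|` on `Q` for `p = ∞`. -/
noncomputable def cubeAverage {n : ℕ} (p : ℝ≥0∞) (Q : Set (EuclideanSpace ℝ (Fin n)))
    (f : EuclideanSpace ℝ (Fin n) → ℂ) : ℝ≥0∞ :=
  eLpNorm f p ((volume Q)⁻¹ • volume.restrict Q)

/-- The sparse form `∑_{Q ∈ S} |Q| ⟨f⟩_{p,Q} ⟨g⟩_{q,Q}`, with values in `[0, ∞]`. -/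
noncomputable def sparseForm {n : ℕ} (S : Set (Set (EuclideanSpace ℝ (Fin n)))) (p q : ℝ≥0∞)
    (f g : EuclideanSpace ℝ (Fin n) → ℂ) : ℝ≥0∞ :=
  ∑' Q : S, volume (Q : Set (EuclideanSpace ℝ (Fin n))) * cubeAverage p Q f * cubeAverage q Q g

/-! ### Fourier multipliers -/

/-- The Fourier multiplier `m` is smooth off the origin, is supported where `|ξ| ^ α ≥ 1`, and
satisfies `|D ^ γ m(ξ)| ≤ A |γ| * |ξ| ^ (-β + |γ| * (α - 1))` for all multi-indices `γ`. The
origin, which is a null set, plays no role. A partial derivative of order `k` is given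
by the list `γ` of the `k` coordinates in which one differentiates. -/
structure IsMiyachiMultiplier {n : ℕ} (α β : ℝ) (A : ℕ → ℝ)
    (m : EuclideanSpace ℝ (Fin n) → ℂ) : Prop where
  smooth : ContDiffOn ℝ (⊤ : ℕ∞) m {0}ᶜ
  support : ∀ ξ, ξ ≠ 0 → m ξ ≠ 0 → 1 ≤ ‖ξ‖ ^ α
  deriv_le : ∀ (k : ℕ) (γ : Fin k → Fin n) (ξ : EuclideanSpace ℝ (Fin n)), ξ ≠ 0 →
    ‖iteratedFDeriv ℝ k m ξ (fun j => EuclideanSpace.single (γ j) (1 : ℝ))‖ ≤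
      A k * ‖ξ‖ ^ (-β + (k : ℝ) * (α - 1))

/-- The multiplier as a function of the frequency variable of Mathlib's Fourier transform, whose
kernel is `exp (-2 π i x ⬝ ξ)`. -/
noncomputable def rescaled {n : ℕ} (m : EuclideanSpace ℝ (Fin n) → ℂ) :
    EuclideanSpace ℝ (Fin n) → ℂ :=
  fun ξ => m ((2 * π) • ξ)

/-- The operator `T_m` on `L²`, for a multiplier `m ∈ L^∞`. It acts on nice functions `u` by
`T_m u (x) = (2 π)⁻ⁿ ∫ exp (i x ⬝ ξ) m(ξ) (∫ exp (-i y ⬝ ξ) u(y) dy) dξ`. -/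
noncomputable def multiplierOp {n : ℕ} (m : EuclideanSpace ℝ (Fin n) → ℂ)
    (hm : MemLp (rescaled m) ∞ volume)
    (u : Lp (α := EuclideanSpace ℝ (Fin n)) ℂ 2 volume) :
    Lp (α := EuclideanSpace ℝ (Fin n)) ℂ 2 volume :=
  𝓕⁻ ((hm.toLp (rescaled m) • 𝓕 u : Lp (α := EuclideanSpace ℝ (Fin n)) ℂ 2 volume))

/-- The multipliers under consideration are bounded. -/
theorem IsMiyachiMultiplier.memLp_rescaled {n : ℕ} (hn : 0 < n) {α β : ℝ} (hαβ : 0 < α * β)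
    {A : ℕ → ℝ} {m : EuclideanSpace ℝ (Fin n) → ℂ} (hm : IsMiyachiMultiplier α β A m) :
    MemLp (rescaled m) ∞ volume := by
  have : Nonempty (Fin n) := ⟨⟨0, hn⟩⟩
  have h2π : (2 * π : ℝ) ≠ 0 := by positivity
  have hne : ∀ᵐ ξ : EuclideanSpace ℝ (Fin n) ∂volume, ξ ≠ 0 := by
    simp [ae_iff]
  have hmeas : AEStronglyMeasurable (rescaled m) volume := by
    have hc : ContinuousOn (rescaled m) {0}ᶜ := by
      refine hm.smooth.continuousOn.comp (by fun_prop) ?_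
      intro ξ hξ
      simpa [h2π] using hξ
    have h1 := hc.aestronglyMeasurable (μ := volume) (measurableSet_singleton 0).compl
    have h2 : (volume : Measure (EuclideanSpace ℝ (Fin n))).restrict {0}ᶜ = volume :=
      Measure.restrict_eq_self_of_ae_mem hne
    rwa [h2] at h1
  refine memLp_top_of_bound hmeas |A 0| ?_
  filter_upwards [hne] with ξ hξ
  have hξ' : (2 * π) • ξ ≠ 0 := smul_ne_zero h2π hξ
  set ζ := (2 * π) • ξ with hζ
  change ‖m ζ‖ ≤ |A 0|
  by_cases h0 : m ζ = 0
  · simp [h0]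
  have hs := hm.support ζ hξ' h0
  have hd := hm.deriv_le 0 (fun j => j.elim0) ζ hξ'
  simp only [iteratedFDeriv_zero_apply, Nat.cast_zero, zero_mul, add_zero] at hd
  have hpos : 0 < ‖ζ‖ := norm_pos_iff.mpr hξ'
  have hle : ‖ζ‖ ^ (-β) ≤ 1 := by
    rcases lt_trichotomy α 0 with hα | hα | hα
    · have hβ : β < 0 := by nlinarith
      have h1 : ‖ζ‖ ≤ 1 := by
        by_contra! h
        exact absurd hs (not_le.mpr (Real.rpow_lt_one_of_one_lt_of_neg h hα))
      exact Real.rpow_le_one hpos.le h1 (by linarith)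
    · simp [hα] at hαβ
    · have hβ : 0 < β := by nlinarith
      have h1 : 1 ≤ ‖ζ‖ := by
        by_contra! h
        exact absurd hs (not_le.mpr (Real.rpow_lt_one hpos.le h hα))
      exact Real.rpow_le_one_of_one_le_of_nonpos h1 (by linarith)
  have hrp : 0 ≤ ‖ζ‖ ^ (-β) := Real.rpow_nonneg hpos.le _
  calc ‖m ζ‖ ≤ A 0 * ‖ζ‖ ^ (-β) := hd
    _ ≤ |A 0| * ‖ζ‖ ^ (-β) := by gcongr; exact le_abs_self _
    _ ≤ |A 0| := by nlinarith [abs_nonneg (A 0)]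

/-- Compactly supported bounded functions belong to `L²`. -/
theorem memLp_two_of_bounded {n : ℕ} {f : EuclideanSpace ℝ (Fin n) → ℂ}
    (hf : MemLp f ∞ volume) (hfs : HasCompactSupport f) : MemLp f 2 volume :=
  hf.mono_exponent_of_measure_support_ne_top (s := tsupport f)
    (fun _ hx => image_eq_zero_of_notMem_tsupport hx) hfs.measure_lt_top.ne le_top

/-! Cut `m` smoothly into pieces at the frequencies `L = 2 ^ (± k)` with `X = L ^ α ≥ 1`. A piece
has size `L ^ (-β) = X ^ (-β / α)`, and integration by parts shows that its kernel decays rapidly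
beyond the distance `ρ = L ^ (α - 1) = X / L`. Take grid cubes `R` of side about `ρ * X ^ ε`, and
pair the part of `f` on `R` with the part of `g` on the triple `3R`. Bernstein's inequality on the
ball of radius `L` bounds this by `X ^ (-β / α) * X ^ ((1 + ε) * n * (1 / p + 1 / q - 1)) * |R|
⟨f⟩_{p,3R} ⟨g⟩_{q,3R}` up to a constant. The exponent of `X` is negative for small `ε` exactly when
`n |α| (1 / p + 1 / q - 1) < |β|`. The pairing with `g` off `3R` is distributed over the coarser
grids; the gain `X ^ (-ε k)` from a high order of kernel decay pays for it. So each piece is bounded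
by grid forms with a factor decaying geometrically in the index of the piece
(`exists_dyadicPiece_bound`), and the pieces sum up.

It remains to dominate the grid forms of all depths by one sparse form. A stopping time selects the
cubes on which an average jumps by a large factor over that of the stopping parent; the weak type
inequality makes the selected cubes sparse. The collection must serve all exponents at once. The
stopping rule therefore watches the measures `|f| ^ p` and `|g| ^ q` for all rational `p, q`
simultaneously, with thresholds so large that the total measure lost over the countable family is at
most one half (`exists_stopping_family`). The thresholds, hence the constants, depend on `p` and `q`
but not on `f` and `g`. The one-third trick puts each triple into a shifted dyadic cube
(`exists_sparse_domination`).

The construction stays finite: for fixed `f` and `g` the high pieces of `m` contribute less than the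
coarsest grid form with exponents `1`, which every other form dominates, and the remaining pieces
need only finitely many depths (`exists_sparse_bound`).

General `r, s` follow from rational `p ≤ r` and `q ≤ s'` close to them, since sparse forms increase
with the exponents and the admissibility condition is open. In the first range `q` is compared with
`2 ≤ s'`, in the second with `s'`. The condition is symmetric in `p` and `q`, so the same collection
serves both assertions. -/

/-- Euclidean space of dimension `n`. -/
abbrev Euc (n : ℕ) := EuclideanSpace ℝ (Fin n)

/-! ### Half-open boxes and the grid of cubes of side `h / 2 ^ d` -/

/-- The half-open cube with corner `l` and side `c`. -/
def halfOpenCube {n : ℕ} (l : Fin n → ℝ) (c : ℝ) : Set (Euc n) :=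
  {x | ∀ j, l j ≤ x j ∧ x j < l j + c}

theorem halfOpenCube_eq_preimage {n : ℕ} (l : Fin n → ℝ) (c : ℝ) :
    halfOpenCube l c = (MeasurableEquiv.toLp 2 (Fin n → ℝ)).symm ⁻¹'
      (Set.pi Set.univ fun j => Set.Ico (l j) (l j + c)) := by
  ext x
  simp [halfOpenCube, Set.mem_pi]

theorem measurableSet_halfOpenCube {n : ℕ} (l : Fin n → ℝ) (c : ℝ) :
    MeasurableSet (halfOpenCube l c) := by
  rw [halfOpenCube_eq_preimage]
  exact (MeasurableEquiv.measurable _) (MeasurableSet.univ_pi fun j => measurableSet_Ico)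

theorem volume_halfOpenCube {n : ℕ} (l : Fin n → ℝ) (c : ℝ) :
    volume (halfOpenCube l c) = ENNReal.ofReal c ^ n := by
  rw [halfOpenCube_eq_preimage,
    (EuclideanSpace.volume_preserving_symm_measurableEquiv_toLp (Fin n)).measure_preimage
      (MeasurableSet.univ_pi fun j => measurableSet_Ico).nullMeasurableSet, Real.volume_pi_Ico]
  simp

/-- The index of the cube of side `h / 2 ^ d` that contains `x`. -/
noncomputable def gridIndex {n : ℕ} (h : ℝ) (d : ℕ) (x : Euc n) : Fin n → ℤ :=
  fun j => ⌊2 ^ d * x j / h⌋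

/-- The cube of side `h / 2 ^ P.1` with index `P.2`. -/
def gridCube {n : ℕ} (h : ℝ) (P : ℕ × (Fin n → ℤ)) : Set (Euc n) :=
  {x | gridIndex h P.1 x = P.2}

/-- The union of a grid cube and its neighbours. -/
def gridTriple {n : ℕ} (h : ℝ) (P : ℕ × (Fin n → ℤ)) : Set (Euc n) :=
  {x | ∀ j, |gridIndex h P.1 x j - P.2 j| ≤ 1}

theorem gridIndex_eq_div {n : ℕ} (h : ℝ) (d : ℕ) (x : Euc n) (j : Fin n) :
    gridIndex h d x j = gridIndex h (d + 1) x j / 2 := by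
  have := Int.floor_div_natCast (2 ^ (d + 1) * x j / h) 2
  simp only [gridIndex]
  rw [← Nat.cast_ofNat (R := ℤ), ← this]
  congr 1
  push_cast
  ring

theorem gridCube_eq {n : ℕ} {h : ℝ} (hh : 0 < h) (P : ℕ × (Fin n → ℤ)) :
    gridCube h P = halfOpenCube (fun j => P.2 j * (h / 2 ^ P.1)) (h / 2 ^ P.1) := by
  ext x
  simp only [gridCube, halfOpenCube, Set.mem_ofPred_eq, funext_iff, gridIndex, Int.floor_eq_iff]
  refine forall_congr' fun j => ?_
  have h2 : (0 : ℝ) < 2 ^ P.1 := by positivity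
  rw [le_div_iff₀ hh, div_lt_iff₀ hh, mul_div_assoc', div_le_iff₀ h2, ← add_div, lt_div_iff₀ h2]
  constructor <;> rintro ⟨h1, h3⟩ <;> constructor <;> linarith

theorem gridTriple_eq {n : ℕ} {h : ℝ} (hh : 0 < h) (P : ℕ × (Fin n → ℤ)) :
    gridTriple h P = halfOpenCube (fun j => (P.2 j - 1) * (h / 2 ^ P.1)) (3 * (h / 2 ^ P.1)) := by
  ext x
  simp only [gridTriple, halfOpenCube, Set.mem_ofPred_eq, gridIndex]
  refine forall_congr' fun j => ?_
  have h2 : (0 : ℝ) < 2 ^ P.1 := by positivity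
  have key : |⌊2 ^ P.1 * x j / h⌋ - P.2 j| ≤ 1 ↔
      P.2 j - 1 ≤ ⌊2 ^ P.1 * x j / h⌋ ∧ ⌊2 ^ P.1 * x j / h⌋ < P.2 j + 2 := by
    rw [abs_le]; constructor <;> rintro ⟨h1, h3⟩ <;> constructor <;> linarith
  rw [key, Int.le_floor, Int.floor_lt, le_div_iff₀ hh, div_lt_iff₀ hh, mul_div_assoc',
    div_le_iff₀ h2, mul_div_assoc', ← add_div, lt_div_iff₀ h2]
  push_cast
  constructor <;> rintro ⟨h1, h3⟩ <;> constructor <;> linarith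

theorem measurableSet_gridCube {n : ℕ} {h : ℝ} (hh : 0 < h) (P : ℕ × (Fin n → ℤ)) :
    MeasurableSet (gridCube h P) := by
  rw [gridCube_eq hh]; exact measurableSet_halfOpenCube _ _

theorem measurableSet_gridTriple {n : ℕ} {h : ℝ} (hh : 0 < h) (P : ℕ × (Fin n → ℤ)) :
    MeasurableSet (gridTriple h P) := by
  rw [gridTriple_eq hh]; exact measurableSet_halfOpenCube _ _

theorem volume_gridCube {n : ℕ} {h : ℝ} (hh : 0 < h) (P : ℕ × (Fin n → ℤ)) :
    volume (gridCube h P) = ENNReal.ofReal (h / 2 ^ P.1) ^ n := by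
  rw [gridCube_eq hh, volume_halfOpenCube]

theorem volume_gridTriple {n : ℕ} {h : ℝ} (hh : 0 < h) (P : ℕ × (Fin n → ℤ)) :
    volume (gridTriple h P) = 3 ^ n * volume (gridCube h P) := by
  rw [gridTriple_eq hh, volume_halfOpenCube, volume_gridCube hh, ENNReal.ofReal_mul (by norm_num),
    mul_pow]
  simp

theorem volume_gridCube_pos {n : ℕ} {h : ℝ} (hh : 0 < h) (P : ℕ × (Fin n → ℤ)) :
    volume (gridCube h P) ≠ 0 := by
  rw [volume_gridCube hh]
  exact pow_ne_zero _ (ENNReal.ofReal_pos.2 (by positivity)).ne'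

theorem volume_gridCube_ne_top {n : ℕ} {h : ℝ} (hh : 0 < h) (P : ℕ × (Fin n → ℤ)) :
    volume (gridCube h P) ≠ ∞ := by
  rw [volume_gridCube hh]
  exact ENNReal.pow_ne_top ENNReal.ofReal_ne_top

theorem gridCube_subset_gridTriple {n : ℕ} (h : ℝ) (P : ℕ × (Fin n → ℤ)) :
    gridCube h P ⊆ gridTriple h P := by
  intro x hx j
  have : gridIndex h P.1 x = P.2 := hx
  simp [this]

theorem mem_gridCube_gridIndex {n : ℕ} (h : ℝ) (d : ℕ) (x : Euc n) :
    x ∈ gridCube h (d, gridIndex h d x) := rfl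

theorem gridIndex_eq_of_le {n : ℕ} {h : ℝ} {d e : ℕ} (hde : e ≤ d) {x y : Euc n}
    (hxy : gridIndex h d x = gridIndex h d y) : gridIndex h e x = gridIndex h e y := by
  induction d, hde using Nat.le_induction with
  | base => exact hxy
  | succ d hd ih =>
    apply ih
    funext j
    rw [gridIndex_eq_div h d x, gridIndex_eq_div h d y, hxy]

/-- Integer halving keeps two integers at distance at most `1` within distance `1`. Hence the
triples of nested cubes are nested, which localizes the stopping argument to the triple of the
parent. -/
theorem abs_gridIndex_sub_le_of_le {n : ℕ} {h : ℝ} {d e : ℕ} (hde : e ≤ d) {x y : Euc n}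
    (hxy : ∀ j, |gridIndex h d x j - gridIndex h d y j| ≤ 1) (j : Fin n) :
    |gridIndex h e x j - gridIndex h e y j| ≤ 1 := by
  induction d, hde using Nat.le_induction with
  | base => exact hxy j
  | succ d hd ih =>
    apply ih
    intro j
    have := hxy j
    rw [gridIndex_eq_div h d x, gridIndex_eq_div h d y]
    rw [abs_le] at this ⊢
    omega

theorem gridCube_subset_gridCube {n : ℕ} {h : ℝ} {d e : ℕ} (hde : e ≤ d) (x : Euc n) :
    gridCube h (d, gridIndex h d x) ⊆ gridCube h (e, gridIndex h e x) :=
  fun _ hy => gridIndex_eq_of_le hde hy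

theorem gridTriple_subset_gridTriple {n : ℕ} {h : ℝ} {d e : ℕ} (hde : e ≤ d) (x : Euc n) :
    gridTriple h (d, gridIndex h d x) ⊆ gridTriple h (e, gridIndex h e x) :=
  fun _ hy => abs_gridIndex_sub_le_of_le hde hy

theorem gridCube_nonempty {n : ℕ} {h : ℝ} (hh : 0 < h) (P : ℕ × (Fin n → ℤ)) :
    (gridCube h P).Nonempty := by
  by_contra hc
  rw [Set.not_nonempty_iff_eq_empty] at hc
  exact volume_gridCube_pos hh P (by rw [hc]; simp)

theorem measurable_gridIndex {n : ℕ} (h : ℝ) (d : ℕ) :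
    Measurable (gridIndex h d : Euc n → Fin n → ℤ) := by
  refine measurable_pi_lambda _ fun j => Int.measurable_floor.comp ?_
  exact ((continuous_const.mul (by fun_prop : Continuous fun x : Euc n => x j)).div_const
    h).measurable

/-! ### The weak type estimate for grid averages -/

/-- The ratio `ν(3P) / |P|`. -/
noncomputable def gridAvg {n : ℕ} (ν : Measure (Euc n)) (h : ℝ) (P : ℕ × (Fin n → ℤ)) : ℝ≥0∞ :=
  ν (gridTriple h P) / volume (gridCube h P)

/-- With `s` the side of `R`, the triple of `R` reaches from `-s` to `2 * s` relative to its corner.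
A point of `P` is within two sides of `P`, hence `4 * s`, of the common point in each coordinate.
This gives the range from `-5 * s` to `6 * s`. -/
theorem gridCube_subset_of_inter {n : ℕ} {h : ℝ} (hh : 0 < h) {P R : ℕ × (Fin n → ℤ)}
    (hPR : (gridTriple h P ∩ gridTriple h R).Nonempty) (hs : h / 2 ^ P.1 ≤ 2 * (h / 2 ^ R.1)) :
    gridCube h P ⊆ halfOpenCube (fun j => (R.2 j - 5) * (h / 2 ^ R.1)) (11 * (h / 2 ^ R.1)) := by
  obtain ⟨z, hzP, hzR⟩ := hPR
  intro x hx j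
  rw [gridTriple_eq hh] at hzP hzR
  rw [gridCube_eq hh] at hx
  obtain ⟨h1, h2⟩ := hzP j
  obtain ⟨h3, h4⟩ := hzR j
  obtain ⟨h5, h6⟩ := hx j
  dsimp only at *
  constructor <;> nlinarith

/-- The weak type (1,1) inequality for the maximal function of `gridAvg`, by a Vitali selection
applied to the triples, whose measures then add up inside `V`. -/
theorem volume_biUnion_gridCube_le {n : ℕ} {h : ℝ} (hh : 0 < h) (ν : Measure (Euc n)) (c : ℝ≥0∞)
    (V : Set (Euc n)) (t : Set (ℕ × (Fin n → ℤ))) (htV : ∀ R ∈ t, gridTriple h R ⊆ V)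
    (ht : ∀ R ∈ t, c * volume (gridCube h R) ≤ ν (gridTriple h R)) :
    c * volume (⋃ R ∈ t, gridCube h R) ≤ 11 ^ n * ν V := by
  obtain ⟨u, hut, hud, hu⟩ := Vitali.exists_disjoint_subfamily_covering_enlargement
    (gridTriple h) t (fun R => h / 2 ^ R.1) 2 one_lt_two (fun R _ => by positivity) h
    (fun R _ => div_le_self hh.le (one_le_pow₀ one_le_two))
    (fun R _ => (gridCube_nonempty hh R).mono (gridCube_subset_gridTriple h R))
  have hcov : (⋃ R ∈ t, gridCube h R) ⊆
      ⋃ R ∈ u, halfOpenCube (fun j => (R.2 j - 5) * (h / 2 ^ R.1)) (11 * (h / 2 ^ R.1)) := by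
    refine Set.iUnion₂_subset fun R hR => ?_
    obtain ⟨b, hb, hb1, hb2⟩ := hu R hR
    exact (gridCube_subset_of_inter hh hb1 hb2).trans
      (Set.subset_biUnion_of_mem (u := fun R : ℕ × (Fin n → ℤ) =>
        halfOpenCube (fun j => (R.2 j - 5) * (h / 2 ^ R.1)) (11 * (h / 2 ^ R.1))) hb)
  have hvol : ∀ R : ℕ × (Fin n → ℤ), volume (halfOpenCube
      (fun j => ((R.2 j : ℝ) - 5) * (h / 2 ^ R.1)) (11 * (h / 2 ^ R.1))) =
      11 ^ n * volume (gridCube h R) := by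
    intro R
    rw [volume_halfOpenCube, volume_gridCube hh, ENNReal.ofReal_mul (by norm_num), mul_pow]
    simp
  calc c * volume (⋃ R ∈ t, gridCube h R)
      ≤ c * ∑' R : u, 11 ^ n * volume (gridCube h R.1) := by
        gcongr
        refine (measure_mono hcov).trans ((measure_biUnion_le _ (Set.to_countable u) _).trans ?_)
        simp_rw [hvol]; rfl
    _ = 11 ^ n * ∑' R : u, c * volume (gridCube h R.1) := by
        rw [ENNReal.tsum_mul_left, ENNReal.tsum_mul_left]; ring
    _ ≤ 11 ^ n * ∑' R : u, ν (gridTriple h R.1) := by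
        gcongr with R
        exact ht _ (hut R.2)
    _ = 11 ^ n * ν (⋃ R ∈ u, gridTriple h R) := by
        rw [measure_biUnion (Set.to_countable u) hud fun R _ => measurableSet_gridTriple hh R]
    _ ≤ 11 ^ n * ν V := by
        gcongr
        exact Set.iUnion₂_subset fun R hR => htV R (hut hR)

/-! ### Stopping parents -/

open Classical in
/-- The stopping parent of the cube of depth `d` and index `a`, for the rule `halt`. -/
noncomputable def haltParent {n : ℕ}
    (halt : ℕ × (Fin n → ℤ) → ℕ × (Fin n → ℤ) → Prop) : ℕ → (Fin n → ℤ) → ℕ × (Fin n → ℤ)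
  | 0, a => (0, a)
  | d + 1, a =>
    if halt (haltParent halt d fun j => a j / 2) (d + 1, a) then (d + 1, a)
    else haltParent halt d fun j => a j / 2

section haltParent

variable {n : ℕ} {halt : ℕ × (Fin n → ℤ) → ℕ × (Fin n → ℤ) → Prop}

theorem haltParent_succ_gridIndex (h : ℝ) (d : ℕ) (x : Euc n) :
    haltParent halt (d + 1) (gridIndex h (d + 1) x) = (d + 1, gridIndex h (d + 1) x) ∧
      halt (haltParent halt d (gridIndex h d x)) (d + 1, gridIndex h (d + 1) x) ∨
    haltParent halt (d + 1) (gridIndex h (d + 1) x) = haltParent halt d (gridIndex h d x) ∧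
      ¬ halt (haltParent halt d (gridIndex h d x)) (d + 1, gridIndex h (d + 1) x) := by
  have hidx : (fun j => gridIndex h (d + 1) x j / 2) = gridIndex h d x :=
    funext fun j => (gridIndex_eq_div h d x j).symm
  rw [haltParent, hidx]
  by_cases hs : halt (haltParent halt d (gridIndex h d x)) (d + 1, gridIndex h (d + 1) x)
  · simp [hs]
  · simp [hs]

/-- The halting rule is always tested against the current parent. So the parent is an ancestor that
is its own parent, and a cube different from its parent did not halt relative to it. -/
theorem haltParent_gridIndex (h : ℝ) (d : ℕ) (x : Euc n) :
    ∃ e ≤ d, haltParent halt d (gridIndex h d x) = (e, gridIndex h e x) ∧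
      haltParent halt e (gridIndex h e x) = (e, gridIndex h e x) ∧
      (e = d ∨ ¬ halt (e, gridIndex h e x) (d, gridIndex h d x)) := by
  induction d with
  | zero => exact ⟨0, le_rfl, rfl, rfl, Or.inl rfl⟩
  | succ d ih =>
    obtain ⟨e, hed, h1, h2, h3⟩ := ih
    rcases haltParent_succ_gridIndex (halt := halt) h d x with ⟨h4, h5⟩ | ⟨h4, h5⟩
    · exact ⟨d + 1, le_rfl, h4, h4, Or.inl rfl⟩
    · exact ⟨e, by omega, h4.trans h1, h2, Or.inr (h1 ▸ h5)⟩

/-- A parent persists down the tower of cubes around `x` until some cube halts relative to it. This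
covers the points that a stopping cube loses. -/
theorem exists_halt_of_haltParent_ne (h : ℝ) {e d : ℕ} (hed : e ≤ d) (x : Euc n)
    (he : haltParent halt e (gridIndex h e x) = (e, gridIndex h e x))
    (hd : haltParent halt d (gridIndex h d x) ≠ (e, gridIndex h e x)) :
    ∃ k, e ≤ k ∧ halt (e, gridIndex h e x) (k, gridIndex h k x) := by
  by_contra! hc
  apply hd
  clear hd
  induction d, hed using Nat.le_induction with
  | base => exact he
  | succ d hd ih =>
    rcases haltParent_succ_gridIndex (halt := halt) h d x with ⟨h4, h5⟩ | ⟨h4, h5⟩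
    · rw [ih] at h5
      exact absurd h5 (hc _ (by omega))
    · rw [h4, ih]

end haltParent

/-- Simultaneous stopping-time decomposition for a countable family of measures. -/
theorem exists_stopping_family (n : ℕ) (ι : Type) [Countable ι] :
    ∃ B : ι → ℝ≥0, (∀ i, 1 ≤ B i) ∧ ∀ (ν : ι → Measure (Euc n)) (h : ℝ) (_ : 0 < h)
      (_ : ∀ i P, ν i (gridTriple h P) ≠ ∞) (D : ℕ),
    ∃ (par : ℕ → (Fin n → ℤ) → ℕ × (Fin n → ℤ)) (E : ℕ × (Fin n → ℤ) → Set (Euc n)),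
      Pairwise (Function.onFun Disjoint E) ∧
      (∀ P, MeasurableSet (E P) ∧ E P ⊆ gridCube h P) ∧
      (∀ d a, gridCube h (d, a) ⊆ gridCube h (par d a)) ∧
      (∀ d ≤ D, ∀ a, volume (gridCube h (par d a)) ≤ 2 * volume (E (par d a))) ∧
      (∀ d a i, gridAvg (ν i) h (d, a) ≤ B i * gridAvg (ν i) h (par d a)) := by
  -- The measure `i` may lose the fraction `11 ^ n * δ i` of a stopping cube, where `11 ^ n` is the
  -- weak type constant; the sum of the `δ i` is such that the total loss stays below one half.
  obtain ⟨δ, hδ0, c, hδc, hc⟩ := NNReal.exists_pos_sum_of_countable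
    (ε := (2 * 11 ^ n)⁻¹) (by positivity) ι
  set B : ι → ℝ≥0 := fun i => max 1 (δ i)⁻¹ with hB
  refine ⟨B, fun i => le_max_left _ _, fun ν h hh hν D => ?_⟩
  set halt : ℕ × (Fin n → ℤ) → ℕ × (Fin n → ℤ) → Prop := fun P R =>
    ∃ i, B i * gridAvg (ν i) h P < gridAvg (ν i) h R with h_halt
  have hrep : ∀ d (a : Fin n → ℤ), ∃ x : Euc n, gridIndex h d x = a := fun d a =>
    gridCube_nonempty hh (d, a)
  -- The set attached to `P` consists of the points whose stopping parent at the final depth `D` is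
  -- `P`; disjointness is then automatic.
  refine ⟨haltParent halt, fun P => {x | haltParent halt D (gridIndex h D x) = P},
    ?_, ?_, ?_, ?_, ?_⟩
  · intro P R hPR
    refine Set.disjoint_left.2 fun x hx hx' => hPR ?_
    exact (show _ = P from hx).symm.trans hx'
  · intro P
    refine ⟨?_, ?_⟩
    · exact measurable_gridIndex h D (Set.to_countable {a | haltParent halt D a = P}).measurableSet
    · intro x hx
      obtain ⟨e, he, h1, -, -⟩ := haltParent_gridIndex (halt := halt) h D x
      have : P = (e, gridIndex h e x) := (show _ = P from hx).symm.trans h1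
      subst this
      exact mem_gridCube_gridIndex h e x
  · intro d a
    obtain ⟨x, rfl⟩ := hrep d a
    obtain ⟨e, he, h1, -, -⟩ := haltParent_gridIndex (halt := halt) h d x
    rw [h1]
    exact gridCube_subset_gridCube he x
  · intro d hd a
    obtain ⟨x₀, rfl⟩ := hrep d a
    obtain ⟨e, he, h1, h2, -⟩ := haltParent_gridIndex (halt := halt) h d x₀
    rw [h1]
    set P : ℕ × (Fin n → ℤ) := (e, gridIndex h e x₀) with hP
    set EP : Set (Euc n) := {x | haltParent halt D (gridIndex h D x) = P} with hEP
    set t : ι → Set (ℕ × (Fin n → ℤ)) := fun i =>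
      {R | B i * gridAvg (ν i) h P < gridAvg (ν i) h R ∧
        ∃ x, e ≤ R.1 ∧ gridIndex h e x = gridIndex h e x₀ ∧ R = (R.1, gridIndex h R.1 x)} with ht
    -- Every point of `P` lost from `EP` lies in a cube that halts relative to `P` because of some
    -- measure `i`.
    have hcov : gridCube h P \ EP ⊆ ⋃ i, ⋃ R ∈ t i, gridCube h R := by
      rintro x ⟨hxP, hxE⟩
      have hx : gridIndex h e x = gridIndex h e x₀ := hxP
      obtain ⟨k, hk, i, hi⟩ := exists_halt_of_haltParent_ne (halt := halt) h (he.trans hd) x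
        (by rw [hx]; exact h2) (by rw [hx]; exact hxE)
      simp only [Set.mem_iUnion]
      refine ⟨i, (k, gridIndex h k x), ⟨?_, x, hk, hx, rfl⟩, mem_gridCube_gridIndex h k x⟩
      rwa [hx] at hi
    have hbound : ∀ i, volume (⋃ R ∈ t i, gridCube h R) ≤
        11 ^ n * δ i * volume (gridCube h P) := by
      intro i
      have hsub : ∀ R ∈ t i, gridTriple h R ⊆ gridTriple h P := by
        rintro R ⟨-, x, hx1, hx2, hx3⟩
        rw [hx3, hP, ← hx2]
        exact gridTriple_subset_gridTriple hx1 x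
      have hv0 := volume_gridCube_pos hh P
      have hvt := volume_gridCube_ne_top hh P
      -- If the triple is null, no smaller cube can halt for `i`; otherwise the average of `P` is
      -- positive and finite and can be cancelled from the weak type inequality.
      by_cases h0 : ν i (gridTriple h P) = 0
      · have : t i = ∅ := by
          refine Set.eq_empty_iff_forall_notMem.2 fun R hR => ?_
          have h3 : ν i (gridTriple h R) = 0 := measure_mono_null (hsub R hR) h0
          have := hR.1
          simp [gridAvg, h3] at this
        simp [this]
      · have hw := volume_biUnion_gridCube_le hh (ν i) (B i * gridAvg (ν i) h P)
          (gridTriple h P) (t i) hsub (fun R hR => by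
            have := hR.1.le
            rw [gridAvg, gridAvg, ENNReal.le_div_iff_mul_le (Or.inl (volume_gridCube_pos hh R))
              (Or.inl (volume_gridCube_ne_top hh R))] at this
            exact this)
        have hBδ : (1 : ℝ≥0∞) ≤ δ i * B i := by
          have : 1 ≤ δ i * B i := by
            calc (1 : ℝ≥0) = δ i * (δ i)⁻¹ := (mul_inv_cancel₀ (hδ0 i).ne').symm
              _ ≤ _ := by gcongr; exact le_max_right _ _
          exact_mod_cast this
        set V := volume (⋃ R ∈ t i, gridCube h R)
        have h5 : ν i (gridTriple h P) = gridAvg (ν i) h P * volume (gridCube h P) := by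
          rw [gridAvg, ENNReal.div_mul_cancel hv0 hvt]
        have hA0 : gridAvg (ν i) h P ≠ 0 := by
          intro h6; rw [h6, zero_mul] at h5; exact h0 h5
        have hAt : gridAvg (ν i) h P ≠ ∞ := ENNReal.div_ne_top (hν i P) hv0
        have h7 : gridAvg (ν i) h P * V ≤
            gridAvg (ν i) h P * (11 ^ n * δ i * volume (gridCube h P)) := by
          calc gridAvg (ν i) h P * V = 1 * (gridAvg (ν i) h P * V) := (one_mul _).symm
            _ ≤ δ i * B i * (gridAvg (ν i) h P * V) := by gcongr
            _ = δ i * (B i * gridAvg (ν i) h P * V) := by ring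
            _ ≤ δ i * (11 ^ n * ν i (gridTriple h P)) := by gcongr
            _ = _ := by rw [h5]; ring
        exact (ENNReal.mul_le_mul_iff_right hA0 hAt).1 h7
    have hsum : volume (gridCube h P \ EP) ≤ volume (gridCube h P) / 2 := by
      calc volume (gridCube h P \ EP) ≤ ∑' i, volume (⋃ R ∈ t i, gridCube h R) :=
            (measure_mono hcov).trans (measure_iUnion_le _)
        _ ≤ ∑' i, 11 ^ n * δ i * volume (gridCube h P) := ENNReal.tsum_le_tsum hbound
        _ = 11 ^ n * (∑' i, (δ i : ℝ≥0∞)) * volume (gridCube h P) := by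
            rw [ENNReal.tsum_mul_right, ENNReal.tsum_mul_left]
        _ ≤ 2⁻¹ * volume (gridCube h P) := by
            gcongr
            rw [← ENNReal.coe_tsum hδc.summable, hδc.tsum_eq]
            have : (11 : ℝ≥0) ^ n * c ≤ 2⁻¹ := by
              calc (11 : ℝ≥0) ^ n * c ≤ 11 ^ n * (2 * 11 ^ n)⁻¹ := by gcongr
                _ = 2⁻¹ := by field_simp
            have h3 : ((11 ^ n * c : ℝ≥0) : ℝ≥0∞) ≤ ((2⁻¹ : ℝ≥0) : ℝ≥0∞) := by exact_mod_cast this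
            simpa [ENNReal.coe_inv] using h3
        _ = _ := by rw [mul_comm, div_eq_mul_inv]
    have hadd : volume (gridCube h P) ≤ volume EP + volume (gridCube h P) / 2 := by
      calc volume (gridCube h P) ≤ volume (EP ∪ (gridCube h P \ EP)) :=
            measure_mono fun x hx => by by_cases hxE : x ∈ EP <;> simp [hx, hxE]
        _ ≤ volume EP + volume (gridCube h P \ EP) := measure_union_le _ _
        _ ≤ _ := by gcongr
    have hvt := volume_gridCube_ne_top hh P
    have h8 : volume (gridCube h P) / 2 ≤ volume EP := by
      have h9 : volume (gridCube h P) / 2 + volume (gridCube h P) / 2 ≤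
          volume EP + volume (gridCube h P) / 2 := by rwa [ENNReal.add_halves]
      exact (ENNReal.add_le_add_iff_right (ENNReal.div_ne_top hvt two_ne_zero)).1 h9
    calc volume (gridCube h P) = 2 * (volume (gridCube h P) / 2) :=
          (ENNReal.mul_div_cancel two_ne_zero (by simp)).symm
      _ ≤ _ := by gcongr
  · intro d a i
    obtain ⟨x, rfl⟩ := hrep d a
    obtain ⟨e, he, h1, -, h3⟩ := haltParent_gridIndex (halt := halt) h d x
    rw [h1]
    rcases h3 with rfl | h3
    · have hB1 : (1 : ℝ≥0∞) ≤ B i := by exact_mod_cast le_max_left 1 (δ i)⁻¹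
      exact le_mul_of_one_le_left' hB1
    · simp only [h_halt, not_exists, not_lt] at h3
      exact h3 i

/-! ### Averages over cubes -/

theorem cubeAverage_eq {n : ℕ} {p : ℝ} (hp : 1 ≤ p) (Q : Set (Euc n)) (f : Euc n → ℂ) :
    cubeAverage (ENNReal.ofReal p) Q f = ((∫⁻ x in Q, ‖f x‖ₑ ^ p) / volume Q) ^ (1 / p) := by
  rw [cubeAverage, eLpNorm_eq_lintegral_rpow_enorm_toReal (by simp; linarith) (by simp),
    ENNReal.toReal_ofReal (by linarith), lintegral_smul_measure, ENNReal.div_eq_inv_mul,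
    smul_eq_mul]

theorem rpow_le_self_of_one_le {c : ℝ≥0∞} (hc : 1 ≤ c) {t : ℝ} (ht : t ≤ 1) : c ^ t ≤ c := by
  simpa using ENNReal.rpow_le_rpow_of_exponent_le hc ht

theorem cubeAverage_le_of_subset {n : ℕ} {p : ℝ} (hp : 1 ≤ p) {Q Q' : Set (Euc n)}
    (hQ : Q ⊆ Q') {c : ℝ≥0∞} (hc : 1 ≤ c) (hct : c ≠ ∞) (hQ' : volume Q' ≤ c * volume Q)
    (f : Euc n → ℂ) :
    cubeAverage (ENNReal.ofReal p) Q f ≤ c * cubeAverage (ENNReal.ofReal p) Q' f := by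
  rw [cubeAverage_eq hp, cubeAverage_eq hp]
  have hp0 : 0 ≤ 1 / p := by positivity
  have hinv : (volume Q)⁻¹ ≤ c * (volume Q')⁻¹ := by
    have hc0 : c ≠ 0 := (zero_lt_one.trans_le hc).ne'
    rw [← ENNReal.inv_le_inv, ENNReal.mul_inv (Or.inl hc0) (Or.inl hct), inv_inv, inv_inv]
    rwa [mul_comm, ← div_eq_mul_inv, ENNReal.div_le_iff_le_mul (Or.inl hc0) (Or.inl hct), mul_comm]
  calc ((∫⁻ x in Q, ‖f x‖ₑ ^ p) / volume Q) ^ (1 / p)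
      ≤ (c * ((∫⁻ x in Q', ‖f x‖ₑ ^ p) / volume Q')) ^ (1 / p) := by
        refine ENNReal.rpow_le_rpow ?_ hp0
        rw [div_eq_mul_inv, div_eq_mul_inv, mul_left_comm]
        gcongr
    _ = c ^ (1 / p) * ((∫⁻ x in Q', ‖f x‖ₑ ^ p) / volume Q') ^ (1 / p) :=
        ENNReal.mul_rpow_of_nonneg _ _ hp0
    _ ≤ c * _ := by
        gcongr
        exact rpow_le_self_of_one_le hc (by rw [div_le_one (by linarith)]; exact hp)

theorem cubeAverage_mono_exponent {n : ℕ} {p q : ℝ≥0∞} (hpq : p ≤ q) {Q : Set (Euc n)}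
    (hQ0 : volume Q ≠ 0) (hQt : volume Q ≠ ∞) {f : Euc n → ℂ} (hf : AEStronglyMeasurable f volume) :
    cubeAverage p Q f ≤ cubeAverage q Q f := by
  have : IsProbabilityMeasure ((volume Q)⁻¹ • (volume : Measure (Euc n)).restrict Q) :=
    ⟨by simp [ENNReal.inv_mul_cancel hQ0 hQt]⟩
  exact eLpNorm_le_eLpNorm_of_exponent_le hpq (hf.restrict.smul_measure _)

theorem cubeAverage_lt_top {n : ℕ} (p : ℝ≥0∞) {Q : Set (Euc n)}
    (hQ0 : volume Q ≠ 0) (hQt : volume Q ≠ ∞) {f : Euc n → ℂ} (hf : MemLp f ∞ volume) :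
    cubeAverage p Q f < ∞ := by
  refine (cubeAverage_mono_exponent le_top hQ0 hQt hf.1).trans_lt ?_
  have hac : ((volume Q)⁻¹ • (volume : Measure (Euc n)).restrict Q) ≪ volume :=
    (Measure.smul_absolutelyContinuous).trans Measure.restrict_le_self.absolutelyContinuous
  exact (eLpNormEssSup_mono_measure f hac).trans_lt (by simpa using hf.2)

/-! ### Shifted dyadic cubes containing triples of grid cubes -/

/-- The shifted dyadic cube of side `8 * 2 ^ (i - d)` that contains the triple of the grid cube of
side `2 ^ (i - d)` and index `a`. -/
noncomputable def dyadicHull {n : ℕ} (i : ℤ) (P : ℕ × (Fin n → ℤ)) : Set (Euc n) :=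
  halfOpenCube (fun j => (2 : ℝ) ^ (i - P.1 + 3) *
    ((((3 * (P.2 j - 1)) / 8) / 3 : ℤ) + (((3 * (P.2 j - 1)) / 8) % 3 : ℤ) / 3))
    ((2 : ℝ) ^ (i - P.1 + 3))

theorem isDyadicCube_dyadicHull {n : ℕ} (i : ℤ) (P : ℕ × (Fin n → ℤ)) :
    IsDyadicCube (dyadicHull i P) := by
  have hmod : ∀ j, (((3 * (P.2 j - 1)) / 8) % 3).toNat < 3 := fun j => by omega
  refine ⟨fun j => ⟨_, hmod j⟩, i - P.1 + 3, fun j => ((3 * (P.2 j - 1)) / 8) / 3, ?_⟩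
  ext x
  simp only [dyadicHull, halfOpenCube, Set.mem_ofPred_eq]
  refine forall_congr' fun j => ?_
  have h1 : (((((3 * (P.2 j - 1)) / 8) % 3).toNat : ℕ) : ℝ) =
      (((3 * (P.2 j - 1)) / 8 % 3 : ℤ) : ℝ) := by
    have : 0 ≤ (3 * (P.2 j - 1)) / 8 % 3 := by omega
    exact_mod_cast Int.toNat_of_nonneg this
  rw [h1]
  refine and_congr Iff.rfl ?_
  rw [← mul_add_one]
  ring_nf

theorem two_zpow_div {i : ℤ} {d : ℕ} : (2 : ℝ) ^ i / 2 ^ d = 2 ^ (i - d) := by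
  rw [zpow_sub₀ two_ne_zero, zpow_natCast]

/-- The one-third trick. The shifted grids of side `8 * s` together allow as corners all multiples
of `8 * s / 3`. The largest such multiple below the corner of the triple misses it by at most `7 * s
/ 3`, which leaves room for the length `3 * s`. Quotient and remainder modulo `3` give the index and
the shift. -/
theorem gridTriple_subset_dyadicHull {n : ℕ} (i : ℤ) (P : ℕ × (Fin n → ℤ)) :
    gridTriple ((2 : ℝ) ^ i) P ⊆ dyadicHull i P := by
  rw [gridTriple_eq (by positivity), dyadicHull, two_zpow_div]
  intro x hx j
  obtain ⟨h1, h2⟩ := hx j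
  have h3 : (2 : ℝ) ^ (i - (P.1 : ℤ) + 3) = 8 * 2 ^ (i - (P.1 : ℤ)) := by
    rw [zpow_add₀ two_ne_zero]; norm_num; ring
  rw [h3]
  set s : ℝ := 2 ^ (i - (P.1 : ℤ)) with hs
  have hs0 : 0 < s := by positivity
  set u := P.2 j - 1 with hu
  have hu' : (P.2 j : ℝ) - 1 = (u : ℝ) := by rw [hu]; push_cast; ring
  have h4 : (((3 * u) / 8 / 3 : ℤ) : ℝ) + ((3 * u / 8 % 3 : ℤ) : ℝ) / 3 = ((3 * u / 8 : ℤ) : ℝ) / 3 := by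
    have := Int.mul_ediv_add_emod (3 * u / 8) 3
    have h5 : (3 : ℝ) * ((3 * u / 8 / 3 : ℤ) : ℝ) + ((3 * u / 8 % 3 : ℤ) : ℝ) = ((3 * u / 8 : ℤ) : ℝ) := by
      exact_mod_cast this
    linarith
  have h6 : (8 : ℝ) * ((3 * u / 8 : ℤ) : ℝ) ≤ 3 * u := by
    have : 8 * (3 * u / 8) ≤ 3 * u := by omega
    exact_mod_cast this
  have h7 : (3 : ℝ) * u ≤ 8 * ((3 * u / 8 : ℤ) : ℝ) + 7 := by
    have : 3 * u ≤ 8 * (3 * u / 8) + 7 := by omega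
    exact_mod_cast this
  dsimp only at h1 h2 ⊢
  rw [hu'] at h1 h2
  rw [h4]
  constructor <;> nlinarith

theorem volume_dyadicHull {n : ℕ} (i : ℤ) (P : ℕ × (Fin n → ℤ)) :
    volume (dyadicHull i P) = 8 ^ n * volume (gridCube ((2 : ℝ) ^ i) P) := by
  have h3 : (2 : ℝ) ^ (i - (P.1 : ℤ) + 3) = 8 * 2 ^ (i - (P.1 : ℤ)) := by
    rw [zpow_add₀ two_ne_zero]; norm_num; ring
  rw [dyadicHull, volume_halfOpenCube, volume_gridCube (by positivity), two_zpow_div, h3,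
    ENNReal.ofReal_mul (by norm_num), mul_pow]
  simp

/-! ### Sparse domination of all grid forms -/

/-- The indices of the cubes of depth `d` inside `[-h, h) ^ n`. -/
noncomputable def boxIndices (n d : ℕ) : Finset (Fin n → ℤ) :=
  Fintype.piFinset fun _ => Finset.Ico (-2 ^ d) (2 ^ d)

/-- The form `∑ |R| ⟨f⟩_{p,3R} ⟨g⟩_{q,3R}` over the cubes `R ⊆ [-h, h) ^ n` of depth `d`. -/
noncomputable def gridForm {n : ℕ} (h : ℝ) (d : ℕ) (p q : ℝ≥0∞) (f g : Euc n → ℂ) : ℝ≥0∞ :=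
  ∑ a ∈ boxIndices n d, volume (gridCube h (d, a)) * cubeAverage p (gridTriple h (d, a)) f *
    cubeAverage q (gridTriple h (d, a)) g

theorem cubeAverage_gridTriple_le {n : ℕ} {p : ℝ} (hp : 1 ≤ p) {h : ℝ} (hh : 0 < h)
    (f : Euc n → ℂ) {P R : ℕ × (Fin n → ℤ)} {B : ℝ≥0} (hB : 1 ≤ B)
    (hPR : gridAvg (volume.withDensity fun x => ‖f x‖ₑ ^ p) h R ≤
      B * gridAvg (volume.withDensity fun x => ‖f x‖ₑ ^ p) h P) :
    cubeAverage (ENNReal.ofReal p) (gridTriple h R) f ≤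
      B * cubeAverage (ENNReal.ofReal p) (gridTriple h P) f := by
  have hp0 : 0 ≤ 1 / p := by positivity
  have key : ∀ P : ℕ × (Fin n → ℤ),
      (∫⁻ x in gridTriple h P, ‖f x‖ₑ ^ p) / volume (gridTriple h P) =
      gridAvg (volume.withDensity fun x => ‖f x‖ₑ ^ p) h P * (3 ^ n)⁻¹ := by
    intro P
    rw [gridAvg, withDensity_apply _ (measurableSet_gridTriple hh P), volume_gridTriple hh,
      div_eq_mul_inv, div_eq_mul_inv, ENNReal.mul_inv (by simp) (by simp)]
    ring
  rw [cubeAverage_eq hp, cubeAverage_eq hp, key, key]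
  calc (gridAvg (volume.withDensity fun x => ‖f x‖ₑ ^ p) h R * (3 ^ n)⁻¹) ^ (1 / p)
      ≤ (B * (gridAvg (volume.withDensity fun x => ‖f x‖ₑ ^ p) h P * (3 ^ n)⁻¹)) ^ (1 / p) := by
        rw [← mul_assoc]; gcongr
    _ = (B : ℝ≥0∞) ^ (1 / p) *
        (gridAvg (volume.withDensity fun x => ‖f x‖ₑ ^ p) h P * (3 ^ n)⁻¹) ^ (1 / p) :=
        ENNReal.mul_rpow_of_nonneg _ _ hp0
    _ ≤ _ := by
        gcongr
        exact rpow_le_self_of_one_le (by exact_mod_cast hB)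
          (by rw [div_le_one (by linarith)]; exact hp)

theorem sparseForm_lt_top {n : ℕ} {S : Set (Set (Euc n))} (hS : S.Finite)
    (hvol : ∀ Q ∈ S, volume Q ≠ 0 ∧ volume Q ≠ ∞) (p q : ℝ≥0∞) {f g : Euc n → ℂ}
    (hf : MemLp f ∞ volume) (hg : MemLp g ∞ volume) : sparseForm S p q f g < ∞ := by
  have := hS.fintype
  rw [sparseForm, tsum_fintype]
  refine ENNReal.sum_lt_top.2 fun Q _ => ?_
  obtain ⟨h0, ht⟩ := hvol Q Q.2
  exact ENNReal.mul_lt_top (ENNReal.mul_lt_top ht.lt_top (cubeAverage_lt_top p h0 ht hf))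
    (cubeAverage_lt_top q h0 ht hg)

theorem sparseForm_mono {n : ℕ} {S : Set (Set (Euc n))}
    (hvol : ∀ Q ∈ S, volume Q ≠ 0 ∧ volume Q ≠ ∞) {p q p' q' : ℝ≥0∞} (hp : p ≤ p') (hq : q ≤ q')
    {f g : Euc n → ℂ} (hf : AEStronglyMeasurable f volume) (hg : AEStronglyMeasurable g volume) :
    sparseForm S p q f g ≤ sparseForm S p' q' f g := by
  refine ENNReal.tsum_le_tsum fun Q => ?_
  obtain ⟨h0, ht⟩ := hvol Q Q.2
  gcongr
  · exact cubeAverage_mono_exponent hp h0 ht hf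
  · exact cubeAverage_mono_exponent hq h0 ht hg

/-- The sum of the volumes of the cubes of one generation with a given ancestor. -/
theorem sum_volume_le {n : ℕ} {h : ℝ} (hh : 0 < h) (d : ℕ) (s : Finset (Fin n → ℤ))
    (V : Set (Euc n)) (hs : ∀ a ∈ s, gridCube h (d, a) ⊆ V) :
    ∑ a ∈ s, volume (gridCube h (d, a)) ≤ volume V := by
  rw [← measure_biUnion_finset]
  · exact measure_mono (Set.iUnion₂_subset hs)
  · intro a _ b _ hab
    refine Set.disjoint_left.2 fun x hx hx' => hab ?_
    exact (show _ = a from hx).symm.trans hx'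
  · exact fun a _ => measurableSet_gridCube hh _

/-- Each cube is charged to its stopping parent, whose averages control its own, and cubes of one
depth with the same parent are disjoint subsets of it. The collection consists of the hulls of these
parents and is chosen before `p`, `q` and `d`. -/
theorem exists_sparse_domination (n : ℕ) :
    ∃ C : ℚ → ℚ → ℝ≥0, ∀ (i : ℤ) (f g : Euc n → ℂ), MemLp f ∞ volume →
      MemLp g ∞ volume → ∀ D : ℕ,
    ∃ S : Set (Set (Euc n)), IsSparse (1 / (4 * 8 ^ n)) S ∧ S.Finite ∧
      (∀ Q ∈ S, volume Q ≠ 0 ∧ volume Q ≠ ∞) ∧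
      ∀ p q : ℚ, 1 ≤ p → 1 ≤ q → ∀ d ≤ D,
        gridForm ((2 : ℝ) ^ i) d (ENNReal.ofReal p) (ENNReal.ofReal q) f g ≤
          C p q * sparseForm S (ENNReal.ofReal p) (ENNReal.ofReal q) f g := by
  classical
  obtain ⟨B, hB1, hB⟩ := exists_stopping_family n (ℚ ⊕ ℚ)
  refine ⟨fun p q => B (.inl p) * B (.inr q) * (8 ^ n * 8 ^ n) * 2, ?_⟩
  intro i f g hf hg D
  set h : ℝ := 2 ^ i with hh_def
  have hh : 0 < h := by positivity
  -- for exponents below `1` the zero measure is used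
  set ν : ℚ ⊕ ℚ → Measure (Euc n) := Sum.elim
    (fun p => if 1 ≤ p then volume.withDensity fun x => ‖f x‖ₑ ^ (p : ℝ) else 0)
    (fun q => if 1 ≤ q then volume.withDensity fun x => ‖g x‖ₑ ^ (q : ℝ) else 0) with hν
  have hfin : ∀ (u : Euc n → ℂ), MemLp u ∞ volume → ∀ (p : ℚ), 1 ≤ p → ∀ P,
      (volume.withDensity fun x => ‖u x‖ₑ ^ (p : ℝ)) (gridTriple h P) ≠ ∞ := by
    intro u hu p hp P
    have hp' : (1 : ℝ) ≤ p := by exact_mod_cast hp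
    rw [withDensity_apply _ (measurableSet_gridTriple hh P)]
    have hvt : volume (gridTriple h P) ≠ ∞ := by
      rw [volume_gridTriple hh]
      exact ENNReal.mul_ne_top (by simp) (volume_gridCube_ne_top hh P)
    have : Fact (volume (gridTriple h P) < ∞) := ⟨hvt.lt_top⟩
    have hup : MemLp u (ENNReal.ofReal p) (volume.restrict (gridTriple h P)) :=
      (hu.restrict _).mono_exponent le_top
    have := (eLpNorm_lt_top_iff_lintegral_rpow_enorm_lt_top (by simp; linarith) (by simp)).1 hup.2
    rw [ENNReal.toReal_ofReal (by linarith)] at this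
    exact this.ne
  obtain ⟨par, E, hEd, hEm, hpar, hparE, havg⟩ := hB ν h hh (by
    rintro (p | p) P
    · by_cases hp : 1 ≤ p
      · simpa [hν, hp] using hfin f hf p hp P
      · simp [hν, hp]
    · by_cases hp : 1 ≤ p
      · simpa [hν, hp] using hfin g hg p hp P
      · simp [hν, hp]) D
  set T : Finset (ℕ × (Fin n → ℤ)) :=
    (Finset.range (D + 1)).biUnion fun d => (boxIndices n d).image (par d) with hT
  have hTE : ∀ P ∈ T, volume (gridCube h P) ≤ 2 * volume (E P) := by
    intro P hP
    simp only [hT, Finset.mem_biUnion, Finset.mem_range, Finset.mem_image] at hP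
    obtain ⟨d, hd, a, -, rfl⟩ := hP
    exact hparE d (by omega) a
  set S : Finset (Set (Euc n)) := T.image (dyadicHull i) with hS
  have hSvol : ∀ Q ∈ (S : Set (Set (Euc n))), volume Q ≠ 0 ∧ volume Q ≠ ∞ := by
    intro Q hQ
    obtain ⟨P, -, rfl⟩ := Finset.mem_image.1 hQ
    rw [volume_dyadicHull]
    exact ⟨mul_ne_zero (by simp) (volume_gridCube_pos hh P),
      ENNReal.mul_ne_top (by simp) (volume_gridCube_ne_top hh P)⟩
  have hcubehull : ∀ P : ℕ × (Fin n → ℤ), gridCube h P ⊆ dyadicHull i P := fun P =>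
    (gridCube_subset_gridTriple h P).trans (gridTriple_subset_dyadicHull i P)
  refine ⟨S, ⟨?_, ?_⟩, S.finite_toSet, hSvol, ?_⟩
  · intro Q hQ
    obtain ⟨P, -, rfl⟩ := Finset.mem_image.1 hQ
    exact isDyadicCube_dyadicHull i P
  · have hch : ∀ Q : Set (Euc n), ∃ P, Q ∈ S → P ∈ T ∧ dyadicHull i P = Q := by
      intro Q
      by_cases hQ : Q ∈ S
      · obtain ⟨P, hP, hPQ⟩ := Finset.mem_image.1 hQ
        exact ⟨P, fun _ => ⟨hP, hPQ⟩⟩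
      · exact ⟨(0, 0), fun h => absurd h hQ⟩
    -- Several stopping cubes may share a hull; one representative suffices to witness sparsity.
    choose pre hpre using hch
    refine ⟨fun Q => E (pre Q), ?_, ?_⟩
    · intro Q hQ Q' hQ' hne
      refine hEd fun heq => hne ?_
      rw [← (hpre Q hQ).2, ← (hpre Q' hQ').2, heq]
    · intro Q hQ
      obtain ⟨hPT, hPQ⟩ := hpre Q hQ
      refine ⟨(hEm _).1, ?_, ?_⟩
      · conv_rhs => rw [← hPQ]
        exact (hEm _).2.trans (hcubehull _)
      · have h1 := hTE _ hPT
        have h2 : volume Q = 8 ^ n * volume (gridCube h (pre Q)) := by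
          conv_lhs => rw [← hPQ]
          exact volume_dyadicHull i _
        have h3 := volume_gridCube_pos hh (pre Q)
        have h4 := volume_gridCube_ne_top hh (pre Q)
        set v := volume (gridCube h (pre Q))
        have h5 : ENNReal.ofReal (1 / (4 * 8 ^ n)) * volume Q = v / 4 := by
          rw [h2, ENNReal.ofReal_div_of_pos (by positivity), ENNReal.ofReal_mul (by norm_num),
            ENNReal.ofReal_pow (by norm_num)]
          simp only [ENNReal.ofReal_one, ENNReal.ofReal_ofNat, one_div]
          rw [ENNReal.mul_inv (by simp) (by simp), ← mul_assoc, mul_assoc (4⁻¹),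
            ENNReal.inv_mul_cancel (by simp) (by simp), mul_one, mul_comm, div_eq_mul_inv]
        -- The factor `4` in the sparsity constant, where the stopping time gives `2`, provides the
        -- strict inequality.
        have h6 : v / 4 < v / 2 := by
          rw [div_eq_mul_inv, div_eq_mul_inv]
          refine ENNReal.mul_lt_mul_right h3 h4 ?_
          rw [ENNReal.inv_lt_inv]
          norm_num
        have h7 : v / 2 ≤ volume (E (pre Q)) :=
          ENNReal.div_le_of_le_mul' h1
        change ENNReal.ofReal (1 / (4 * 8 ^ n)) * volume Q < _
        rw [h5]
        exact h6.trans_le h7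
  · intro p q hp hq d hd
    have hp' : (1 : ℝ) ≤ p := by exact_mod_cast hp
    have hq' : (1 : ℝ) ≤ q := by exact_mod_cast hq
    set F : ℕ × (Fin n → ℤ) → ℝ≥0∞ := fun P =>
      cubeAverage (ENNReal.ofReal p) (dyadicHull i P) f *
        cubeAverage (ENNReal.ofReal q) (dyadicHull i P) g with hF
    have h81 : (1 : ℝ≥0∞) ≤ 8 ^ n := one_le_pow₀ (by norm_num)
    have hhull : ∀ (r : ℝ), 1 ≤ r → ∀ (u : Euc n → ℂ) (P : ℕ × (Fin n → ℤ)), cubeAverage (ENNReal.ofReal r) (gridTriple h P) u ≤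
        8 ^ n * cubeAverage (ENNReal.ofReal r) (dyadicHull i P) u := by
      intro r hr u P
      refine cubeAverage_le_of_subset hr (gridTriple_subset_dyadicHull i P) h81 (by simp) ?_ u
      rw [volume_dyadicHull]
      gcongr
      exact gridCube_subset_gridTriple h P
    set K : ℝ≥0∞ := B (.inl p) * B (.inr q) * (8 ^ n * 8 ^ n) with hK
    have hone : ∀ a ∈ boxIndices n d,
        volume (gridCube h (d, a)) * cubeAverage (ENNReal.ofReal p) (gridTriple h (d, a)) f *
          cubeAverage (ENNReal.ofReal q) (gridTriple h (d, a)) g ≤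
        K * (volume (gridCube h (d, a)) * F (par d a)) := by
      intro a _
      have h1 : cubeAverage (ENNReal.ofReal p) (gridTriple h (d, a)) f ≤
          B (.inl p) * cubeAverage (ENNReal.ofReal p) (gridTriple h (par d a)) f := by
        refine cubeAverage_gridTriple_le hp' hh f (hB1 _) ?_
        simpa [hν, hp] using havg d a (.inl p)
      have h2 : cubeAverage (ENNReal.ofReal q) (gridTriple h (d, a)) g ≤
          B (.inr q) * cubeAverage (ENNReal.ofReal q) (gridTriple h (par d a)) g := by
        refine cubeAverage_gridTriple_le hq' hh g (hB1 _) ?_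
        simpa [hν, hq] using havg d a (.inr q)
      calc _ ≤ volume (gridCube h (d, a)) *
            (B (.inl p) * (8 ^ n * cubeAverage (ENNReal.ofReal p) (dyadicHull i (par d a)) f)) *
            (B (.inr q) * (8 ^ n * cubeAverage (ENNReal.ofReal q) (dyadicHull i (par d a)) g)) := by
              gcongr
              · exact h1.trans (by gcongr; exact hhull p hp' f _)
              · exact h2.trans (by gcongr; exact hhull q hq' g _)
        _ = _ := by simp only [hF, hK]; ring
    have hgroup : ∑ a ∈ boxIndices n d, volume (gridCube h (d, a)) * F (par d a) ≤
        ∑ P ∈ T, volume (gridCube h P) * F P := by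
      have hmaps : ∀ a ∈ boxIndices n d, par d a ∈ T := fun a ha => by
        simp only [hT, Finset.mem_biUnion, Finset.mem_range, Finset.mem_image]
        exact ⟨d, by omega, a, ha, rfl⟩
      rw [← Finset.sum_fiberwise_of_maps_to hmaps]
      refine Finset.sum_le_sum fun P _ => ?_
      have : ∑ a ∈ boxIndices n d with par d a = P, volume (gridCube h (d, a)) * F (par d a) =
          (∑ a ∈ boxIndices n d with par d a = P, volume (gridCube h (d, a))) * F P := by
        rw [Finset.sum_mul]
        refine Finset.sum_congr rfl fun a ha => ?_
        rw [(Finset.mem_filter.1 ha).2]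
      rw [this]
      gcongr
      refine sum_volume_le hh d _ _ fun a ha => ?_
      rw [← (Finset.mem_filter.1 ha).2]
      exact hpar d a
    have hsparse : ∑ P ∈ T, volume (gridCube h P) * F P ≤
        2 * sparseForm (S : Set (Set (Euc n))) (ENNReal.ofReal p) (ENNReal.ofReal q) f g := by
      have hform : sparseForm (S : Set (Set (Euc n))) (ENNReal.ofReal p) (ENNReal.ofReal q) f g =
          ∑ Q ∈ S, volume Q * cubeAverage (ENNReal.ofReal p) Q f *
            cubeAverage (ENNReal.ofReal q) Q g :=
        S.tsum_subtype' fun Q => volume Q * cubeAverage (ENNReal.ofReal p) Q f *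
            cubeAverage (ENNReal.ofReal q) Q g
      have hmaps : ∀ P ∈ T, dyadicHull i P ∈ S := fun P hP => Finset.mem_image_of_mem _ hP
      rw [hform, Finset.mul_sum, ← Finset.sum_fiberwise_of_maps_to hmaps]
      refine Finset.sum_le_sum fun Q _ => ?_
      calc ∑ P ∈ T with dyadicHull i P = Q, volume (gridCube h P) * F P
          = (∑ P ∈ T with dyadicHull i P = Q, volume (gridCube h P)) *
            (cubeAverage (ENNReal.ofReal p) Q f * cubeAverage (ENNReal.ofReal q) Q g) := by
            rw [Finset.sum_mul]
            refine Finset.sum_congr rfl fun P hP => ?_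
            simp only [hF]
            rw [(Finset.mem_filter.1 hP).2]
        _ ≤ (2 * volume Q) *
            (cubeAverage (ENNReal.ofReal p) Q f * cubeAverage (ENNReal.ofReal q) Q g) := by
            gcongr
            -- Stopping cubes with a common hull need not be disjoint, but their sets `E P` are, and
            -- these exhaust at least half of each cube.
            calc ∑ P ∈ T with dyadicHull i P = Q, volume (gridCube h P)
                ≤ ∑ P ∈ T with dyadicHull i P = Q, 2 * volume (E P) :=
                  Finset.sum_le_sum fun P hP => hTE P (Finset.mem_filter.1 hP).1
              _ = 2 * volume (⋃ P ∈ T.filter (fun P => dyadicHull i P = Q), E P) := by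
                  rw [measure_biUnion_finset (fun P _ R _ hPR => hEd hPR) fun P _ => (hEm P).1,
                    Finset.mul_sum]
              _ ≤ 2 * volume Q := by
                  gcongr
                  refine Set.iUnion₂_subset fun P hP => ?_
                  rw [← (Finset.mem_filter.1 hP).2]
                  exact (hEm P).2.trans (hcubehull P)
        _ = _ := by ring
    calc gridForm h d (ENNReal.ofReal p) (ENNReal.ofReal q) f g
        ≤ ∑ a ∈ boxIndices n d, K * (volume (gridCube h (d, a)) * F (par d a)) :=
          Finset.sum_le_sum hone
      _ = K * ∑ a ∈ boxIndices n d, volume (gridCube h (d, a)) * F (par d a) := by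
          rw [Finset.mul_sum]
      _ ≤ K * (2 * sparseForm (S : Set (Set (Euc n))) (ENNReal.ofReal p) (ENNReal.ofReal q) f g) :=
          by gcongr; exact hgroup.trans hsparse
      _ = _ := by rw [hK]; push_cast; ring

/-! ### The Fourier transform of integrable and square integrable functions -/

theorem continuous_fourier_of_integrable {n : ℕ} {f : Euc n → ℂ} (hf : Integrable f) :
    Continuous (𝓕 f) :=
  VectorFourier.fourierIntegral_continuous Real.continuous_fourierChar
    (innerSL ℝ).continuous₂ hf

theorem norm_fourier_le {n : ℕ} (f : Euc n → ℂ) (w : Euc n) : ‖𝓕 f w‖ ≤ ∫ x, ‖f x‖ :=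
  VectorFourier.norm_fourierIntegral_le_integral_norm _ _ _ _ _

theorem integral_fourier_mul {n : ℕ} {f g : Euc n → ℂ} (hf : Integrable f) (hg : Integrable g) :
    ∫ w, 𝓕 f w * g w = ∫ x, f x * 𝓕 g x := by
  have h := VectorFourier.integral_fourierIntegral_smul_eq_flip (μ := volume) (ν := volume)
    (L := innerₗ (Euc n)) Real.continuous_fourierChar (innerSL ℝ).continuous₂ hf hg
  simp only [smul_eq_mul] at h
  refine h.trans ?_
  congr 1
  funext x
  congr 1
  rw [Real.fourier_eq]
  simp only [VectorFourier.fourierIntegral, LinearMap.flip_apply, innerₗ_apply_apply]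
  congr 1
  funext v
  rw [real_inner_comm]

/-- The `L²` Fourier transform of an integrable function is given by the Fourier integral. -/
theorem coeFn_fourier_toLp {n : ℕ} {f : Euc n → ℂ} (h1 : Integrable f) (h2 : MemLp f 2 volume) :
    (𝓕 (h2.toLp f) : Lp (α := Euc n) ℂ 2 volume) =ᵐ[volume] 𝓕 f := by
  refine ae_eq_of_integral_contDiff_smul_eq ?_ ?_ ?_
  · exact (Lp.memLp _).locallyIntegrable one_le_two
  · exact (continuous_fourier_of_integrable h1).locallyIntegrable
  · intro g hg hgs
    have hg1 : ContDiff ℝ (⊤ : ℕ∞) (fun x => (g x : ℂ)) := Complex.ofRealCLM.contDiff.comp hg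
    have hg2 : HasCompactSupport (fun x => (g x : ℂ)) := hgs.comp_left Complex.ofReal_zero
    set φ : SchwartzMap (Euc n) ℂ := hg2.toSchwartzMap hg1 with hφ
    have hφg : ∀ x, φ x = g x := fun x => rfl
    have h := congrArg (fun T => T φ) (Lp.fourier_toTemperedDistribution_eq (h2.toLp f))
    simp only [TemperedDistribution.fourier_apply, Lp.toTemperedDistribution_apply] at h
    have h3 : ∫ x, (𝓕 φ) x • (h2.toLp f) x = ∫ x, f x * 𝓕 (φ : Euc n → ℂ) x := by
      refine integral_congr_ae ?_
      filter_upwards [h2.coeFn_toLp] with x hx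
      rw [hx, SchwartzMap.fourier_coe, smul_eq_mul, mul_comm]
    rw [h3, ← integral_fourier_mul h1 φ.integrable] at h
    simp only [Complex.real_smul, ← hφg]
    simp only [smul_eq_mul] at h
    rw [← h]
    simp only [mul_comm]

theorem eLpNorm_fourier_eq {n : ℕ} {f : Euc n → ℂ} (h1 : Integrable f) (h2 : MemLp f 2 volume) :
    eLpNorm (𝓕 f) 2 volume = eLpNorm f 2 volume := by
  have h := Lp.norm_fourier_eq (h2.toLp f)
  rw [Lp.norm_toLp, Lp.norm_def, eLpNorm_congr_ae (coeFn_fourier_toLp h1 h2)] at h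
  refine (ENNReal.toReal_eq_toReal_iff' ?_ h2.2.ne).1 h
  rw [← eLpNorm_congr_ae (coeFn_fourier_toLp h1 h2)]
  exact (Lp.memLp _).2.ne

/-! ### Multiplier forms and their kernels -/

/-- The bilinear form of the Fourier multiplier with symbol `M`. -/
noncomputable def multiplierForm {n : ℕ} (M u v : Euc n → ℂ) : ℂ :=
  ∫ ξ, M ξ * 𝓕 u ξ * conj (𝓕 v ξ)

theorem integral_multiplierOp {n : ℕ} {m f g : Euc n → ℂ} (hm : MemLp (rescaled m) ∞ volume)
    (hf1 : Integrable f) (hf2 : MemLp f 2 volume) (hg1 : Integrable g) (hg2 : MemLp g 2 volume) :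
    ∫ x, multiplierOp m hm (hf2.toLp f) x * conj (g x) = multiplierForm (rescaled m) f g := by
  have h1 : ∫ x, multiplierOp m hm (hf2.toLp f) x * conj (g x) =
      inner ℂ (hg2.toLp g) (multiplierOp m hm (hf2.toLp f)) := by
    rw [L2.inner_def]
    refine integral_congr_ae ?_
    filter_upwards [hg2.coeFn_toLp] with x hx
    rw [hx, RCLike.inner_apply]
  rw [h1, ← Lp.inner_fourier_eq, multiplierOp, fourier_fourierInv_eq, L2.inner_def, multiplierForm]
  refine integral_congr_ae ?_
  filter_upwards [coeFn_fourier_toLp hf1 hf2, coeFn_fourier_toLp hg1 hg2,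
    Lp.coeFn_lpSMul (r := 2) (hm.toLp (rescaled m)) (𝓕 (hf2.toLp f)), hm.coeFn_toLp]
    with ξ h2 h3 h4 h5
  rw [RCLike.inner_apply, h3, h4]
  simp only [Pi.smul_apply', smul_eq_mul, h5, h2]

theorem multiplierForm_eq_integral {n : ℕ} {M u v : Euc n → ℂ} (hM : Integrable M)
    (hu : Integrable u) (hv : Integrable v) :
    multiplierForm M u v = ∫ x, u x * 𝓕 (fun ξ => M ξ * conj (𝓕 v ξ)) x := by
  have hvc := continuous_fourier_of_integrable hv
  have hint : Integrable fun ξ => M ξ * conj (𝓕 v ξ) := by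
    refine hM.mul_bdd (c := ∫ x, ‖v x‖) ?_ ?_
    · exact (Complex.continuous_conj.comp hvc).aestronglyMeasurable
    · filter_upwards with ξ
      rw [RCLike.norm_conj]
      exact norm_fourier_le v ξ
  rw [← integral_fourier_mul hu hint, multiplierForm]
  congr 1
  funext ξ
  ring

/-- The multiplication formula, applied to `v` and the conjugate of the modulated symbol, and then
conjugated. The modulation by `x` becomes a translation of the kernel. -/
theorem fourier_mul_conj_fourier {n : ℕ} {M v : Euc n → ℂ} (hM : Integrable M)
    (hv : Integrable v) (x : Euc n) :
    𝓕 (fun ξ => M ξ * conj (𝓕 v ξ)) x = ∫ y, conj (v y) * 𝓕 M (x - y) := by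
  have hMx : Integrable fun ξ => conj (𝐞 (-(inner ℝ ξ x : ℝ)) • M ξ) := by
    refine Integrable.congr' (f := M) hM ?_ ?_
    · refine Complex.continuous_conj.comp_aestronglyMeasurable ?_
      refine AEStronglyMeasurable.smul ?_ hM.1
      have hc : Continuous fun ξ : Euc n => -(inner ℝ ξ x : ℝ) := by fun_prop
      exact (continuous_subtype_val.comp
        (Real.continuous_fourierChar.comp hc)).aestronglyMeasurable
    · filter_upwards with ξ
      simp
  have h := integral_fourier_mul hv hMx
  have h2 := congrArg (starRingEnd ℂ) h
  rw [← integral_conj, ← integral_conj] at h2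
  calc 𝓕 (fun ξ => M ξ * conj (𝓕 v ξ)) x
      = ∫ ξ, conj (𝓕 v ξ * conj (𝐞 (-(inner ℝ ξ x : ℝ)) • M ξ)) := by
        rw [Real.fourier_eq]
        congr 1
        funext ξ
        simp only [map_mul, Complex.conj_conj, Circle.smul_def, smul_eq_mul]
        ring
    _ = _ := h2
    _ = _ := by
        congr 1
        funext y
        rw [map_mul]
        congr 1
        rw [Real.fourier_eq, ← integral_conj, Real.fourier_eq]
        congr 1
        funext ξ
        simp only [Circle.smul_def, smul_eq_mul, map_mul, Complex.conj_conj, ← mul_assoc]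
        rw [← Circle.coe_inv_eq_conj, ← Circle.coe_mul, ← AddChar.map_neg_eq_inv,
          ← AddChar.map_add_eq_mul]
        congr 3
        rw [inner_sub_right]
        ring

theorem enorm_multiplierForm_le_lintegral {n : ℕ} {M u v : Euc n → ℂ} (hM : Integrable M)
    (hu : Integrable u) (hv : Integrable v) :
    ‖multiplierForm M u v‖ₑ ≤ ∫⁻ x, ‖u x‖ₑ * ∫⁻ y, ‖v y‖ₑ * ‖𝓕 M (x - y)‖ₑ := by
  rw [multiplierForm_eq_integral hM hu hv]
  refine (enorm_integral_le_lintegral_enorm _).trans ?_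
  gcongr with x
  rw [enorm_mul, fourier_mul_conj_fourier hM hv]
  gcongr
  refine (enorm_integral_le_lintegral_enorm _).trans (le_of_eq ?_)
  congr 1
  funext y
  rw [enorm_mul, RCLike.enorm_conj]

/-! ### Restriction of the Fourier transform to sets of finite measure -/

theorem eLpNorm_one_le_of_lt {n : ℕ} {u : Euc n → ℂ} {p : ℝ} (hp1 : 1 ≤ p) {l : ℝ≥0∞}
    (hl0 : l ≠ 0) (hlt : l ≠ ∞) :
    eLpNorm ({x | l < ‖u x‖ₑ}.indicator u) 1 volume ≤
      l ^ (1 - p) * eLpNorm u (ENNReal.ofReal p) volume ^ p := by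
  have hp0 : 0 < p := by linarith
  rw [eLpNorm_eq_lintegral_rpow_enorm_toReal (p := ENNReal.ofReal p) (by simpa) (by simp),
    ENNReal.toReal_ofReal hp0.le, ← ENNReal.rpow_mul, one_div, inv_mul_cancel₀ hp0.ne',
    ENNReal.rpow_one, eLpNorm_one_eq_lintegral_enorm, ← lintegral_const_mul' _ _
      (by simp [ENNReal.rpow_eq_top_iff, hl0, hlt])]
  gcongr with x
  by_cases hx : l < ‖u x‖ₑ
  · rw [Set.indicator_of_mem (by exact hx)]
    have h0 : ‖u x‖ₑ ≠ 0 := (bot_le.trans_lt hx).ne'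
    calc ‖u x‖ₑ = ‖u x‖ₑ ^ (1 - p) * ‖u x‖ₑ ^ p := by
          rw [← ENNReal.rpow_add _ _ h0 enorm_ne_top]; simp
      _ ≤ _ := by
          gcongr 1
          rw [← neg_sub p 1, ENNReal.rpow_neg, ENNReal.rpow_neg, ENNReal.inv_le_inv]
          exact ENNReal.rpow_le_rpow hx.le (by linarith)
  · rw [Set.indicator_of_notMem (by exact hx)]
    simp

theorem eLpNorm_two_le_of_ge {n : ℕ} {u : Euc n → ℂ} {p : ℝ} (hp1 : 1 ≤ p) (hp2 : p ≤ 2)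
    {l : ℝ≥0∞} (hlt : l ≠ ∞) :
    eLpNorm ({x | l < ‖u x‖ₑ}ᶜ.indicator u) 2 volume ≤
      l ^ (1 - p / 2) * eLpNorm u (ENNReal.ofReal p) volume ^ (p / 2) := by
  have hp0 : 0 < p := by linarith
  have key : ∫⁻ x, ‖({x | l < ‖u x‖ₑ}ᶜ.indicator u) x‖ₑ ^ (2 : ℝ) ≤
      l ^ (2 - p) * ∫⁻ x, ‖u x‖ₑ ^ p := by
    rw [← lintegral_const_mul' _ _ (by simp [ENNReal.rpow_eq_top_iff, hlt, hp2])]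
    gcongr with x
    by_cases hx : l < ‖u x‖ₑ
    · rw [Set.indicator_of_notMem (by simpa using hx)]
      simp
    · rw [Set.indicator_of_mem (by exact hx)]
      calc ‖u x‖ₑ ^ (2 : ℝ) = ‖u x‖ₑ ^ (2 - p) * ‖u x‖ₑ ^ p := by
            rw [← ENNReal.rpow_add_of_nonneg _ _ (by linarith) hp0.le]; simp
        _ ≤ _ := by
            gcongr 1
            exact ENNReal.rpow_le_rpow (not_lt.1 hx) (by linarith)
  rw [eLpNorm_eq_lintegral_rpow_enorm_toReal (p := ENNReal.ofReal p) (by simpa) (by simp),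
    eLpNorm_eq_lintegral_rpow_enorm_toReal (p := 2) (by simp) (by simp),
    ENNReal.toReal_ofReal hp0.le, ENNReal.toReal_ofNat, ← ENNReal.rpow_mul]
  calc _ ≤ (l ^ (2 - p) * ∫⁻ x, ‖u x‖ₑ ^ p) ^ (1 / 2 : ℝ) := by gcongr
    _ = _ := by
        rw [ENNReal.mul_rpow_of_nonneg _ _ (by norm_num), ← ENNReal.rpow_mul]
        congr 2
        · ring
        · field_simp

/-- Bernstein's inequality in its dual form. -/
theorem eLpNorm_fourier_restrict_le {n : ℕ} {u : Euc n → ℂ} (h1 : Integrable u)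
    (h2 : MemLp u 2 volume) {A : Set (Euc n)} (hA0 : volume A ≠ 0) (hAt : volume A ≠ ∞)
    {p : ℝ} (hp1 : 1 ≤ p) (hp2 : p ≤ 2) :
    eLpNorm (𝓕 u) 2 (volume.restrict A) ≤
      2 * volume A ^ (1 / p - 1 / 2) * eLpNorm u (ENNReal.ofReal p) volume := by
  have hp0 : 0 < p := by linarith
  set a := volume A with ha
  set N := eLpNorm u (ENNReal.ofReal p) volume with hN
  have hae0 : a ^ (1 / p - 1 / 2) ≠ 0 := by
    simp [ENNReal.rpow_eq_zero_iff, hA0, hAt]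
  rcases eq_or_ne N 0 with hN0 | hN0
  · have hu0 : u =ᵐ[volume] 0 := (eLpNorm_eq_zero_iff h2.1 (by simpa)).1 hN0
    have : 𝓕 u = fun _ => 0 := by
      funext w
      rw [Real.fourier_congr_ae hu0, Real.fourier_eq]
      simp
    rw [this]
    simp
  rcases eq_or_ne N ∞ with hNt | hNt
  · rw [hNt, ENNReal.mul_top (mul_ne_zero two_ne_zero hae0)]
    exact le_top
  -- Real interpolation by one cut: the part of `u` above height `l` is handled through `L¹ → L^∞`,
  -- the part below through Plancherel. This `l` makes both bounds equal to `a ^ (1 / p - 1 / 2) *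
  -- N`.
  set l := a ^ (1 / p) * N with hl
  have ha1 : a ^ (1 / p) ≠ 0 := by simp [ENNReal.rpow_eq_zero_iff, hA0, hAt]
  have ha2 : a ^ (1 / p) ≠ ∞ := by simp [ENNReal.rpow_eq_top_iff, hA0, hAt]
  have hl0 : l ≠ 0 := mul_ne_zero ha1 hN0
  have hlt : l ≠ ∞ := ENNReal.mul_ne_top ha2 hNt
  have hms : NullMeasurableSet {x | l < ‖u x‖ₑ} volume :=
    nullMeasurableSet_lt aemeasurable_const h1.1.enorm
  -- The superlevel set is only null measurable, so it is replaced by a measurable set that agrees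
  -- with it almost everywhere.
  obtain ⟨s, hsm, hs⟩ : ∃ s, MeasurableSet s ∧ s =ᵐ[volume] {x | l < ‖u x‖ₑ} :=
    ⟨toMeasurable volume {x | l < ‖u x‖ₑ}, measurableSet_toMeasurable _ _, hms.toMeasurable_ae_eq⟩
  have hi1 : s.indicator u =ᵐ[volume] {x | l < ‖u x‖ₑ}.indicator u := indicator_ae_eq_of_ae_eq_set hs
  have hi2 : sᶜ.indicator u =ᵐ[volume] {x | l < ‖u x‖ₑ}ᶜ.indicator u :=
    indicator_ae_eq_of_ae_eq_set hs.compl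
  have hsum : 𝓕 u = 𝓕 (s.indicator u) + 𝓕 (sᶜ.indicator u) := by
    have h3 : s.indicator u + sᶜ.indicator u = u := Set.indicator_self_add_compl s u
    funext w
    have h4 := congrFun (VectorFourier.fourierIntegral_add (μ := volume) (L := innerₗ (Euc n))
      Real.continuous_fourierChar (innerSL ℝ).continuous₂ (h1.indicator hsm)
      (h1.indicator hsm.compl)) w
    rw [h3] at h4
    exact h4
  have hb1 : eLpNorm (𝓕 (s.indicator u)) 2 (volume.restrict A) ≤
      a ^ (1 / p - 1 / 2) * N := by
    have h3 := eLpNorm_le_of_ae_bound (p := 2) (μ := volume.restrict A) (f := 𝓕 (s.indicator u))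
      (C := ∫ x, ‖s.indicator u x‖) (by filter_upwards with w; exact norm_fourier_le _ w)
    have h4 : ENNReal.ofReal (∫ x, ‖s.indicator u x‖) ≤ l ^ (1 - p) * N ^ p := by
      rw [ofReal_integral_norm_eq_lintegral_enorm (h1.indicator hsm),
        ← eLpNorm_one_eq_lintegral_enorm, eLpNorm_congr_ae hi1]
      exact eLpNorm_one_le_of_lt hp1 hl0 hlt
    calc _ ≤ _ := h3
      _ ≤ a ^ (1 / 2 : ℝ) * (l ^ (1 - p) * N ^ p) := by
          gcongr
          simp [ha]
      _ = _ := by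
          rw [hl, ENNReal.mul_rpow_of_ne_top ha2 hNt, ← ENNReal.rpow_mul, mul_assoc (a ^ _),
            ← ENNReal.rpow_add _ _ hN0 hNt, ← mul_assoc, ← ENNReal.rpow_add _ _ hA0 hAt]
          rw [show 1 - p + p = 1 by ring, ENNReal.rpow_one]
          congr 2
          field_simp
          ring
  have hb2 : eLpNorm (𝓕 (sᶜ.indicator u)) 2 (volume.restrict A) ≤
      a ^ (1 / p - 1 / 2) * N := by
    calc eLpNorm (𝓕 (sᶜ.indicator u)) 2 (volume.restrict A)
        ≤ eLpNorm (𝓕 (sᶜ.indicator u)) 2 volume :=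
          eLpNorm_mono_measure _ Measure.restrict_le_self
      _ = eLpNorm (sᶜ.indicator u) 2 volume :=
          eLpNorm_fourier_eq (h1.indicator hsm.compl) (h2.indicator hsm.compl)
      _ ≤ l ^ (1 - p / 2) * N ^ (p / 2) := by
          rw [eLpNorm_congr_ae hi2]
          exact eLpNorm_two_le_of_ge hp1 hp2 hlt
      _ = _ := by
          rw [hl, ENNReal.mul_rpow_of_ne_top ha2 hNt, ← ENNReal.rpow_mul, mul_assoc (a ^ _),
            ← ENNReal.rpow_add _ _ hN0 hNt]
          rw [show 1 - p / 2 + p / 2 = 1 by ring, ENNReal.rpow_one]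
          congr 2
          field_simp
  rw [hsum]
  refine (eLpNorm_add_le ?_ ?_ one_le_two).trans ?_
  · exact (continuous_fourier_of_integrable (h1.indicator hsm)).aestronglyMeasurable
  · exact (continuous_fourier_of_integrable (h1.indicator hsm.compl)).aestronglyMeasurable
  calc _ ≤ a ^ (1 / p - 1 / 2) * N + a ^ (1 / p - 1 / 2) * N := add_le_add hb1 hb2
    _ = _ := by ring

theorem enorm_multiplierForm_le_eLpNorm {n : ℕ} {M u v : Euc n → ℂ} {A : Set (Euc n)} {c : ℝ≥0∞}
    (hct : c ≠ ∞) (hMA : ∀ ξ ∉ A, M ξ = 0) (hMc : ∀ ξ, ‖M ξ‖ₑ ≤ c) (hA : MeasurableSet A)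
    (hu : Integrable u) (hv : Integrable v) :
    ‖multiplierForm M u v‖ₑ ≤ c * (eLpNorm (𝓕 u) 2 (volume.restrict A) *
      eLpNorm (𝓕 v) 2 (volume.restrict A)) := by
  have hH := ENNReal.lintegral_mul_le_Lp_mul_Lq (volume.restrict A)
    (Real.HolderConjugate.two_two) (f := fun ξ => ‖𝓕 u ξ‖ₑ) (g := fun ξ => ‖𝓕 v ξ‖ₑ)
    (continuous_fourier_of_integrable hu).enorm.measurable.aemeasurable
    (continuous_fourier_of_integrable hv).enorm.measurable.aemeasurable
  rw [eLpNorm_eq_lintegral_rpow_enorm_toReal (by simp) (by simp),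
    eLpNorm_eq_lintegral_rpow_enorm_toReal (by simp) (by simp), ENNReal.toReal_ofNat]
  refine le_trans ?_ (mul_le_mul_right hH c)
  rw [← lintegral_const_mul' _ _ hct, ← lintegral_indicator hA]
  refine (enorm_integral_le_lintegral_enorm _).trans ?_
  gcongr with ξ
  by_cases hξ : ξ ∈ A
  · rw [Set.indicator_of_mem hξ, enorm_mul, enorm_mul, RCLike.enorm_conj, mul_assoc]
    simp only [Pi.mul_apply]
    gcongr
    exact hMc ξ
  · rw [Set.indicator_of_notMem hξ, hMA ξ hξ]
    simp

/-- Cauchy–Schwarz on the frequency support `A`, then the dual Bernstein inequality for each factor.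
-/
theorem enorm_multiplierForm_le_of_support {n : ℕ} {M u v : Euc n → ℂ} {A : Set (Euc n)}
    {c : ℝ≥0∞} (hct : c ≠ ∞) (hMA : ∀ ξ ∉ A, M ξ = 0) (hMc : ∀ ξ, ‖M ξ‖ₑ ≤ c)
    (hA : MeasurableSet A) (hA0 : volume A ≠ 0) (hAt : volume A ≠ ∞)
    (hu1 : Integrable u) (hu2 : MemLp u 2 volume) (hv1 : Integrable v) (hv2 : MemLp v 2 volume)
    {p q : ℝ} (hp1 : 1 ≤ p) (hp2 : p ≤ 2) (hq1 : 1 ≤ q) (hq2 : q ≤ 2) :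
    ‖multiplierForm M u v‖ₑ ≤ 4 * c * volume A ^ (1 / p + 1 / q - 1) *
      (eLpNorm u (ENNReal.ofReal p) volume * eLpNorm v (ENNReal.ofReal q) volume) := by
  refine (enorm_multiplierForm_le_eLpNorm hct hMA hMc hA hu1 hv1).trans ?_
  calc _ ≤ c * ((2 * volume A ^ (1 / p - 1 / 2) * eLpNorm u (ENNReal.ofReal p) volume) *
        (2 * volume A ^ (1 / q - 1 / 2) * eLpNorm v (ENNReal.ofReal q) volume)) := by
        gcongr
        · exact eLpNorm_fourier_restrict_le hu1 hu2 hA0 hAt hp1 hp2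
        · exact eLpNorm_fourier_restrict_le hv1 hv2 hA0 hAt hq1 hq2
    _ = _ := by
        rw [show 1 / p + 1 / q - 1 = (1 / p - 1 / 2) + (1 / q - 1 / 2) by ring,
          ENNReal.rpow_add _ _ hA0 hAt]
        ring

/-! ### Littlewood–Paley pieces of a multiplier -/

/-- A smooth bump function that is `1` for `‖ξ‖ ≤ 1` and `0` for `2 ≤ ‖ξ‖`. -/
noncomputable def freqCutoff (n : ℕ) : ContDiffBump (0 : Euc n) := ⟨1, 2, one_pos, one_lt_two⟩

/-- A smooth function supported in the annulus `1 / 2 ≤ ‖ξ‖ ≤ 2`. -/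
noncomputable def annulusCutoff {n : ℕ} (ξ : Euc n) : ℝ :=
  freqCutoff n ξ - freqCutoff n ((2 : ℝ) • ξ)

/-- The part of the multiplier `m` at frequencies comparable with `L`. -/
noncomputable def dyadicPiece {n : ℕ} (m : Euc n → ℂ) (L : ℝ) (ξ : Euc n) : ℂ :=
  annulusCutoff (L⁻¹ • ξ) • m ξ

theorem freqCutoff_eq_one {n : ℕ} {ξ : Euc n} (h : ‖ξ‖ ≤ 1) : freqCutoff n ξ = 1 :=
  (freqCutoff n).one_of_mem_closedBall (by simpa [freqCutoff] using h)

theorem freqCutoff_eq_zero {n : ℕ} {ξ : Euc n} (h : 2 ≤ ‖ξ‖) : freqCutoff n ξ = 0 :=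
  (freqCutoff n).zero_of_le_dist (by simpa [freqCutoff] using h)

theorem contDiff_annulusCutoff {n : ℕ} :
    ContDiff ℝ (⊤ : ℕ∞) (annulusCutoff : Euc n → ℝ) :=
  (freqCutoff n).contDiff.sub ((freqCutoff n).contDiff.comp (contDiff_const_smul (2 : ℝ)))

theorem annulusCutoff_eq_zero_of_le {n : ℕ} {ξ : Euc n} (h : ‖ξ‖ ≤ 1 / 2) :
    annulusCutoff ξ = 0 := by
  rw [annulusCutoff, freqCutoff_eq_one (by linarith), freqCutoff_eq_one, sub_self]
  rw [norm_smul, Real.norm_ofNat]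
  linarith

theorem annulusCutoff_eq_zero_of_ge {n : ℕ} {ξ : Euc n} (h : 2 ≤ ‖ξ‖) :
    annulusCutoff ξ = 0 := by
  rw [annulusCutoff, freqCutoff_eq_zero h, freqCutoff_eq_zero, sub_self]
  rw [norm_smul, Real.norm_ofNat]
  linarith

theorem exists_iteratedFDeriv_annulusCutoff_le (n j : ℕ) :
    ∃ X : ℝ, 0 ≤ X ∧ ∀ ξ : Euc n, ‖iteratedFDeriv ℝ j (annulusCutoff : Euc n → ℝ) ξ‖ ≤ X := by
  have hcs : HasCompactSupport (annulusCutoff : Euc n → ℝ) :=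
    HasCompactSupport.intro (isCompact_closedBall (0 : Euc n) 2) fun ξ hξ =>
      annulusCutoff_eq_zero_of_ge (by simpa using (not_le.1 (by simpa using hξ)).le)
  have hc : Continuous (iteratedFDeriv ℝ j (annulusCutoff : Euc n → ℝ)) :=
    contDiff_annulusCutoff.continuous_iteratedFDeriv (by exact_mod_cast le_top)
  obtain ⟨X, hX⟩ := hc.bounded_above_of_compact_support (hcs.iteratedFDeriv j)
  exact ⟨X, (norm_nonneg _).trans (hX 0), hX⟩

theorem norm_iteratedFDeriv_comp_smul_le {n : ℕ} {F : Type*} [NormedAddCommGroup F]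
    [NormedSpace ℝ F] {f : Euc n → F} (hf : ContDiff ℝ (⊤ : ℕ∞) f) (c : ℝ) (j : ℕ) (ξ : Euc n) :
    ‖iteratedFDeriv ℝ j (fun ξ => f (c • ξ)) ξ‖ ≤ |c| ^ j * ‖iteratedFDeriv ℝ j f (c • ξ)‖ := by
  have h := (c • ContinuousLinearMap.id ℝ (Euc n)).iteratedFDeriv_comp_right hf ξ (i := j)
    (by exact_mod_cast le_top)
  have h2 : (f ∘ (c • ContinuousLinearMap.id ℝ (Euc n))) = fun ξ => f (c • ξ) := rfl
  rw [h2] at h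
  rw [h]
  refine (ContinuousMultilinearMap.norm_compContinuousLinearMap_le _ _).trans ?_
  rw [Finset.prod_const, Finset.card_univ, Fintype.card_fin, mul_comm]
  have h3 : ‖c • ContinuousLinearMap.id ℝ (Euc n)‖ ≤ |c| := by
    rw [norm_smul, Real.norm_eq_abs]
    exact mul_le_of_le_one_right (abs_nonneg c) ContinuousLinearMap.norm_id_le
  gcongr
  exact le_of_eq rfl

/-- Multilinear expansion in the standard basis has `n ^ k` terms. It turns the hypotheses on
partial derivatives into bounds for the full derivative. -/
theorem norm_multilinear_le_of_single {n k : ℕ}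
    (T : ContinuousMultilinearMap ℝ (fun _ : Fin k => Euc n) ℂ) {a : ℝ} (ha : 0 ≤ a)
    (hT : ∀ γ : Fin k → Fin n, ‖T fun j => EuclideanSpace.single (γ j) (1 : ℝ)‖ ≤ a) :
    ‖T‖ ≤ (n : ℝ) ^ k * a := by
  refine T.opNorm_le_bound (by positivity) fun v => ?_
  have hv : v = fun j => ∑ l : Fin n, (v j l) • (EuclideanSpace.single l (1 : ℝ) : Euc n) := by
    funext j
    conv_lhs => rw [← (EuclideanSpace.basisFun (Fin n) ℝ).sum_repr (v j)]
    simp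
  have hsum : T v = ∑ γ : Fin k → Fin n, T fun j =>
      (v j (γ j)) • (EuclideanSpace.single (γ j) (1 : ℝ) : Euc n) := by
    conv_lhs => rw [hv]
    exact T.map_sum fun j l => (v j l) • (EuclideanSpace.single l (1 : ℝ) : Euc n)
  rw [hsum]
  refine (norm_sum_le _ _).trans ?_
  calc _ ≤ ∑ γ : Fin k → Fin n, a * ∏ j, ‖v j‖ := by
        refine Finset.sum_le_sum fun γ _ => ?_
        rw [T.map_smul_univ, norm_smul, norm_prod, mul_comm]
        gcongr with j
        · exact hT γ
        · exact PiLp.norm_apply_le _ _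
    _ = _ := by simp [mul_assoc]

section pieces

variable {n : ℕ} {α β : ℝ} {A : ℕ → ℝ} {m : Euc n → ℂ}

theorem IsMiyachiMultiplier.norm_iteratedFDeriv_le (hm : IsMiyachiMultiplier α β A m) (k : ℕ)
    {ξ : Euc n} (hξ : ξ ≠ 0) :
    ‖iteratedFDeriv ℝ k m ξ‖ ≤ (n : ℝ) ^ k * |A k| * ‖ξ‖ ^ (-β + (k : ℝ) * (α - 1)) := by
  rw [mul_assoc]
  refine norm_multilinear_le_of_single _ (by positivity) fun γ => (hm.deriv_le k γ ξ hξ).trans ?_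
  gcongr
  exact le_abs_self _

theorem dyadicPiece_eventuallyEq_zero_of_lt {L : ℝ} (hL : 0 < L) {ξ : Euc n}
    (hξ : ‖ξ‖ < L / 2) : dyadicPiece m L =ᶠ[nhds ξ] 0 := by
  have : ∀ᶠ ζ : Euc n in nhds ξ, ‖ζ‖ < L / 2 := continuous_norm.continuousAt.eventually_lt_const hξ
  filter_upwards [this] with ζ hζ
  rw [dyadicPiece, annulusCutoff_eq_zero_of_le, zero_smul, Pi.zero_apply]
  rw [norm_smul, norm_inv, Real.norm_of_nonneg hL.le, inv_mul_le_iff₀ hL]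
  linarith

theorem dyadicPiece_eq_zero_of_ge {L : ℝ} (hL : 0 < L) {ξ : Euc n}
    (hξ : 2 * L ≤ ‖ξ‖) : dyadicPiece m L ξ = 0 := by
  rw [dyadicPiece, annulusCutoff_eq_zero_of_ge, zero_smul]
  rw [norm_smul, norm_inv, Real.norm_of_nonneg hL.le, le_inv_mul_iff₀ hL]
  linarith

theorem dyadicPiece_eventuallyEq_zero_of_gt {L : ℝ} (hL : 0 < L) {ξ : Euc n}
    (hξ : 2 * L < ‖ξ‖) : dyadicPiece m L =ᶠ[nhds ξ] 0 := by
  have : ∀ᶠ ζ : Euc n in nhds ξ, 2 * L < ‖ζ‖ := continuous_norm.continuousAt.eventually_const_lt hξ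
  filter_upwards [this] with ζ hζ
  exact dyadicPiece_eq_zero_of_ge hL hζ.le

theorem IsMiyachiMultiplier.contDiff_dyadicPiece (hm : IsMiyachiMultiplier α β A m) {L : ℝ}
    (hL : 0 < L) : ContDiff ℝ (⊤ : ℕ∞) (dyadicPiece m L) := by
  rw [contDiff_iff_contDiffAt]
  intro ξ
  by_cases hξ : ξ = 0
  · refine contDiffAt_const.congr_of_eventuallyEq
      (dyadicPiece_eventuallyEq_zero_of_lt (m := m) hL (ξ := ξ) ?_)
    rw [hξ, norm_zero]
    positivity
  · have h1 : ContDiffAt ℝ (⊤ : ℕ∞) m ξ := hm.smooth.contDiffAt (isOpen_compl_singleton.mem_nhds hξ)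
    exact ((contDiff_annulusCutoff.comp (contDiff_const_smul L⁻¹)).contDiffAt).smul h1

theorem rpow_le_two_rpow_mul {L t e : ℝ} (hL : 0 < L) (h1 : L / 2 ≤ t) (h2 : t ≤ 2 * L) :
    t ^ e ≤ 2 ^ |e| * L ^ e := by
  have ht : 0 < t := by linarith
  rcases le_total 0 e with he | he
  · rw [abs_of_nonneg he, ← Real.mul_rpow two_pos.le hL.le]
    exact Real.rpow_le_rpow ht.le h2 he
  · rw [abs_of_nonpos he, Real.rpow_neg two_pos.le, ← Real.inv_rpow two_pos.le,
      ← Real.mul_rpow (by norm_num) hL.le]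
    refine Real.rpow_le_rpow_of_nonpos (by positivity) (by linarith) he

/-- Leibniz' rule. A derivative of the cutoff costs `L⁻¹ ≤ L ^ (α - 1)`, because `1 ≤ L ^ α`, so it
is no worse than a derivative of `m`. -/
theorem exists_iteratedFDeriv_dyadicPiece_le (n : ℕ) (α β : ℝ) (A : ℕ → ℝ) (N : ℕ) :
    ∃ C : ℝ, 0 ≤ C ∧ ∀ m : Euc n → ℂ, IsMiyachiMultiplier α β A m → ∀ L : ℝ, 0 < L → 1 ≤ L ^ α →
      ∀ ξ, ‖iteratedFDeriv ℝ N (dyadicPiece m L) ξ‖ ≤ C * L ^ (-β + (N : ℝ) * (α - 1)) := by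
  choose X hX0 hX using exists_iteratedFDeriv_annulusCutoff_le n
  refine ⟨∑ i ∈ Finset.range (N + 1), (N.choose i : ℝ) * X i *
    ((n : ℝ) ^ (N - i) * |A (N - i)| * 2 ^ |(-β + ((N - i : ℕ) : ℝ) * (α - 1))|),
    Finset.sum_nonneg fun i _ => by have := hX0 i; positivity, ?_⟩
  intro m hm L hL hLα ξ
  have hzero : dyadicPiece m L =ᶠ[nhds ξ] 0 → ‖iteratedFDeriv ℝ N (dyadicPiece m L) ξ‖ = 0 := by
    intro h
    have h1 := (h.iteratedFDeriv ℝ N).eq_of_nhds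
    rw [h1]
    simp
  have hRHS : 0 ≤ (∑ i ∈ Finset.range (N + 1), (N.choose i : ℝ) * X i *
    ((n : ℝ) ^ (N - i) * |A (N - i)| * 2 ^ |(-β + ((N - i : ℕ) : ℝ) * (α - 1))|)) *
      L ^ (-β + (N : ℝ) * (α - 1)) :=
    mul_nonneg (Finset.sum_nonneg fun i _ => by have := hX0 i; positivity) (by positivity)
  rcases lt_or_ge ‖ξ‖ (L / 2) with h1 | h1
  · rw [hzero (dyadicPiece_eventuallyEq_zero_of_lt hL h1)]
    exact hRHS
  rcases lt_or_ge (2 * L) ‖ξ‖ with h2 | h2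
  · rw [hzero (dyadicPiece_eventuallyEq_zero_of_gt hL h2)]
    exact hRHS
  have hξ : ξ ≠ 0 := by
    rintro rfl
    rw [norm_zero] at h1
    linarith
  have hopen : IsOpen ({0}ᶜ : Set (Euc n)) := isOpen_compl_singleton
  have hcut : ContDiff ℝ (⊤ : ℕ∞) fun ζ : Euc n => annulusCutoff (L⁻¹ • ζ) :=
    contDiff_annulusCutoff.comp (contDiff_const_smul L⁻¹)
  -- The product rule is used within the complement of the origin, since `m` need not be smooth at
  -- `0`.
  have hprod := norm_iteratedFDerivWithin_smul_le (n := N) hcut.contDiffOn hm.smooth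
    hopen.uniqueDiffOn (x := ξ) hξ (by exact_mod_cast le_top)
  rw [iteratedFDerivWithin_of_isOpen N hopen hξ] at hprod
  refine hprod.trans ?_
  rw [Finset.sum_mul]
  refine Finset.sum_le_sum fun i hi => ?_
  have hiN : i ≤ N := by simpa [Nat.lt_succ_iff] using hi
  rw [iteratedFDerivWithin_of_isOpen _ hopen hξ, iteratedFDerivWithin_of_isOpen _ hopen hξ]
  have hb1 : ‖iteratedFDeriv ℝ i (fun ζ : Euc n => annulusCutoff (L⁻¹ • ζ)) ξ‖ ≤
      X i * L ^ ((i : ℝ) * (α - 1)) := by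
    refine (norm_iteratedFDeriv_comp_smul_le contDiff_annulusCutoff _ i ξ).trans ?_
    have h3 : |L⁻¹| ^ i ≤ L ^ ((i : ℝ) * (α - 1)) := by
      rw [abs_of_pos (by positivity), mul_comm, Real.rpow_mul hL.le, Real.rpow_natCast]
      gcongr
      rw [Real.rpow_sub hL, Real.rpow_one, inv_eq_one_div]
      gcongr
    rw [mul_comm]
    have := hX0 i
    gcongr
    exact hX i _
  have hb2 : ‖iteratedFDeriv ℝ (N - i) m ξ‖ ≤ (n : ℝ) ^ (N - i) * |A (N - i)| *
      (2 ^ |(-β + ((N - i : ℕ) : ℝ) * (α - 1))| * L ^ (-β + ((N - i : ℕ) : ℝ) * (α - 1))) := by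
    refine (hm.norm_iteratedFDeriv_le (N - i) hξ).trans ?_
    gcongr
    exact rpow_le_two_rpow_mul hL h1 h2
  have hexp : L ^ (-β + (N : ℝ) * (α - 1)) =
      L ^ ((i : ℝ) * (α - 1)) * L ^ (-β + ((N - i : ℕ) : ℝ) * (α - 1)) := by
    rw [← Real.rpow_add hL, Nat.cast_sub hiN]
    congr 1
    ring
  rw [hexp]
  have := hX0 i
  calc _ ≤ (N.choose i : ℝ) * (X i * L ^ ((i : ℝ) * (α - 1))) * ((n : ℝ) ^ (N - i) * |A (N - i)| *
      (2 ^ |(-β + ((N - i : ℕ) : ℝ) * (α - 1))| * L ^ (-β + ((N - i : ℕ) : ℝ) * (α - 1)))) := by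
        gcongr
    _ = _ := by ring

/-! ### Kernel estimates -/

/-- Integration by parts: the transform of the `N`-th derivative, evaluated at the directions `z, …,
z`, is `𝓕 f z` times a factor of modulus `(2 * π * ‖z‖ ^ 2) ^ N`. The power of `2 * π` is at least
`1` and is dropped. -/
theorem norm_pow_mul_norm_fourier_le {f : Euc n → ℂ} (hf : ContDiff ℝ (⊤ : ℕ∞) f)
    (hfs : HasCompactSupport f) (N : ℕ) (z : Euc n) :
    ‖z‖ ^ N * ‖𝓕 f z‖ ≤ ∫ ξ, ‖iteratedFDeriv ℝ N f ξ‖ := by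
  rcases eq_or_ne (‖z‖ ^ N) 0 with hz | hz
  · rw [hz, zero_mul]
    exact integral_nonneg fun _ => norm_nonneg _
  have hint : ∀ k : ℕ, (k : ℕ∞) ≤ (⊤ : ℕ∞) → Integrable (iteratedFDeriv ℝ k f) := fun k _ =>
    (hf.continuous_iteratedFDeriv (by exact_mod_cast le_top)).integrable_of_hasCompactSupport
      (hfs.iteratedFDeriv k)
  have h1 := congrFun (Real.fourier_iteratedFDeriv (n := N) hf hint le_top) z
  have h2 : ‖𝓕 (iteratedFDeriv ℝ N f) z (fun _ => z)‖ ≤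
      (∫ ξ, ‖iteratedFDeriv ℝ N f ξ‖) * ‖z‖ ^ N := by
    refine (ContinuousMultilinearMap.le_opNorm _ _).trans ?_
    rw [Finset.prod_const, Finset.card_univ, Fintype.card_fin]
    gcongr
    exact VectorFourier.norm_fourierIntegral_le_integral_norm _ _ _ _ _
  rw [h1] at h2
  simp only [VectorFourier.fourierPowSMulRight_apply, Finset.prod_const, Finset.card_univ,
    Fintype.card_fin, norm_smul, norm_pow, norm_neg] at h2
  have h3 : ‖((-innerSL ℝ) z : Euc n →L[ℝ] ℝ) z‖ = ‖z‖ ^ 2 := by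
    simp
  have h4 : (1 : ℝ) ≤ ‖(2 * π * Complex.I : ℂ)‖ := by
    simp only [norm_mul, Complex.norm_I, mul_one, Complex.norm_ofNat, Complex.norm_real,
      Real.norm_eq_abs, abs_of_pos Real.pi_pos]
    linarith [Real.pi_gt_three]
  rw [h3] at h2
  have h5 : ‖z‖ ^ N * ‖𝓕 f z‖ * ‖z‖ ^ N ≤ (∫ ξ, ‖iteratedFDeriv ℝ N f ξ‖) * ‖z‖ ^ N := by
    refine le_trans ?_ h2
    calc ‖z‖ ^ N * ‖𝓕 f z‖ * ‖z‖ ^ N = 1 * ((‖z‖ ^ 2) ^ N * ‖𝓕 f z‖) := by ring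
      _ ≤ _ := by
        gcongr
        exact one_le_pow₀ h4
  exact le_of_mul_le_mul_right h5 (lt_of_le_of_ne (by positivity) hz.symm)

theorem rescaled_dyadicPiece_eq_zero {L : ℝ} (hL : 0 < L) {ξ : Euc n} (hξ : L ≤ ‖ξ‖) :
    rescaled (dyadicPiece m L) ξ = 0 := by
  refine dyadicPiece_eq_zero_of_ge hL ?_
  rw [norm_smul, Real.norm_of_nonneg (by positivity)]
  nlinarith [Real.pi_gt_three, norm_nonneg ξ]

theorem IsMiyachiMultiplier.contDiff_rescaled_dyadicPiece (hm : IsMiyachiMultiplier α β A m)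
    {L : ℝ} (hL : 0 < L) : ContDiff ℝ (⊤ : ℕ∞) (rescaled (dyadicPiece m L)) :=
  (hm.contDiff_dyadicPiece hL).comp (contDiff_const_smul (2 * π))

theorem hasCompactSupport_rescaled_dyadicPiece {L : ℝ} (hL : 0 < L) :
    HasCompactSupport (rescaled (dyadicPiece m L)) :=
  HasCompactSupport.intro (isCompact_closedBall (0 : Euc n) L) fun ξ hξ =>
    rescaled_dyadicPiece_eq_zero hL (by simpa using (not_le.1 (by simpa using hξ)).le)

/-- The derivative bound integrated over the frequency ball of radius `L`, whose volume gives the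
factor `L ^ n`. -/
theorem exists_kernel_bound (n : ℕ) (α β : ℝ) (A : ℕ → ℝ) (N : ℕ) :
    ∃ C : ℝ, 0 ≤ C ∧ ∀ m : Euc n → ℂ, IsMiyachiMultiplier α β A m → ∀ L : ℝ, 0 < L → 1 ≤ L ^ α →
      ∀ z, ‖z‖ ^ N * ‖𝓕 (rescaled (dyadicPiece m L)) z‖ ≤
        C * L ^ (n - β + (N : ℝ) * (α - 1)) := by
  obtain ⟨C, hC0, hC⟩ := exists_iteratedFDeriv_dyadicPiece_le n α β A N
  set V : ℝ := volume.real (Metric.closedBall (0 : Euc n) 1) with hV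
  refine ⟨(2 * π) ^ N * C * V, by positivity, ?_⟩
  intro m hm L hL hLα z
  have hs := hm.contDiff_rescaled_dyadicPiece hL
  have hcs := hasCompactSupport_rescaled_dyadicPiece (m := m) hL
  refine (norm_pow_mul_norm_fourier_le hs hcs N z).trans ?_
  have hbound : ∀ ξ, ‖iteratedFDeriv ℝ N (rescaled (dyadicPiece m L)) ξ‖ ≤
      (2 * π) ^ N * (C * L ^ (-β + (N : ℝ) * (α - 1))) := by
    intro ξ
    have h := norm_iteratedFDeriv_comp_smul_le (hm.contDiff_dyadicPiece hL) (2 * π) N ξ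
    rw [abs_of_pos (by positivity)] at h
    refine h.trans ?_
    gcongr
    exact hC m hm L hL hLα _
  have hsupp : ∀ ξ ∉ Metric.closedBall (0 : Euc n) L,
      ‖iteratedFDeriv ℝ N (rescaled (dyadicPiece m L)) ξ‖ = 0 := by
    intro ξ hξ
    have h1 : tsupport (rescaled (dyadicPiece m L)) ⊆ Metric.closedBall 0 L := by
      refine closure_minimal (fun ζ hζ => ?_) Metric.isClosed_closedBall
      by_contra hc
      exact hζ (rescaled_dyadicPiece_eq_zero hL (by simpa using (not_le.1 (by simpa using hc)).le))
    rw [norm_eq_zero]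
    exact Function.notMem_support.1 fun h => hξ (h1 (support_iteratedFDeriv_subset N h))
  rw [← setIntegral_eq_integral_of_forall_compl_eq_zero hsupp]
  have hVL : volume.real (Metric.closedBall (0 : Euc n) L) = L ^ n * V := by
    have := Measure.addHaar_closedBall_mul (volume : Measure (Euc n)) 0 hL.le (s := 1) zero_le_one
    rw [mul_one] at this
    rw [hV, Measure.real, this, ENNReal.toReal_mul, ENNReal.toReal_ofReal (by positivity),
      finrank_euclideanSpace_fin, Measure.real]
  have h2 := norm_setIntegral_le_of_norm_le_const (μ := volume)
    (s := Metric.closedBall (0 : Euc n) L)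
    (f := fun ξ => ‖iteratedFDeriv ℝ N (rescaled (dyadicPiece m L)) ξ‖)
    (isCompact_closedBall _ _).measure_lt_top (fun ξ _ => by rw [norm_norm]; exact hbound ξ)
  refine (le_abs_self _).trans (h2.trans (le_of_eq ?_))
  rw [hVL, show (n : ℝ) - β + N * (α - 1) = (-β + N * (α - 1)) + n by ring,
    Real.rpow_add hL _ (n : ℝ), Real.rpow_natCast L n]
  ring

end pieces

/-! ### Estimate of one Littlewood–Paley piece by grid forms -/

theorem integrable_multiplierForm {n : ℕ} {M u v : Euc n → ℂ} (hM : Integrable M)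
    (hu : Integrable u) (hv : Integrable v) :
    Integrable fun ξ => M ξ * 𝓕 u ξ * conj (𝓕 v ξ) := by
  refine (hM.mul_bdd (c := ∫ x, ‖u x‖) ?_ ?_).mul_bdd (c := ∫ x, ‖v x‖) ?_ ?_
  · exact (continuous_fourier_of_integrable hu).aestronglyMeasurable
  · filter_upwards with ξ using norm_fourier_le u ξ
  · exact (Complex.continuous_conj.comp (continuous_fourier_of_integrable hv)).aestronglyMeasurable
  · filter_upwards with ξ
    rw [RCLike.norm_conj]
    exact norm_fourier_le v ξ

theorem fourier_add_of_integrable {n : ℕ} {u v : Euc n → ℂ} (hu : Integrable u)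
    (hv : Integrable v) (ξ : Euc n) : 𝓕 (u + v) ξ = 𝓕 u ξ + 𝓕 v ξ :=
  congrFun (VectorFourier.fourierIntegral_add (μ := volume) (L := innerₗ (Euc n))
    Real.continuous_fourierChar (innerSL ℝ).continuous₂ hu hv) ξ

theorem multiplierForm_add_left {n : ℕ} {M u u' v : Euc n → ℂ} (hM : Integrable M)
    (hu : Integrable u) (hu' : Integrable u') (hv : Integrable v) :
    multiplierForm M (u + u') v = multiplierForm M u v + multiplierForm M u' v := by
  rw [multiplierForm, multiplierForm, multiplierForm,
    ← integral_add (integrable_multiplierForm hM hu hv) (integrable_multiplierForm hM hu' hv)]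
  congr 1
  funext ξ
  rw [fourier_add_of_integrable hu hu']
  ring

theorem multiplierForm_add_right {n : ℕ} {M u v v' : Euc n → ℂ} (hM : Integrable M)
    (hu : Integrable u) (hv : Integrable v) (hv' : Integrable v') :
    multiplierForm M u (v + v') = multiplierForm M u v + multiplierForm M u v' := by
  rw [multiplierForm, multiplierForm, multiplierForm,
    ← integral_add (integrable_multiplierForm hM hu hv) (integrable_multiplierForm hM hu hv')]
  congr 1
  funext ξ
  rw [fourier_add_of_integrable hv hv', map_add]
  ring

theorem multiplierForm_sum_left {n : ℕ} {M v : Euc n → ℂ} {ι : Type*} (s : Finset ι)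
    (u : ι → Euc n → ℂ) (hM : Integrable M) (hu : ∀ i ∈ s, Integrable (u i)) (hv : Integrable v) :
    multiplierForm M (∑ i ∈ s, u i) v = ∑ i ∈ s, multiplierForm M (u i) v := by
  classical
  induction s using Finset.induction_on with
  | empty =>
    rw [Finset.sum_empty, Finset.sum_empty, multiplierForm]
    have h0 : ∀ ξ, 𝓕 (0 : Euc n → ℂ) ξ = 0 := fun ξ => by
      rw [Real.fourier_eq]
      simp
    simp [h0]
  | insert i s hi ih =>
    rw [Finset.sum_insert hi, Finset.sum_insert hi, multiplierForm_add_left hM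
      (hu i (Finset.mem_insert_self i s))
      (integrable_finsetSum' s fun j hj => hu j (Finset.mem_insert_of_mem hj)) hv,
      ih fun j hj => hu j (Finset.mem_insert_of_mem hj)]

theorem gridIndex_mem_boxIndices {n : ℕ} {h : ℝ} {x : Euc n}
    (hx : gridIndex h 0 x ∈ boxIndices n 0) (d : ℕ) : gridIndex h d x ∈ boxIndices n d := by
  induction d with
  | zero => exact hx
  | succ d ih =>
    simp only [boxIndices, Fintype.mem_piFinset, Finset.mem_Ico] at ih ⊢
    intro j
    have := ih j
    rw [gridIndex_eq_div] at this
    rw [pow_succ]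
    omega

theorem abs_gridIndex_zero_sub_le {n : ℕ} {h : ℝ} {x y : Euc n}
    (hx : gridIndex h 0 x ∈ boxIndices n 0) (hy : gridIndex h 0 y ∈ boxIndices n 0) (j : Fin n) :
    |gridIndex h 0 y j - gridIndex h 0 x j| ≤ 1 := by
  simp only [boxIndices, Fintype.mem_piFinset, Finset.mem_Ico, pow_zero] at hx hy
  have h1 := hx j
  have h2 := hy j
  rw [abs_le]
  omega

theorem le_norm_sub_of_notMem_gridTriple {n : ℕ} {h : ℝ} (hh : 0 < h) {d : ℕ} {x y : Euc n}
    (hxy : y ∉ gridTriple h (d, gridIndex h d x)) : h / 2 ^ d ≤ ‖x - y‖ := by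
  simp only [gridTriple, Set.mem_ofPred_eq, not_forall, not_le] at hxy
  obtain ⟨j, hj⟩ := hxy
  have h1 : |(x - y) j| ≤ ‖x - y‖ := PiLp.norm_apply_le (x - y) j
  refine le_trans ?_ h1
  have h2 : (1 : ℝ) ≤ |2 ^ d * x j / h - 2 ^ d * y j / h| := by
    by_contra! hc
    rw [abs_lt] at hc
    have h3 := Int.floor_le (2 ^ d * x j / h)
    have h4 := Int.lt_floor_add_one (2 ^ d * x j / h)
    have h5 := Int.floor_le (2 ^ d * y j / h)
    have h6 := Int.lt_floor_add_one (2 ^ d * y j / h)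
    simp only [gridIndex] at hj
    have h7 : (⌊2 ^ d * y j / h⌋ : ℝ) - ⌊2 ^ d * x j / h⌋ < 2 := by linarith
    have h8 : (⌊2 ^ d * x j / h⌋ : ℝ) - ⌊2 ^ d * y j / h⌋ < 2 := by linarith
    have h9 : ⌊2 ^ d * y j / h⌋ - ⌊2 ^ d * x j / h⌋ < 2 := by exact_mod_cast h7
    have h10 : ⌊2 ^ d * x j / h⌋ - ⌊2 ^ d * y j / h⌋ < 2 := by exact_mod_cast h8
    rw [lt_abs] at hj
    omega
  have h3 : 2 ^ d * x j / h - 2 ^ d * y j / h = (2 ^ d / h) * (x - y) j := by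
    rw [PiLp.sub_apply]
    ring
  rw [h3, abs_mul, abs_of_pos (by positivity)] at h2
  rw [div_le_iff₀ (by positivity)]
  calc h = h * 1 := (mul_one h).symm
    _ ≤ h * (2 ^ d / h * |(x - y) j|) := by gcongr
    _ = _ := by field_simp

/-- At depth `0` the box consists of mutually neighbouring cubes, so `y` lies in the coarsest
triple; the level is where it leaves the tower of triples around `x`. -/
theorem exists_gridTriple_level {n : ℕ} {h : ℝ} {d : ℕ} {x y : Euc n}
    (hx : gridIndex h 0 x ∈ boxIndices n 0) (hy : gridIndex h 0 y ∈ boxIndices n 0)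
    (hxy : y ∉ gridTriple h (d, gridIndex h d x)) :
    ∃ l < d, y ∈ gridTriple h (l, gridIndex h l x) ∧
      y ∉ gridTriple h (l + 1, gridIndex h (l + 1) x) := by
  induction d with
  | zero => exact absurd (fun j => abs_gridIndex_zero_sub_le hx hy j) hxy
  | succ d ih =>
    by_cases hd : y ∈ gridTriple h (d, gridIndex h d x)
    · exact ⟨d, by omega, hd, hxy⟩
    · obtain ⟨l, hl, h1⟩ := ih hd
      exact ⟨l, by omega, h1⟩

/-- Decay of the kernel away from the diagonal, in terms of the grids. -/
theorem enorm_kernel_le {n : ℕ} {h : ℝ} (hh : 0 < h) {d N : ℕ} {K : Euc n → ℂ} {κ : ℝ}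
    (hK : ∀ z, ‖z‖ ^ N * ‖K z‖ ≤ κ) {x y : Euc n}
    (hx : gridIndex h 0 x ∈ boxIndices n 0) (hy : gridIndex h 0 y ∈ boxIndices n 0)
    (hxy : y ∉ gridTriple h (d, gridIndex h d x)) :
    ‖K (x - y)‖ₑ ≤ ∑ l ∈ Finset.range d, ENNReal.ofReal (κ * (2 ^ (l + 1) / h) ^ N) *
      (gridTriple h (l, gridIndex h l x)).indicator 1 y := by
  obtain ⟨l, hl, h1, h2⟩ := exists_gridTriple_level hx hy hxy
  -- At the level where `y` leaves the triples, the distance is at least the side of the next finer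
  -- cube; this one term of the sum already majorizes the kernel.
  refine le_trans ?_ (Finset.single_le_sum
    (f := fun l => ENNReal.ofReal (κ * (2 ^ (l + 1) / h) ^ N) *
      (gridTriple h (l, gridIndex h l x)).indicator 1 y) (fun _ _ => zero_le)
    (Finset.mem_range.2 hl))
  simp only [Set.indicator_of_mem h1, Pi.one_apply, mul_one]
  rw [← ofReal_norm]
  refine ENNReal.ofReal_le_ofReal ?_
  have h3 := le_norm_sub_of_notMem_gridTriple hh h2
  have h4 : (h / 2 ^ (l + 1)) ^ N * ‖K (x - y)‖ ≤ κ := by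
    refine le_trans ?_ (hK (x - y))
    gcongr
  calc ‖K (x - y)‖ = (2 ^ (l + 1) / h) ^ N * ((h / 2 ^ (l + 1)) ^ N * ‖K (x - y)‖) := by
        rw [← mul_assoc, ← mul_pow]
        have : (2 : ℝ) ^ (l + 1) / h * (h / 2 ^ (l + 1)) = 1 := by field_simp
        rw [this, one_pow, one_mul]
    _ ≤ (2 ^ (l + 1) / h) ^ N * κ := by gcongr
    _ = _ := mul_comm _ _

theorem lintegral_eq_sum_gridCube {n : ℕ} {h : ℝ} (hh : 0 < h) (d : ℕ) {F : Euc n → ℝ≥0∞}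
    (hF : ∀ x, F x ≠ 0 → gridIndex h 0 x ∈ boxIndices n 0) :
    ∫⁻ x, F x = ∑ a ∈ boxIndices n d, ∫⁻ x in gridCube h (d, a), F x := by
  rw [← lintegral_biUnion_finset]
  · refine (setLIntegral_eq_of_support_subset fun x hx => ?_).symm
    simp only [Set.mem_iUnion]
    exact ⟨_, gridIndex_mem_boxIndices (hF x hx) d, mem_gridCube_gridIndex h d x⟩
  · intro a _ b _ hab
    refine Set.disjoint_left.2 fun x hx hx' => hab ?_
    exact (show _ = a from hx).symm.trans hx'
  · exact fun a _ => measurableSet_gridCube hh _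

theorem lintegral_gridTriple_le {n : ℕ} {h : ℝ} (hh : 0 < h) {u : Euc n → ℂ}
    (hu : AEStronglyMeasurable u volume) {p : ℝ} (hp : 1 ≤ p) (P : ℕ × (Fin n → ℤ)) :
    ∫⁻ x in gridTriple h P, ‖u x‖ₑ ≤
      volume (gridTriple h P) * cubeAverage (ENNReal.ofReal p) (gridTriple h P) u := by
  have h0 : volume (gridTriple h P) ≠ 0 := by
    rw [volume_gridTriple hh]
    exact mul_ne_zero (by simp) (volume_gridCube_pos hh P)
  have ht : volume (gridTriple h P) ≠ ∞ := by
    rw [volume_gridTriple hh]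
    exact ENNReal.mul_ne_top (by simp) (volume_gridCube_ne_top hh P)
  have h1 := cubeAverage_mono_exponent (ENNReal.ofReal_le_ofReal hp) h0 ht hu
  rw [cubeAverage_eq le_rfl] at h1
  simp only [ENNReal.rpow_one, div_one] at h1
  rwa [ENNReal.div_le_iff_le_mul (Or.inl h0) (Or.inl ht), mul_comm] at h1

theorem sum_lintegral_gridTriple_le {n : ℕ} {h : ℝ} (hh : 0 < h) {f g : Euc n → ℂ}
    (hf : AEStronglyMeasurable f volume) (hg : AEStronglyMeasurable g volume)
    {p q : ℝ} (hp : 1 ≤ p) (hq : 1 ≤ q) (l : ℕ) :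
    ∑ a ∈ boxIndices n l, (∫⁻ x in gridCube h (l, a), ‖f x‖ₑ) *
        ∫⁻ y in gridTriple h (l, a), ‖g y‖ₑ ≤
      ENNReal.ofReal (9 ^ n * (h / 2 ^ l) ^ n) *
        gridForm h l (ENNReal.ofReal p) (ENNReal.ofReal q) f g := by
  rw [gridForm, Finset.mul_sum]
  refine Finset.sum_le_sum fun a _ => ?_
  calc _ ≤ (volume (gridTriple h (l, a)) *
        cubeAverage (ENNReal.ofReal p) (gridTriple h (l, a)) f) *
        (volume (gridTriple h (l, a)) *
        cubeAverage (ENNReal.ofReal q) (gridTriple h (l, a)) g) := by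
        gcongr
        · exact (lintegral_mono_set (gridCube_subset_gridTriple h _)).trans
            (lintegral_gridTriple_le hh hf hp _)
        · exact lintegral_gridTriple_le hh hg hq _
    _ = _ := by
        rw [volume_gridTriple hh, volume_gridCube hh, ENNReal.ofReal_mul (by positivity),
          ENNReal.ofReal_pow (by positivity), ENNReal.ofReal_pow (by positivity),
          show (9 : ℝ) = 3 * 3 by norm_num, ENNReal.ofReal_mul (by norm_num), mul_pow,
          ENNReal.ofReal_ofNat]
        ring

theorem sum_two_pow_pow_le (M d : ℕ) (hM : 1 ≤ M) :
    ∑ l ∈ Finset.range d, ((2 : ℝ) ^ l) ^ M ≤ (2 ^ d) ^ M := by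
  induction d with
  | zero => simp
  | succ d ih =>
    rw [Finset.sum_range_succ, pow_succ (2 : ℝ) d, mul_pow]
    have h1 : (2 : ℝ) ^ 1 ≤ 2 ^ M := pow_le_pow_right₀ one_le_two hM
    have h2 : (0 : ℝ) < (2 ^ d) ^ M := by positivity
    nlinarith

/-- The off-diagonal part of a multiplier form. -/
theorem sum_enorm_multiplierForm_far_le {n : ℕ} {h : ℝ} (hh : 0 < h) {M f g : Euc n → ℂ}
    (hM : Integrable M) (hf : Integrable f) (hg : Integrable g)
    (hfb : ∀ x, f x ≠ 0 → gridIndex h 0 x ∈ boxIndices n 0)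
    (hgb : ∀ x, g x ≠ 0 → gridIndex h 0 x ∈ boxIndices n 0) {k : ℕ} (hk : 1 ≤ k) {κ : ℝ}
    (hκ : ∀ z, ‖z‖ ^ (n + k) * ‖𝓕 M z‖ ≤ κ) {p q : ℝ} (hp : 1 ≤ p) (hq : 1 ≤ q) {b : ℝ≥0∞}
    (d : ℕ) (hb : ∀ l < d, gridForm h l (ENNReal.ofReal p) (ENNReal.ofReal q) f g ≤ b) :
    ∑ a ∈ boxIndices n d, ‖multiplierForm M ((gridCube h (d, a)).indicator f)
        ((gridTriple h (d, a))ᶜ.indicator g)‖ₑ ≤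
      ENNReal.ofReal (κ * (2 ^ (n + k) * 9 ^ n * (2 ^ d / h) ^ k)) * b := by
  have hκ0 : 0 ≤ κ := le_trans (by positivity) (hκ 0)
  set w : ℕ → ℝ≥0∞ := fun l => ENNReal.ofReal (κ * (2 ^ (l + 1) / h) ^ (n + k)) with hw
  set I : ℕ → (Fin n → ℤ) → ℝ≥0∞ := fun l a => ∫⁻ y in gridTriple h (l, a), ‖g y‖ₑ with hI
  have hImeas : ∀ l, Measurable fun x : Euc n => I l (gridIndex h l x) := fun l =>
    (measurable_of_countable (I l)).comp (measurable_gridIndex h l)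
  have hstep : ∀ a ∈ boxIndices n d, ‖multiplierForm M ((gridCube h (d, a)).indicator f)
      ((gridTriple h (d, a))ᶜ.indicator g)‖ₑ ≤
      ∫⁻ x in gridCube h (d, a), ‖f x‖ₑ * ∑ l ∈ Finset.range d, w l * I l (gridIndex h l x) := by
    intro a _
    have hmR := measurableSet_gridCube hh (d, a)
    have hmT := (measurableSet_gridTriple hh (d, a)).compl
    refine (enorm_multiplierForm_le_lintegral hM (hf.indicator hmR) (hg.indicator hmT)).trans ?_
    rw [← lintegral_indicator hmR]
    gcongr with x
    by_cases hxR : x ∈ gridCube h (d, a)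
    swap
    · simp [Set.indicator_of_notMem hxR]
    rw [Set.indicator_of_mem hxR, Set.indicator_of_mem hxR]
    by_cases hfx : f x = 0
    · simp [hfx]
    have hx := hfb x hfx
    gcongr
    have hxa : gridIndex h d x = a := hxR
    calc ∫⁻ y, ‖(gridTriple h (d, a))ᶜ.indicator g y‖ₑ * ‖𝓕 M (x - y)‖ₑ
        ≤ ∫⁻ y, ∑ l ∈ Finset.range d, w l *
            (gridTriple h (l, gridIndex h l x)).indicator (fun y => ‖g y‖ₑ) y := by
          gcongr with y
          by_cases hy : y ∈ gridTriple h (d, a)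
          · simp [hy]
          rw [Set.indicator_of_mem (by exact hy)]
          by_cases hgy : g y = 0
          · simp [hgy]
          rw [← hxa] at hy
          calc ‖g y‖ₑ * ‖𝓕 M (x - y)‖ₑ ≤ ‖g y‖ₑ * ∑ l ∈ Finset.range d, w l *
              (gridTriple h (l, gridIndex h l x)).indicator 1 y := by
                gcongr
                exact enorm_kernel_le hh hκ hx (hgb y hgy) hy
            _ = _ := by
                rw [Finset.mul_sum]
                refine Finset.sum_congr rfl fun l _ => ?_
                by_cases hyl : y ∈ gridTriple h (l, gridIndex h l x)
                · simp only [Set.indicator_of_mem hyl, Pi.one_apply]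
                  ring
                · simp only [Set.indicator_of_notMem hyl]
                  ring
      _ = ∑ l ∈ Finset.range d, w l * I l (gridIndex h l x) := by
          rw [lintegral_finsetSum']
          · refine Finset.sum_congr rfl fun l _ => ?_
            rw [lintegral_const_mul' _ _ ENNReal.ofReal_ne_top,
              lintegral_indicator (measurableSet_gridTriple hh _)]
          · intro l _
            exact (hg.1.enorm.indicator (measurableSet_gridTriple hh _)).const_mul _
  refine (Finset.sum_le_sum hstep).trans ?_
  rw [← lintegral_eq_sum_gridCube hh d (F := fun x => ‖f x‖ₑ * ∑ l ∈ Finset.range d,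
    w l * I l (gridIndex h l x)) (fun x hx => hfb x fun h0 => hx (by simp [h0]))]
  have hlevel : ∀ l < d, ∫⁻ x, ‖f x‖ₑ * I l (gridIndex h l x) ≤
      ENNReal.ofReal (9 ^ n * (h / 2 ^ l) ^ n) * b := by
    intro l hl
    rw [lintegral_eq_sum_gridCube hh l (F := fun x => ‖f x‖ₑ * I l (gridIndex h l x))
      (fun x hx => hfb x fun h0 => hx (by simp [h0]))]
    calc ∑ a ∈ boxIndices n l, ∫⁻ x in gridCube h (l, a), ‖f x‖ₑ * I l (gridIndex h l x)
        = ∑ a ∈ boxIndices n l, (∫⁻ x in gridCube h (l, a), ‖f x‖ₑ) * I l a := by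
          refine Finset.sum_congr rfl fun a _ => ?_
          rw [← lintegral_mul_const'' _ hf.1.enorm.restrict]
          refine setLIntegral_congr_fun (measurableSet_gridCube hh _) fun x hx => ?_
          have : gridIndex h l x = a := hx
          simp only [this]
      _ ≤ _ := (sum_lintegral_gridTriple_le hh hf.1 hg.1 hp hq l).trans (by gcongr; exact hb l hl)
  calc ∫⁻ x, ‖f x‖ₑ * ∑ l ∈ Finset.range d, w l * I l (gridIndex h l x)
      = ∑ l ∈ Finset.range d, w l * ∫⁻ x, ‖f x‖ₑ * I l (gridIndex h l x) := by
        simp_rw [Finset.mul_sum]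
        rw [lintegral_finsetSum']
        · refine Finset.sum_congr rfl fun l _ => ?_
          rw [← lintegral_const_mul' _ _ ENNReal.ofReal_ne_top]
          congr 1
          funext x
          ring
        · intro l _
          exact hf.1.enorm.mul ((hImeas l).const_mul _).aemeasurable
    _ ≤ ∑ l ∈ Finset.range d, ENNReal.ofReal
          (κ * (2 ^ (n + k) * 9 ^ n / h ^ k) * (2 ^ l) ^ k) * b := by
        refine Finset.sum_le_sum fun l hl => ?_
        refine (mul_le_mul_right (hlevel l (Finset.mem_range.1 hl)) _).trans (le_of_eq ?_)
        rw [← mul_assoc, hw, ← ENNReal.ofReal_mul (by positivity)]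
        congr 2
        -- The volume factor `(h / 2 ^ l) ^ n` cancels `n` of the `n + k` powers of kernel decay.
        -- The remaining `(2 ^ l / h) ^ k` grows geometrically in `l`, so the finest level
        -- dominates.
        rw [pow_succ (2 : ℝ) l, div_pow, div_pow, mul_pow, pow_add _ n k, pow_add _ n k, pow_add _ n k]
        field_simp
    _ = ENNReal.ofReal (κ * (2 ^ (n + k) * 9 ^ n / h ^ k) *
          ∑ l ∈ Finset.range d, (2 ^ l) ^ k) * b := by
        rw [← Finset.sum_mul, ← ENNReal.ofReal_sum_of_nonneg (fun _ _ => by positivity),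
          Finset.mul_sum]
    _ ≤ _ := by
        refine mul_le_mul_left (ENNReal.ofReal_le_ofReal ?_) b
        calc _ ≤ κ * (2 ^ (n + k) * 9 ^ n / h ^ k) * (2 ^ d) ^ k := by
              gcongr
              exact sum_two_pow_pow_le k d hk
          _ = _ := by
              rw [div_pow]
              ring

theorem eLpNorm_indicator_le_cubeAverage {n : ℕ} {p : ℝ} (hp : 1 ≤ p) {Q Q' : Set (Euc n)}
    (hQ : MeasurableSet Q) (hQQ : Q ⊆ Q') (h0 : volume Q' ≠ 0) (ht : volume Q' ≠ ∞)
    (u : Euc n → ℂ) :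
    eLpNorm (Q.indicator u) (ENNReal.ofReal p) volume ≤
      volume Q' ^ (1 / p) * cubeAverage (ENNReal.ofReal p) Q' u := by
  have hp0 : 0 < p := by linarith
  rw [eLpNorm_indicator_eq_eLpNorm_restrict hQ, cubeAverage_eq hp,
    eLpNorm_eq_lintegral_rpow_enorm_toReal (by simpa) (by simp), ENNReal.toReal_ofReal hp0.le,
    ← ENNReal.mul_rpow_of_nonneg _ _ (by positivity), ENNReal.mul_div_cancel h0 ht]
  gcongr

/-- The diagonal part of a multiplier form. -/
theorem sum_enorm_multiplierForm_near_le {n : ℕ} {h : ℝ} (hh : 0 < h) {M f g : Euc n → ℂ}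
    {L c : ℝ} (hL : 0 < L) (hMA : ∀ ξ, L < ‖ξ‖ → M ξ = 0) (hMc : ∀ ξ, ‖M ξ‖ ≤ c)
    (hf1 : Integrable f) (hf2 : MemLp f 2 volume) (hg1 : Integrable g) (hg2 : MemLp g 2 volume)
    {p q : ℝ} (hp1 : 1 ≤ p) (hp2 : p ≤ 2) (hq1 : 1 ≤ q) (hq2 : q ≤ 2) (d : ℕ) :
    ∑ a ∈ boxIndices n d, ‖multiplierForm M ((gridCube h (d, a)).indicator f)
        ((gridTriple h (d, a)).indicator g)‖ₑ ≤
      ENNReal.ofReal (4 * 3 ^ n * c * (volume.real (Metric.closedBall (0 : Euc n) 1) *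
        (3 * (L * (h / 2 ^ d))) ^ n) ^ (1 / p + 1 / q - 1)) *
        gridForm h d (ENNReal.ofReal p) (ENNReal.ofReal q) f g := by
  have hc0 : 0 ≤ c := (norm_nonneg _).trans (hMc 0)
  set B := Metric.closedBall (0 : Euc n) L with hB
  set V := volume.real (Metric.closedBall (0 : Euc n) 1) with hV
  have hVB : volume B = ENNReal.ofReal (L ^ n * V) := by
    have := Measure.addHaar_closedBall_mul (volume : Measure (Euc n)) 0 hL.le (s := 1) zero_le_one
    rw [mul_one, finrank_euclideanSpace_fin] at this
    rw [hB, this, ENNReal.ofReal_mul (by positivity), hV,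
      ofReal_measureReal (isCompact_closedBall _ _).measure_lt_top.ne]
  have hB0 : volume B ≠ 0 := (Metric.measure_closedBall_pos volume 0 hL).ne'
  have hBt : volume B ≠ ∞ := (isCompact_closedBall _ _).measure_lt_top.ne
  have ht0 : 0 ≤ 1 / p + 1 / q - 1 := by
    have h1 : 1 / 2 ≤ 1 / p := one_div_le_one_div_of_le (by linarith) hp2
    have h2 : 1 / 2 ≤ 1 / q := one_div_le_one_div_of_le (by linarith) hq2
    linarith
  set t := 1 / p + 1 / q - 1 with ht
  rw [gridForm, Finset.mul_sum]
  refine Finset.sum_le_sum fun a _ => ?_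
  have hmR := measurableSet_gridCube hh (d, a)
  have hmT := measurableSet_gridTriple hh (d, a)
  set T := gridTriple h (d, a) with hT
  have hT0 : volume T ≠ 0 := by
    rw [volume_gridTriple hh]
    exact mul_ne_zero (by simp) (volume_gridCube_pos hh _)
  have hTt : volume T ≠ ∞ := by
    rw [volume_gridTriple hh]
    exact ENNReal.mul_ne_top (by simp) (volume_gridCube_ne_top hh _)
  have hVT : volume T = ENNReal.ofReal ((3 * (h / 2 ^ d)) ^ n) := by
    rw [hT, gridTriple_eq hh, volume_halfOpenCube, ENNReal.ofReal_pow (by positivity)]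
  have h1 := enorm_multiplierForm_le_of_support (M := M) (A := B) (c := ENNReal.ofReal c)
    ENNReal.ofReal_ne_top (fun ξ hξ => hMA ξ (by simpa [hB] using hξ))
    (fun ξ => by rw [← ofReal_norm]; exact ENNReal.ofReal_le_ofReal (hMc ξ))
    Metric.isClosed_closedBall.measurableSet hB0 hBt (hf1.indicator hmR) (hf2.indicator hmR)
    (hg1.indicator hmT) (hg2.indicator hmT) hp1 hp2 hq1 hq2
  refine h1.trans ?_
  calc _ ≤ 4 * ENNReal.ofReal c * volume B ^ t *
        ((volume T ^ (1 / p) * cubeAverage (ENNReal.ofReal p) T f) *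
        (volume T ^ (1 / q) * cubeAverage (ENNReal.ofReal q) T g)) := by
        gcongr
        · exact eLpNorm_indicator_le_cubeAverage hp1 hmR (gridCube_subset_gridTriple h _) hT0 hTt f
        · exact eLpNorm_indicator_le_cubeAverage hq1 hmT subset_rfl hT0 hTt g
    _ = (4 * ENNReal.ofReal c * (volume B ^ t * (volume T ^ (1 / p) * volume T ^ (1 / q)))) *
        (cubeAverage (ENNReal.ofReal p) T f * cubeAverage (ENNReal.ofReal q) T g) := by ring
    -- Since `1 / p + 1 / q = t + 1`, one full power of the volume normalizes the form, and the
    -- excess `t` pairs with the frequency ball into `(volume B * volume T) ^ t`.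
    _ = (4 * ENNReal.ofReal c * (volume B ^ t * (volume T ^ t * volume T))) *
        (cubeAverage (ENNReal.ofReal p) T f * cubeAverage (ENNReal.ofReal q) T g) := by
        rw [← ENNReal.rpow_add _ _ hT0 hTt, show 1 / p + 1 / q = t + 1 by rw [ht]; ring,
          ENNReal.rpow_add _ _ hT0 hTt, ENNReal.rpow_one]
    _ = (4 * 3 ^ n * ENNReal.ofReal c * (volume B * volume T) ^ t) *
        (volume (gridCube h (d, a)) * cubeAverage (ENNReal.ofReal p) T f *
          cubeAverage (ENNReal.ofReal q) T g) := by
        rw [ENNReal.mul_rpow_of_nonneg _ _ ht0, hT, volume_gridTriple hh]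
        ring
    _ = _ := by
        congr 1
        rw [hVB, hVT, ← ENNReal.ofReal_mul (by positivity),
          ENNReal.ofReal_rpow_of_nonneg (by positivity) ht0,
          ENNReal.ofReal_mul (by positivity), ENNReal.ofReal_mul (by positivity),
          ENNReal.ofReal_mul (by positivity), ENNReal.ofReal_pow (by norm_num),
          ENNReal.ofReal_ofNat, ENNReal.ofReal_ofNat]
        congr 3
        rw [mul_pow 3 (L * _), mul_pow L, mul_pow 3]
        ring

theorem enorm_multiplierForm_le_near_add_far {n : ℕ} {h : ℝ} (hh : 0 < h) {M f g : Euc n → ℂ}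
    (hM : Integrable M) (hf : Integrable f) (hg : Integrable g)
    (hfb : ∀ x, f x ≠ 0 → gridIndex h 0 x ∈ boxIndices n 0) (d : ℕ) :
    ‖multiplierForm M f g‖ₑ ≤
      ∑ a ∈ boxIndices n d, ‖multiplierForm M ((gridCube h (d, a)).indicator f)
        ((gridTriple h (d, a)).indicator g)‖ₑ +
      ∑ a ∈ boxIndices n d, ‖multiplierForm M ((gridCube h (d, a)).indicator f)
        ((gridTriple h (d, a))ᶜ.indicator g)‖ₑ := by
  classical
  have hdec : f = ∑ a ∈ boxIndices n d, (gridCube h (d, a)).indicator f := by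
    funext x
    rw [Finset.sum_apply]
    have hterm : ∀ a, (gridCube h (d, a)).indicator f x = if gridIndex h d x = a then f x else 0 :=
      fun a => by
        by_cases hxa : gridIndex h d x = a
        · rw [if_pos hxa, Set.indicator_of_mem (show x ∈ gridCube h (d, a) from hxa)]
        · rw [if_neg hxa, Set.indicator_of_notMem (show x ∉ gridCube h (d, a) from hxa)]
    simp_rw [hterm]
    rw [Finset.sum_ite_eq]
    by_cases hfx : f x = 0
    · simp [hfx]
    · rw [if_pos (gridIndex_mem_boxIndices (hfb x hfx) d)]
  have hfi : ∀ a, Integrable ((gridCube h (d, a)).indicator f) := fun a =>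
    hf.indicator (measurableSet_gridCube hh _)
  conv_lhs => rw [hdec]
  rw [multiplierForm_sum_left _ _ hM (fun a _ => hfi a) hg, ← Finset.sum_add_distrib]
  refine (enorm_sum_le _ _).trans (Finset.sum_le_sum fun a _ => ?_)
  have hmT := measurableSet_gridTriple hh (d, a)
  have hg2 : g = (gridTriple h (d, a)).indicator g + (gridTriple h (d, a))ᶜ.indicator g :=
    (Set.indicator_self_add_compl _ g).symm
  conv_lhs => rw [hg2]
  rw [multiplierForm_add_right hM (hfi a) (hg.indicator hmT) (hg.indicator hmT.compl)]
  exact enorm_add_le _ _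

/-- The first depth with side at most `2 * σ`: by minimality its side is also at least `σ`, unless
the coarsest cubes are already small enough. -/
theorem exists_depth {h σ ρ : ℝ} (hσ : 0 < σ) (hρσ : ρ ≤ σ) {D : ℕ} (hD : h / 2 ^ D ≤ ρ) :
    ∃ d ≤ D, h / 2 ^ d ≤ 2 * σ ∧ (d = 0 ∨ σ ≤ h / 2 ^ d) := by
  classical
  have hex : ∃ d : ℕ, h / 2 ^ d ≤ 2 * σ := ⟨D, by linarith⟩
  refine ⟨Nat.find hex, Nat.find_le (by linarith), Nat.find_spec hex, ?_⟩
  rcases Nat.eq_zero_or_pos (Nat.find hex) with h0 | h0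
  · exact Or.inl h0
  · right
    obtain ⟨e, he⟩ := Nat.exists_eq_succ_of_ne_zero h0.ne'
    have h1 := Nat.find_min hex (m := e) (by omega)
    rw [he, Nat.succ_eq_add_one, pow_succ]
    rw [not_le] at h1
    have h2 : h / (2 ^ e * 2) = (h / 2 ^ e) / 2 := by rw [div_div]
    rw [h2]
    linarith

/-- Bound of one Littlewood–Paley piece by the grid forms, with geometric decay. -/
theorem exists_dyadicPiece_bound (n : ℕ) {α β : ℝ} (hα : α ≠ 0) (hαβ : 0 < α * β) (A : ℕ → ℝ)
    {p q : ℝ} (hp1 : 1 ≤ p) (hp2 : p ≤ 2) (hq1 : 1 ≤ q) (hq2 : q ≤ 2)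
    (hadm : (n : ℝ) * |α| * (1 / p + 1 / q - 1) < |β|) :
    ∃ C δ : ℝ, 0 ≤ C ∧ 0 < δ ∧ ∀ m : Euc n → ℂ, IsMiyachiMultiplier α β A m →
      ∀ f g : Euc n → ℂ, Integrable f → MemLp f 2 volume → Integrable g → MemLp g 2 volume →
      ∀ h : ℝ, 0 < h → (∀ x, f x ≠ 0 → gridIndex h 0 x ∈ boxIndices n 0) →
      (∀ x, g x ≠ 0 → gridIndex h 0 x ∈ boxIndices n 0) →
      ∀ (D : ℕ) (L : ℝ), 0 < L → 1 ≤ L ^ α → h / 2 ^ D ≤ L ^ (α - 1) →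
      ∀ b : ℝ≥0∞, (∀ d ≤ D, gridForm h d (ENNReal.ofReal p) (ENNReal.ofReal q) f g ≤ b) →
        ‖multiplierForm (rescaled (dyadicPiece m L)) f g‖ₑ ≤
          ENNReal.ofReal (C * (L ^ α) ^ (-δ)) * b := by
  set t := 1 / p + 1 / q - 1 with ht
  have ht0 : 0 ≤ t := by
    have h1 : 1 / 2 ≤ 1 / p := one_div_le_one_div_of_le (by linarith) hp2
    have h2 : 1 / 2 ≤ 1 / q := one_div_le_one_div_of_le (by linarith) hq2
    linarith
  set γ := β / α with hγ
  have hγabs : γ = |β| / |α| := by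
    rw [hγ, ← abs_div, abs_of_pos]
    rcases lt_or_gt_of_ne hα with h | h
    · exact div_pos_of_neg_of_neg (by nlinarith) h
    · exact div_pos (by nlinarith) h
  have hnt : (n : ℝ) * t < γ := by
    rw [hγabs, lt_div_iff₀ (abs_pos.2 hα)]
    linarith
  have hnt0 : 0 ≤ (n : ℝ) * t := by positivity
  -- The strict admissibility leaves room to enlarge the localization scale by `X ^ ε`. The summand
  -- `1` in the denominator covers the case `n * t = 0`.
  obtain ⟨ε, hε0, hε⟩ : ∃ ε : ℝ, 0 < ε ∧ (1 + ε) * (n * t) < γ := by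
    refine ⟨(γ - n * t) / (2 * (n * t + 1)), by have : 0 < γ - n * t := by linarith
                                                positivity, ?_⟩
    have h1 : (γ - n * t) / (2 * (n * t + 1)) * (n * t) < γ - n * t := by
      rw [div_mul_eq_mul_div, div_lt_iff₀ (by positivity)]
      nlinarith
    linarith
  -- The order of decay is chosen so that `X ^ (ε * k)` absorbs the loss `X ^ n` of the far part.
  obtain ⟨k, hk1, hk⟩ : ∃ k : ℕ, 1 ≤ k ∧ (n : ℝ) ≤ ε * k := by
    refine ⟨⌈n / ε⌉₊ + 1, by omega, ?_⟩
    have h1 := Nat.le_ceil ((n : ℝ) / ε)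
    rw [div_le_iff₀ hε0] at h1
    push_cast
    nlinarith
  obtain ⟨C₀, hC₀, hC₀b⟩ := exists_iteratedFDeriv_dyadicPiece_le n α β A 0
  obtain ⟨C₁, hC₁, hC₁b⟩ := exists_kernel_bound n α β A (n + k)
  set V := volume.real (Metric.closedBall (0 : Euc n) 1) with hV
  have hV0 : 0 ≤ V := measureReal_nonneg
  refine ⟨4 * 3 ^ n * C₀ * (V * 6 ^ n) ^ t + C₁ * (2 ^ (n + k) * 9 ^ n), γ - (1 + ε) * (n * t),
    by positivity, by linarith, ?_⟩
  intro m hm f g hf1 hf2 hg1 hg2 h hh hfb hgb D L hL hLα hD b hb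
  set X := L ^ α with hX
  have hX0 : 0 < X := by positivity
  set ρ := L ^ (α - 1) with hρ
  have hρ0 : 0 < ρ := by positivity
  have hLρ : L * ρ = X := by
    rw [hρ, hX, Real.rpow_sub hL, Real.rpow_one]
    field_simp
  have hXε : 1 ≤ X ^ ε := Real.one_le_rpow hLα hε0.le
  obtain ⟨d, hdD, hd1, hd2⟩ := exists_depth (σ := ρ * X ^ ε) (by positivity)
    (le_mul_of_one_le_right hρ0.le hXε) hD
  have hLβ : L ^ (-β) = X ^ (-γ) := by
    rw [hX, ← Real.rpow_mul hL.le, hγ]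
    congr 1
    field_simp
  set M := rescaled (dyadicPiece m L) with hMdef
  have hMint : Integrable M :=
    (hm.contDiff_rescaled_dyadicPiece hL).continuous.integrable_of_hasCompactSupport
      (hasCompactSupport_rescaled_dyadicPiece hL)
  have hMc : ∀ ξ, ‖M ξ‖ ≤ C₀ * L ^ (-β) := by
    intro ξ
    have h1 := hC₀b m hm L hL hLα ((2 * π) • ξ)
    rw [norm_iteratedFDeriv_zero, Nat.cast_zero, zero_mul, add_zero] at h1
    exact h1
  have hnear := sum_enorm_multiplierForm_near_le hh hL
    (fun ξ hξ => rescaled_dyadicPiece_eq_zero (m := m) hL hξ.le) hMc hf1 hf2 hg1 hg2 hp1 hp2 hq1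
    hq2 d
  have hnear2 : 4 * 3 ^ n * (C₀ * L ^ (-β)) * (V * (3 * (L * (h / 2 ^ d))) ^ n) ^ t ≤
      4 * 3 ^ n * C₀ * (V * 6 ^ n) ^ t * X ^ (-(γ - (1 + ε) * (n * t))) := by
    have h1 : V * (3 * (L * (h / 2 ^ d))) ^ n ≤ V * 6 ^ n * (X ^ (1 + ε)) ^ n := by
      rw [mul_assoc, ← mul_pow]
      have h2 : 3 * (L * (h / 2 ^ d)) ≤ 6 * X ^ (1 + ε) := by
        calc 3 * (L * (h / 2 ^ d)) ≤ 3 * (L * (2 * (ρ * X ^ ε))) := by gcongr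
          _ = 6 * ((L * ρ) * X ^ ε) := by ring
          _ = _ := by rw [hLρ, Real.rpow_add hX0, Real.rpow_one]
      gcongr
    have h3 : (V * (3 * (L * (h / 2 ^ d))) ^ n) ^ t ≤
        (V * 6 ^ n) ^ t * X ^ ((1 + ε) * (n * t)) := by
      refine (Real.rpow_le_rpow (by positivity) h1 ht0).trans (le_of_eq ?_)
      rw [Real.mul_rpow (by positivity) (by positivity), ← Real.rpow_natCast (X ^ (1 + ε)),
        ← Real.rpow_mul hX0.le, ← Real.rpow_mul hX0.le]
      congr 2
      ring
    calc _ ≤ 4 * 3 ^ n * (C₀ * L ^ (-β)) * ((V * 6 ^ n) ^ t * X ^ ((1 + ε) * (n * t))) := by gcongr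
      _ = 4 * 3 ^ n * C₀ * (V * 6 ^ n) ^ t * (X ^ (-γ) * X ^ ((1 + ε) * (n * t))) := by
          rw [hLβ]; ring
      _ = _ := by
          rw [← Real.rpow_add hX0]
          congr 2
          ring
  have hfar := sum_enorm_multiplierForm_far_le hh hMint hf1 hg1 hfb hgb hk1
    (hC₁b m hm L hL hLα) hp1 hq1 d (fun l hl => hb l (by omega))
  have hfar2 : d ≠ 0 → C₁ * L ^ ((n : ℝ) - β + ((n + k : ℕ) : ℝ) * (α - 1)) *
      (2 ^ (n + k) * 9 ^ n * (2 ^ d / h) ^ k) ≤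
      C₁ * (2 ^ (n + k) * 9 ^ n) * X ^ (-(γ - (1 + ε) * (n * t))) := by
    intro hd0
    have hσ := hd2.resolve_left hd0
    have h1 : 2 ^ d / h ≤ (ρ * X ^ ε)⁻¹ := by
      rw [← inv_div]
      gcongr
    have h2 : L ^ ((n : ℝ) - β + ((n + k : ℕ) : ℝ) * (α - 1)) = L ^ (-β) * L ^ n * ρ ^ (n + k) := by
      rw [hρ, ← Real.rpow_natCast L n, ← Real.rpow_natCast (L ^ (α - 1)), ← Real.rpow_mul hL.le,
        ← Real.rpow_add hL, ← Real.rpow_add hL]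
      congr 1
      ring
    -- Here `L ^ n * ρ ^ n = X ^ n`, the remaining `ρ ^ k` cancels, and only the gain `(X ^ ε) ^ k`
    -- is left in the denominator.
    have h3 : L ^ (-β) * L ^ n * ρ ^ (n + k) * ((ρ * X ^ ε)⁻¹) ^ k =
        X ^ (-γ) * (X ^ n / (X ^ ε) ^ k) := by
      rw [hLβ, ← hLρ, mul_pow L ρ n, hLρ, pow_add, inv_pow, mul_pow]
      field_simp
    have h4 : X ^ n / (X ^ ε) ^ k ≤ 1 := by
      rw [div_le_one (by positivity), ← Real.rpow_natCast, ← Real.rpow_natCast,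
        ← Real.rpow_mul hX0.le]
      exact Real.rpow_le_rpow_of_exponent_le hLα hk
    have h5 : X ^ (-γ) ≤ X ^ (-(γ - (1 + ε) * (n * t))) := by
      refine Real.rpow_le_rpow_of_exponent_le hLα ?_
      have : 0 ≤ (1 + ε) * (n * t) := by positivity
      linarith
    calc _ ≤ C₁ * L ^ ((n : ℝ) - β + ((n + k : ℕ) : ℝ) * (α - 1)) *
          (2 ^ (n + k) * 9 ^ n * ((ρ * X ^ ε)⁻¹) ^ k) := by gcongr
      _ = C₁ * (2 ^ (n + k) * 9 ^ n) * (L ^ (-β) * L ^ n * ρ ^ (n + k) * ((ρ * X ^ ε)⁻¹) ^ k) := by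
          rw [h2]; ring
      _ = C₁ * (2 ^ (n + k) * 9 ^ n) * (X ^ (-γ) * (X ^ n / (X ^ ε) ^ k)) := by rw [h3]
      _ ≤ C₁ * (2 ^ (n + k) * 9 ^ n) * (X ^ (-(γ - (1 + ε) * (n * t))) * 1) := by gcongr
      _ = _ := by ring
  refine (enorm_multiplierForm_le_near_add_far hh hMint hf1 hg1 hfb d).trans ?_
  rw [add_mul, ENNReal.ofReal_add (by positivity) (by positivity), add_mul]
  refine add_le_add ?_ ?_
  · refine hnear.trans ?_
    gcongr
    exact hb d hdD
  -- At depth `0` the lower bound on the side is unavailable, but there the triple of any cube of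
  -- the box contains the support of `g`, so the far part vanishes.
  · by_cases hd0 : d = 0
    · have hzero : ∑ a ∈ boxIndices n d, ‖multiplierForm M ((gridCube h (d, a)).indicator f)
          ((gridTriple h (d, a))ᶜ.indicator g)‖ₑ = 0 := by
        refine Finset.sum_eq_zero fun a ha => ?_
        have hg0 : (gridTriple h (d, a))ᶜ.indicator g = fun _ => 0 := by
          funext y
          by_cases hy : y ∈ gridTriple h (d, a)
          · simp [hy]
          rw [Set.indicator_of_mem (by exact hy)]
          by_contra hgy
          obtain ⟨x, hx⟩ := gridCube_nonempty hh (d, a)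
          have hxa : gridIndex h d x = a := hx
          subst hd0
          refine hy fun j => ?_
          have := abs_gridIndex_zero_sub_le (h := h) (x := x) (y := y) (by rw [hxa]; exact ha)
            (hgb y hgy) j
          rwa [hxa] at this
        have hF0 : ∀ ξ, 𝓕 (fun _ : Euc n => (0 : ℂ)) ξ = 0 := fun ξ => by
          rw [Real.fourier_eq]
          simp
        rw [hg0, multiplierForm]
        simp [hF0]
      rw [hzero]
      exact zero_le
    · exact hfar.trans (mul_le_mul_left (ENNReal.ofReal_le_ofReal (hfar2 hd0)) b)

/-! ### Summation over the Littlewood–Paley pieces -/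

theorem sum_annulusCutoff_of_pos {n : ℕ} (K : ℕ) (ξ : Euc n) :
    ∑ k ∈ Finset.range (K + 1), annulusCutoff (((2 : ℝ) ^ (k : ℝ))⁻¹ • ξ) =
      freqCutoff n (((2 : ℝ) ^ K)⁻¹ • ξ) - freqCutoff n ((2 : ℝ) • ξ) := by
  induction K with
  | zero => simp [annulusCutoff]
  | succ K ih =>
    rw [Finset.sum_range_succ, ih, annulusCutoff, smul_smul, Real.rpow_natCast]
    have : (2 : ℝ) * (2 ^ (K + 1))⁻¹ = (2 ^ K)⁻¹ := by
      rw [pow_succ]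
      field_simp
    rw [this]
    ring

theorem sum_annulusCutoff_of_neg {n : ℕ} (K : ℕ) (ξ : Euc n) :
    ∑ k ∈ Finset.range (K + 1), annulusCutoff (((2 : ℝ) ^ (-(k : ℝ)))⁻¹ • ξ) =
      freqCutoff n ξ - freqCutoff n ((2 : ℝ) ^ (K + 1) • ξ) := by
  induction K with
  | zero => simp [annulusCutoff]
  | succ K ih =>
    rw [Finset.sum_range_succ, ih, annulusCutoff, smul_smul, Real.rpow_neg two_pos.le, inv_inv,
      Real.rpow_natCast, ← pow_succ']
    ring

/-- The frequencies `2 ^ k` for `0 < α` and `2 ^ (-k)` for `α < 0`. -/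
noncomputable def freqScale (α : ℝ) (k : ℕ) : ℝ := 2 ^ (SignType.sign α * (k : ℝ))

theorem freqScale_pos (α : ℝ) (k : ℕ) : 0 < freqScale α k := by
  unfold freqScale
  positivity

theorem freqScale_rpow (α : ℝ) (k : ℕ) : freqScale α k ^ α = (2 ^ |α|) ^ k := by
  rw [freqScale, ← Real.rpow_mul two_pos.le, ← Real.rpow_natCast, ← Real.rpow_mul two_pos.le,
    mul_right_comm, sign_mul_self]

theorem one_le_freqScale_rpow (α : ℝ) (k : ℕ) : 1 ≤ freqScale α k ^ α := by
  rw [freqScale_rpow]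
  exact one_le_pow₀ (Real.one_le_rpow one_le_two (abs_nonneg α))

/-- The pieces of frequency up to `freqScale α K` approximate the multiplier uniformly. -/
theorem norm_sub_sum_dyadicPiece_le {n : ℕ} {α β : ℝ} (hαβ : 0 < α * β)
    {A : ℕ → ℝ} {m : Euc n → ℂ} (hm : IsMiyachiMultiplier α β A m) (K : ℕ) {ξ : Euc n}
    (hξ : ξ ≠ 0) :
    ‖m ξ - ∑ k ∈ Finset.range (K + 1), dyadicPiece m (freqScale α k) ξ‖ ≤
      |A 0| * (2 ^ (-|β|)) ^ K := by
  have hRHS : 0 ≤ |A 0| * ((2 : ℝ) ^ (-|β|)) ^ K := by positivity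
  have hpos : 0 < ‖ξ‖ := norm_pos_iff.2 hξ
  by_cases hm0 : m ξ = 0
  · simpa [dyadicPiece, hm0] using hRHS
  have hs := hm.support ξ hξ hm0
  have hd := hm.deriv_le 0 (fun j => j.elim0) ξ hξ
  simp only [iteratedFDeriv_zero_apply, Nat.cast_zero, zero_mul, add_zero] at hd
  have hd' : ‖m ξ‖ ≤ |A 0| * ‖ξ‖ ^ (-β) := hd.trans (by gcongr; exact le_abs_self _)
  have hsum : m ξ - ∑ k ∈ Finset.range (K + 1), dyadicPiece m (freqScale α k) ξ =
      (1 - ∑ k ∈ Finset.range (K + 1), annulusCutoff ((freqScale α k)⁻¹ • ξ)) • m ξ := by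
    simp only [dyadicPiece]
    rw [sub_smul, one_smul, Finset.sum_smul]
  have hpow : ((2 : ℝ) ^ (-|β|)) ^ K = ((2 : ℝ) ^ K) ^ (-|β|) := by
    rw [← Real.rpow_natCast, ← Real.rpow_natCast, ← Real.rpow_mul two_pos.le,
      ← Real.rpow_mul two_pos.le, mul_comm]
  rw [hsum, norm_smul, hpow]
  have h2K : (0 : ℝ) < 2 ^ K := by positivity
  have hcut : ∀ ζ : Euc n, 0 ≤ freqCutoff n ζ ∧ freqCutoff n ζ ≤ 1 := fun ζ =>
    ⟨(freqCutoff n).nonneg, (freqCutoff n).le_one⟩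
  rcases lt_trichotomy α 0 with hα | hα | hα
  · have hβ : β < 0 := by nlinarith
    have h1 : ‖ξ‖ ≤ 1 := by
      by_contra! hc
      exact absurd hs (not_le.mpr (Real.rpow_lt_one_of_one_lt_of_neg hc hα))
    have hfs : ∀ k : ℕ, freqScale α k = 2 ^ (-(k : ℝ)) := fun k => by
      simp [freqScale, hα]
    simp_rw [hfs]
    -- The sum telescopes. On the support of `m` one of its two end terms equals `1`, so the error
    -- lives where `‖ξ‖ ≤ 2 ^ (-K)`, and there the bound for `m` is small.
    rw [sum_annulusCutoff_of_neg, freqCutoff_eq_one h1, sub_sub_cancel]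
    by_cases h2 : 2 ≤ ‖(2 : ℝ) ^ (K + 1) • ξ‖
    · rw [freqCutoff_eq_zero h2]
      simpa using by positivity
    · rw [norm_smul, norm_pow, Real.norm_ofNat, not_le, pow_succ] at h2
      have h3 : ‖ξ‖ ≤ (2 ^ K)⁻¹ := by
        rw [← one_div, le_div_iff₀ h2K]
        linarith
      rw [Real.norm_of_nonneg (hcut _).1]
      calc _ ≤ 1 * (|A 0| * ‖ξ‖ ^ (-β)) := by gcongr; exact (hcut _).2
        _ ≤ 1 * (|A 0| * ((2 ^ K)⁻¹) ^ (-β)) := by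
            gcongr
            linarith
        _ = _ := by
            rw [one_mul, abs_of_neg hβ, neg_neg, Real.inv_rpow h2K.le, ← Real.rpow_neg h2K.le,
              neg_neg]
  · simp [hα] at hαβ
  · have hβ : 0 < β := by nlinarith
    have h1 : 1 ≤ ‖ξ‖ := by
      by_contra! hc
      exact absurd hs (not_le.mpr (Real.rpow_lt_one hpos.le hc hα))
    have hfs : ∀ k : ℕ, freqScale α k = 2 ^ (k : ℝ) := fun k => by
      simp [freqScale, hα]
    simp_rw [hfs]
    -- The mirror case: the low end term vanishes on the support of `m`, and the error lives where
    -- `2 ^ K < ‖ξ‖`.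
    rw [sum_annulusCutoff_of_pos, freqCutoff_eq_zero (ξ := (2 : ℝ) • ξ)
      (by rw [norm_smul, Real.norm_ofNat]; linarith), sub_zero]
    by_cases h2 : ‖((2 : ℝ) ^ K)⁻¹ • ξ‖ ≤ 1
    · rw [freqCutoff_eq_one h2]
      simpa using by positivity
    · rw [norm_smul, norm_inv, norm_pow, Real.norm_ofNat, not_le, lt_inv_mul_iff₀ h2K, mul_one] at h2
      rw [Real.norm_of_nonneg (by linarith [(hcut (((2 : ℝ) ^ K)⁻¹ • ξ)).2])]
      calc _ ≤ 1 * (|A 0| * ‖ξ‖ ^ (-β)) := by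
            gcongr
            linarith [(hcut (((2 : ℝ) ^ K)⁻¹ • ξ)).1]
        _ ≤ 1 * (|A 0| * (2 ^ K) ^ (-β)) := by
            gcongr ?_ * (?_ * ?_)
            exact Real.rpow_le_rpow_of_nonpos h2K h2.le (by linarith)
        _ = _ := by rw [one_mul, abs_of_pos hβ]

theorem integrable_of_bounded {n : ℕ} {f : Euc n → ℂ} (hf : MemLp f ∞ volume)
    (hfs : HasCompactSupport f) : Integrable f :=
  memLp_one_iff_integrable.1 <| hf.mono_exponent_of_measure_support_ne_top (s := tsupport f)
    (fun _ hx => image_eq_zero_of_notMem_tsupport hx) hfs.measure_lt_top.ne le_top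

theorem integrable_fourier_mul_conj_fourier {n : ℕ} {f g : Euc n → ℂ}
    (hf1 : Integrable f) (hf2 : MemLp f 2 volume) (hg1 : Integrable g) (hg2 : MemLp g 2 volume) :
    Integrable fun ξ => 𝓕 f ξ * conj (𝓕 g ξ) := by
  have h1 : MemLp (𝓕 f) 2 volume :=
    ⟨(continuous_fourier_of_integrable hf1).aestronglyMeasurable, by
      rw [eLpNorm_fourier_eq hf1 hf2]; exact hf2.2⟩
  have h2 : MemLp (𝓕 g) 2 volume :=
    ⟨(continuous_fourier_of_integrable hg1).aestronglyMeasurable, by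
      rw [eLpNorm_fourier_eq hg1 hg2]; exact hg2.2⟩
  exact h1.integrable_mul h2.star

theorem enorm_multiplierForm_le_sum_add {n : ℕ} {α β : ℝ} (hαβ : 0 < α * β)
    {A : ℕ → ℝ} {m : Euc n → ℂ} (hm : IsMiyachiMultiplier α β A m)
    (hmb : MemLp (rescaled m) ∞ volume) (hn : 0 < n) {f g : Euc n → ℂ}
    (hf1 : Integrable f) (hf2 : MemLp f 2 volume) (hg1 : Integrable g) (hg2 : MemLp g 2 volume)
    (K : ℕ) :
    ‖multiplierForm (rescaled m) f g‖ₑ ≤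
      ∑ k ∈ Finset.range (K + 1), ‖multiplierForm (rescaled (dyadicPiece m (freqScale α k))) f g‖ₑ +
      ENNReal.ofReal (|A 0| * (2 ^ (-|β|)) ^ K) * ∫⁻ ξ, ‖𝓕 f ξ * conj (𝓕 g ξ)‖ₑ := by
  have : Nonempty (Fin n) := ⟨⟨0, hn⟩⟩
  have hJ := integrable_fourier_mul_conj_fourier hf1 hf2 hg1 hg2
  have hM : Integrable fun ξ => rescaled m ξ * 𝓕 f ξ * conj (𝓕 g ξ) := by
    simp_rw [mul_assoc]
    exact hJ.mul_of_top_right hmb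
  have hMk : ∀ k, Integrable fun ξ =>
      rescaled (dyadicPiece m (freqScale α k)) ξ * 𝓕 f ξ * conj (𝓕 g ξ) := fun k =>
    integrable_multiplierForm ((hm.contDiff_rescaled_dyadicPiece
      (freqScale_pos α k)).continuous.integrable_of_hasCompactSupport
      (hasCompactSupport_rescaled_dyadicPiece (freqScale_pos α k))) hf1 hg1
  have hsplit : multiplierForm (rescaled m) f g =
      ∑ k ∈ Finset.range (K + 1), multiplierForm (rescaled (dyadicPiece m (freqScale α k))) f g +
      ∫ ξ, (rescaled m ξ - ∑ k ∈ Finset.range (K + 1),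
        rescaled (dyadicPiece m (freqScale α k)) ξ) * (𝓕 f ξ * conj (𝓕 g ξ)) := by
    simp only [multiplierForm]
    rw [← integral_finsetSum _ fun k _ => hMk k, ← sub_eq_iff_eq_add', ← integral_sub hM
      (integrable_finsetSum _ fun k _ => hMk k)]
    congr 1
    funext ξ
    rw [sub_mul, Finset.sum_mul]
    congr 1
    · ring
    · exact Finset.sum_congr rfl fun k _ => by ring
  rw [hsplit]
  refine (enorm_add_le _ _).trans (add_le_add (enorm_sum_le _ _) ?_)
  refine (enorm_integral_le_lintegral_enorm _).trans ?_
  rw [← lintegral_const_mul' _ _ ENNReal.ofReal_ne_top]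
  have hne : ∀ᵐ ξ : Euc n ∂volume, ξ ≠ 0 := by simp [ae_iff]
  refine lintegral_mono_ae ?_
  filter_upwards [hne] with ξ hξ
  rw [enorm_mul]
  gcongr
  rw [← ofReal_norm]
  refine ENNReal.ofReal_le_ofReal ?_
  exact norm_sub_sum_dyadicPiece_le hαβ hm K (smul_ne_zero (by positivity) hξ)

theorem exists_gridIndex_mem_boxIndices {n : ℕ} {f : Euc n → ℂ} (hf : HasCompactSupport f) :
    ∃ i₀ : ℕ, ∀ i : ℕ, i₀ ≤ i → ∀ x, f x ≠ 0 →
      gridIndex ((2 : ℝ) ^ (i : ℤ)) 0 x ∈ boxIndices n 0 := by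
  obtain ⟨R, hR⟩ := hf.isCompact.isBounded.exists_norm_le
  obtain ⟨i₀, hi₀⟩ := pow_unbounded_of_one_lt R one_lt_two
  refine ⟨i₀, fun i hi x hx => ?_⟩
  have h1 : ‖x‖ < 2 ^ i := (hR x (subset_tsupport f hx)).trans_lt
    (hi₀.trans_le (pow_le_pow_right₀ one_le_two hi))
  simp only [boxIndices, Fintype.mem_piFinset, Finset.mem_Ico, pow_zero, gridIndex]
  intro j
  have h2 : |x j| ≤ ‖x‖ := PiLp.norm_apply_le x j
  have h3 : |x j| < 2 ^ i := h2.trans_lt h1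
  rw [abs_lt] at h3
  have hpos : (0 : ℝ) < 2 ^ i := by positivity
  rw [zpow_natCast, Int.le_floor, Int.floor_lt, one_mul, le_div_iff₀ hpos, div_lt_iff₀ hpos]
  push_cast
  constructor <;> linarith

/-- The triple of the coarsest cube with index `0` contains the whole box, so both averages over it
are nonzero. This positive quantity absorbs the tail of the frequency decomposition. -/
theorem gridForm_zero_ne_zero {n : ℕ} {h : ℝ} (hh : 0 < h) {f g : Euc n → ℂ}
    (hf : AEStronglyMeasurable f volume) (hg : AEStronglyMeasurable g volume)
    (hf0 : ¬ f =ᵐ[volume] 0) (hg0 : ¬ g =ᵐ[volume] 0)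
    (hfb : ∀ x, f x ≠ 0 → gridIndex h 0 x ∈ boxIndices n 0)
    (hgb : ∀ x, g x ≠ 0 → gridIndex h 0 x ∈ boxIndices n 0) :
    gridForm h 0 1 1 f g ≠ 0 := by
  have hmem : (0 : Fin n → ℤ) ∈ boxIndices n 0 := by
    simp [boxIndices, Fintype.mem_piFinset]
  have hbox : ∀ x : Euc n, gridIndex h 0 x ∈ boxIndices n 0 → x ∈ gridTriple h (0, 0) := by
    intro x hx j
    simp only [boxIndices, Fintype.mem_piFinset, Finset.mem_Ico, pow_zero] at hx
    have := hx j
    rw [abs_le]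
    simp only [Pi.zero_apply]
    omega
  have key : ∀ u : Euc n → ℂ, AEStronglyMeasurable u volume → ¬ u =ᵐ[volume] 0 →
      (∀ x, u x ≠ 0 → gridIndex h 0 x ∈ boxIndices n 0) →
      cubeAverage 1 (gridTriple h (0, 0)) u ≠ 0 := by
    intro u hu hu0 hub hc
    have h1 : (volume (gridTriple h ((0 : ℕ), (0 : Fin n → ℤ))))⁻¹ ≠ 0 := by
      rw [ENNReal.inv_ne_zero, volume_gridTriple hh]
      exact ENNReal.mul_ne_top (by simp) (volume_gridCube_ne_top hh _)
    rw [cubeAverage, eLpNorm_eq_zero_iff (hu.restrict.smul_measure _) one_ne_zero,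
      Filter.EventuallyEq, Measure.ae_ennreal_smul_measure_iff h1,
      ae_restrict_iff' (measurableSet_gridTriple hh _)] at hc
    refine hu0 ?_
    filter_upwards [hc] with x hx
    by_contra hux
    exact hux (hx (hbox x (hub x hux)))
  intro hc
  rw [gridForm, Finset.sum_eq_zero_iff] at hc
  have h1 := hc 0 hmem
  simp only [mul_eq_zero] at h1
  rcases h1 with (h1 | h1) | h1
  · exact volume_gridCube_pos hh _ h1
  · exact key f hf hf0 hfb h1
  · exact key g hg hg0 hgb h1

theorem gridForm_mono {n : ℕ} {h : ℝ} (hh : 0 < h) (d : ℕ) {p q p' q' : ℝ≥0∞} (hp : p ≤ p')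
    (hq : q ≤ q') {f g : Euc n → ℂ} (hf : AEStronglyMeasurable f volume)
    (hg : AEStronglyMeasurable g volume) : gridForm h d p q f g ≤ gridForm h d p' q' f g := by
  refine Finset.sum_le_sum fun a _ => ?_
  have h0 : volume (gridTriple h (d, a)) ≠ 0 := by
    rw [volume_gridTriple hh]
    exact mul_ne_zero (by simp) (volume_gridCube_pos hh _)
  have ht : volume (gridTriple h (d, a)) ≠ ∞ := by
    rw [volume_gridTriple hh]
    exact ENNReal.mul_ne_top (by simp) (volume_gridCube_ne_top hh _)
  gcongr
  · exact cubeAverage_mono_exponent hp h0 ht hf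
  · exact cubeAverage_mono_exponent hq h0 ht hg

theorem exists_depth_forall_le {h : ℝ} (K : ℕ) {ρ : ℕ → ℝ} (hρ : ∀ k, 0 < ρ k) :
    ∃ D : ℕ, ∀ k ∈ Finset.range (K + 1), h / 2 ^ D ≤ ρ k := by
  have h1 : Filter.Tendsto (fun D : ℕ => h / (2 : ℝ) ^ D) Filter.atTop (nhds 0) :=
    tendsto_const_nhds.div_atTop (tendsto_pow_atTop_atTop_of_one_lt one_lt_two)
  have h2 : ∀ᶠ D : ℕ in Filter.atTop, ∀ k ∈ Finset.range (K + 1), h / (2 : ℝ) ^ D ≤ ρ k :=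
    (Filter.eventually_all_finset _).2 fun k _ => h1.eventually_le_const (hρ k)
  exact h2.exists

theorem multiplierForm_eq_zero_of_ae {n : ℕ} (M : Euc n → ℂ) {f g : Euc n → ℂ}
    (h : f =ᵐ[volume] 0 ∨ g =ᵐ[volume] 0) : multiplierForm M f g = 0 := by
  have hF : ∀ u : Euc n → ℂ, u =ᵐ[volume] 0 → ∀ ξ, 𝓕 u ξ = 0 := fun u hu ξ => by
    rw [Real.fourier_congr_ae hu, Real.fourier_eq]
    simp
  rcases h with h | h
  · simp [multiplierForm, hF f h]
  · simp [multiplierForm, hF g h]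

/-- The sparse bound for a countable dense family of exponents. -/
theorem exists_sparse_bound (n : ℕ) (hn : 0 < n) {α β : ℝ} (hα : α ≠ 0) (hαβ : 0 < α * β)
    (A : ℕ → ℝ) :
    ∃ C : ℚ → ℚ → ℝ≥0, ∀ m : Euc n → ℂ, IsMiyachiMultiplier α β A m →
      ∀ f g : Euc n → ℂ, MemLp f ∞ volume → HasCompactSupport f →
        MemLp g ∞ volume → HasCompactSupport g →
      ∃ S : Set (Set (Euc n)), IsSparse (1 / (4 * 8 ^ n)) S ∧ S.Finite ∧
        (∀ Q ∈ S, volume Q ≠ 0 ∧ volume Q ≠ ∞) ∧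
        ∀ p q : ℚ, 1 ≤ p → p ≤ 2 → 1 ≤ q → q ≤ 2 →
          (n : ℝ) * |α| * (1 / (p : ℝ) + 1 / (q : ℝ) - 1) < |β| →
          ‖multiplierForm (rescaled m) f g‖ₑ ≤
            C p q * sparseForm S (ENNReal.ofReal p) (ENNReal.ofReal q) f g := by
  obtain ⟨C₁, hC₁⟩ := exists_sparse_domination n
  have hex : ∀ p q : ℚ, ∃ C δ : ℝ, 0 ≤ C ∧ 0 < δ ∧ (1 ≤ p → p ≤ 2 → 1 ≤ q → q ≤ 2 →
      (n : ℝ) * |α| * (1 / (p : ℝ) + 1 / (q : ℝ) - 1) < |β| →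
      ∀ m : Euc n → ℂ, IsMiyachiMultiplier α β A m →
      ∀ f g : Euc n → ℂ, Integrable f → MemLp f 2 volume → Integrable g → MemLp g 2 volume →
      ∀ h : ℝ, 0 < h → (∀ x, f x ≠ 0 → gridIndex h 0 x ∈ boxIndices n 0) →
      (∀ x, g x ≠ 0 → gridIndex h 0 x ∈ boxIndices n 0) →
      ∀ (D : ℕ) (L : ℝ), 0 < L → 1 ≤ L ^ α → h / 2 ^ D ≤ L ^ (α - 1) →
      ∀ b : ℝ≥0∞, (∀ d ≤ D, gridForm h d (ENNReal.ofReal p) (ENNReal.ofReal q) f g ≤ b) →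
        ‖multiplierForm (rescaled (dyadicPiece m L)) f g‖ₑ ≤
          ENNReal.ofReal (C * (L ^ α) ^ (-δ)) * b) := by
    intro p q
    by_cases hpq : 1 ≤ p ∧ p ≤ 2 ∧ 1 ≤ q ∧ q ≤ 2 ∧
      (n : ℝ) * |α| * (1 / (p : ℝ) + 1 / (q : ℝ) - 1) < |β|
    · obtain ⟨h1, h2, h3, h4, h5⟩ := hpq
      obtain ⟨C, δ, hC, hδ, hb⟩ := exists_dyadicPiece_bound n hα hαβ A (p := p) (q := q)
        (by exact_mod_cast h1) (by exact_mod_cast h2) (by exact_mod_cast h3)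
        (by exact_mod_cast h4) h5
      exact ⟨C, δ, hC, hδ, fun _ _ _ _ _ => hb⟩
    -- Default values for inadmissible exponents, where nothing is claimed.
    · exact ⟨0, 1, le_rfl, one_pos, fun h1 h2 h3 h4 h5 => absurd ⟨h1, h2, h3, h4, h5⟩ hpq⟩
  choose C₂ δ hC₂ hδ hpiece using hex
  set r : ℚ → ℚ → ℝ := fun p q => (2 ^ |α|) ^ (-(δ p q)) with hr
  have hr0 : ∀ p q, 0 ≤ r p q := fun p q => by simp only [hr]; positivity
  have hr1 : ∀ p q, r p q < 1 := fun p q => by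
    simp only [hr]
    exact Real.rpow_lt_one_of_one_lt_of_neg
      (Real.one_lt_rpow one_lt_two (abs_pos.2 hα)) (by linarith [hδ p q])
  -- The geometric series gives the first summand; the `1` accounts for the frequency tail.
  refine ⟨fun p q => (Real.toNNReal (C₂ p q * (1 - r p q)⁻¹) + 1) * C₁ p q, ?_⟩
  intro m hm f g hf hfs hg hgs
  by_cases hfg : f =ᵐ[volume] 0 ∨ g =ᵐ[volume] 0
  · refine ⟨∅, ⟨by simp, fun _ => ∅, by simp, by simp⟩, Set.finite_empty, by simp, ?_⟩
    intro p q _ _ _ _ _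
    rw [multiplierForm_eq_zero_of_ae _ hfg, enorm_zero]
    exact zero_le
  rw [not_or] at hfg
  have hmb := hm.memLp_rescaled hn hαβ
  have hf2 := memLp_two_of_bounded hf hfs
  have hg2 := memLp_two_of_bounded hg hgs
  have hf1 := integrable_of_bounded hf hfs
  have hg1 := integrable_of_bounded hg hgs
  obtain ⟨i₁, hi₁⟩ := exists_gridIndex_mem_boxIndices hfs
  obtain ⟨i₂, hi₂⟩ := exists_gridIndex_mem_boxIndices hgs
  set i : ℕ := max i₁ i₂ with hi
  have hfb := hi₁ i (le_max_left _ _)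
  have hgb := hi₂ i (le_max_right _ _)
  set h : ℝ := 2 ^ (i : ℤ) with hh_def
  have hh : 0 < h := by positivity
  have hb0 := gridForm_zero_ne_zero hh hf.1 hg.1 hfg.1 hfg.2 hfb hgb
  -- The tail is compared with the form with exponents `1, 1`, so that `K`, and with it `D` and `S`,
  -- is independent of `p` and `q`.
  obtain ⟨K, hK⟩ : ∃ K : ℕ, ENNReal.ofReal (|A 0| * (2 ^ (-|β|)) ^ K) *
      ∫⁻ ξ, ‖𝓕 f ξ * conj (𝓕 g ξ)‖ₑ ≤ gridForm h 0 1 1 f g := by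
    have hJ : ∫⁻ ξ, ‖𝓕 f ξ * conj (𝓕 g ξ)‖ₑ ≠ ∞ :=
      (integrable_fourier_mul_conj_fourier hf1 hf2 hg1 hg2).2.ne
    have hβ : 0 < |β| := abs_pos.2 fun h0 => by simp [h0] at hαβ
    have h1 : Filter.Tendsto (fun K : ℕ => |A 0| * ((2 : ℝ) ^ (-|β|)) ^ K) Filter.atTop
        (nhds 0) := by
      have := (tendsto_pow_atTop_nhds_zero_of_lt_one (r := (2 : ℝ) ^ (-|β|)) (by positivity)
        (Real.rpow_lt_one_of_one_lt_of_neg one_lt_two (by linarith))).const_mul |A 0|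
      rwa [mul_zero] at this
    have h2 : Filter.Tendsto (fun K : ℕ => ENNReal.ofReal (|A 0| * ((2 : ℝ) ^ (-|β|)) ^ K) *
        ∫⁻ ξ, ‖𝓕 f ξ * conj (𝓕 g ξ)‖ₑ) Filter.atTop (nhds 0) := by
      have := ENNReal.Tendsto.mul_const (ENNReal.tendsto_ofReal h1) (Or.inr hJ)
      rwa [ENNReal.ofReal_zero, zero_mul] at this
    exact (h2.eventually_le_const (pos_iff_ne_zero.2 hb0)).exists
  obtain ⟨D, hD⟩ := exists_depth_forall_le (h := h) K (ρ := fun k => freqScale α k ^ (α - 1))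
    fun k => Real.rpow_pos_of_pos (freqScale_pos α k) _
  obtain ⟨S, hS, hSfin, hSvol, hSdom⟩ := hC₁ i f g hf hg D
  refine ⟨S, hS, hSfin, hSvol, ?_⟩
  intro p q hp1 hp2 hq1 hq2 hadm
  set b : ℝ≥0∞ := C₁ p q * sparseForm S (ENNReal.ofReal p) (ENNReal.ofReal q) f g with hb
  have hdom := hSdom p q hp1 hq1
  have hone : gridForm h 0 1 1 f g ≤ b := by
    refine (gridForm_mono hh 0 ?_ ?_ hf.1 hg.1).trans (hdom 0 (Nat.zero_le D))
    · rw [← ENNReal.ofReal_one]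
      exact ENNReal.ofReal_le_ofReal (by exact_mod_cast hp1)
    · rw [← ENNReal.ofReal_one]
      exact ENNReal.ofReal_le_ofReal (by exact_mod_cast hq1)
  have hpk : ∀ k ∈ Finset.range (K + 1),
      ‖multiplierForm (rescaled (dyadicPiece m (freqScale α k))) f g‖ₑ ≤
        ENNReal.ofReal (C₂ p q * r p q ^ k) * b := by
    intro k hk
    have h1 := hpiece p q hp1 hp2 hq1 hq2 hadm m hm f g hf1 hf2 hg1 hg2 h hh hfb hgb D
      (freqScale α k) (freqScale_pos α k) (one_le_freqScale_rpow α k) (hD k hk) b hdom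
    rw [freqScale_rpow] at h1
    have h2 : (((2 : ℝ) ^ |α|) ^ k) ^ (-δ p q) = r p q ^ k := by
      simp only [hr]
      have h3 : (0 : ℝ) ≤ 2 ^ |α| := by positivity
      rw [← Real.rpow_natCast ((2 : ℝ) ^ |α|) k, ← Real.rpow_natCast (((2 : ℝ) ^ |α|) ^ (-δ p q)) k,
        ← Real.rpow_mul h3, ← Real.rpow_mul h3, mul_comm]
    rwa [h2] at h1
  calc ‖multiplierForm (rescaled m) f g‖ₑ
      ≤ ∑ k ∈ Finset.range (K + 1),
          ‖multiplierForm (rescaled (dyadicPiece m (freqScale α k))) f g‖ₑ +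
        ENNReal.ofReal (|A 0| * (2 ^ (-|β|)) ^ K) * ∫⁻ ξ, ‖𝓕 f ξ * conj (𝓕 g ξ)‖ₑ :=
        enorm_multiplierForm_le_sum_add hαβ hm hmb hn hf1 hf2 hg1 hg2 K
    _ ≤ ∑ k ∈ Finset.range (K + 1), ENNReal.ofReal (C₂ p q * r p q ^ k) * b + b :=
        add_le_add (Finset.sum_le_sum hpk) (hK.trans hone)
    _ ≤ ENNReal.ofReal (C₂ p q * (1 - r p q)⁻¹) * b + b := by
        gcongr
        rw [← Finset.sum_mul, ← ENNReal.ofReal_sum_of_nonneg fun k _ =>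
          mul_nonneg (hC₂ p q) (pow_nonneg (hr0 p q) k), ← Finset.mul_sum]
        refine mul_le_mul_left (ENNReal.ofReal_le_ofReal ?_) b
        refine mul_le_mul_of_nonneg_left ?_ (hC₂ p q)
        rw [← tsum_geometric_of_lt_one (hr0 p q) (hr1 p q)]
        exact (summable_geometric_of_lt_one (hr0 p q) (hr1 p q)).sum_le_tsum _
          fun k _ => pow_nonneg (hr0 p q) k
    _ = _ := by
        rw [hb]
        push_cast
        rw [ENNReal.ofReal]
        ring

/-! ### Approximation of the exponents by rational ones -/

theorem exists_rat_le_one_div_lt {x η : ℝ} (hx : 1 ≤ x) (hη : 0 < η) :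
    ∃ p : ℚ, 1 ≤ p ∧ (p : ℝ) ≤ x ∧ 1 / (p : ℝ) < 1 / x + η := by
  rcases hx.eq_or_lt with rfl | hx
  · exact ⟨1, le_rfl, by simp, by simpa using hη⟩
  have hx0 : 0 < 1 / x := by positivity
  have h1 : 1 / (1 / x + η) < x := by
    rw [one_div_lt (by positivity) (by positivity)]
    linarith
  obtain ⟨p, hp, hpx⟩ := exists_rat_btwn (max_lt hx h1)
  have hp1 := (le_max_left _ _).trans_lt hp
  refine ⟨p, by exact_mod_cast hp1.le, hpx.le, ?_⟩
  rw [one_div_lt (by linarith) (by positivity)]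
  exact (le_max_right _ _).trans_lt hp

/-- Rounding the exponents down raises each reciprocal by less than `η`, and `2 * c * η` is less
than the gap in the strict inequality. -/
theorem exists_rat_pair_of_lt {x y c b : ℝ} (hx : 1 ≤ x) (hy : 1 ≤ y) (hc : 0 ≤ c)
    (h : c * (1 / x + 1 / y - 1) < b) :
    ∃ p q : ℚ, 1 ≤ p ∧ 1 ≤ q ∧ (p : ℝ) ≤ x ∧ (q : ℝ) ≤ y ∧
      c * (1 / (p : ℝ) + 1 / (q : ℝ) - 1) < b := by
  set η := (b - c * (1 / x + 1 / y - 1)) / (2 * (c + 1)) with hη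
  have hη0 : 0 < η := div_pos (by linarith) (by linarith)
  obtain ⟨p, hp1, hpx, hp⟩ := exists_rat_le_one_div_lt hx hη0
  obtain ⟨q, hq1, hqy, hq⟩ := exists_rat_le_one_div_lt hy hη0
  refine ⟨p, q, hp1, hq1, hpx, hqy, ?_⟩
  have h1 : c * (1 / (p : ℝ) + 1 / (q : ℝ) - 1) ≤ c * (1 / x + 1 / y - 1 + 2 * η) :=
    mul_le_mul_of_nonneg_left (by linarith) hc
  have h2 : 2 * η * (c + 1) = b - c * (1 / x + 1 / y - 1) := by
    rw [hη]
    field_simp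
  nlinarith

theorem exists_rat_pair_of_admissible {n : ℕ} {α b : ℝ} {r s : ℝ≥0∞}
    (h : (1 ≤ r ∧ r ≤ s ∧ s ≤ 2 ∧ (n : ℝ) * |α| * ((r⁻¹).toReal - 1 / 2) < b) ∨
      (1 ≤ r ∧ r ≤ 2 ∧ 2 ≤ s ∧ s ≤ ENNReal.conjExponent r ∧
        (n : ℝ) * |α| * ((r⁻¹).toReal - (s⁻¹).toReal) < b)) :
    ∃ p q : ℚ, 1 ≤ p ∧ p ≤ 2 ∧ 1 ≤ q ∧ q ≤ 2 ∧
      (n : ℝ) * |α| * (1 / (p : ℝ) + 1 / (q : ℝ) - 1) < b ∧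
      ENNReal.ofReal p ≤ r ∧ ENNReal.ofReal q ≤ ENNReal.conjExponent s := by
  have key : ∀ {t : ℝ≥0∞}, 1 ≤ t → t ≤ 2 → t ≠ ∞ ∧ 1 ≤ t.toReal ∧ t.toReal ≤ 2 ∧
      1 / t.toReal = (t⁻¹).toReal := by
    intro t ht1 ht2
    have ht : t ≠ ∞ := (ht2.trans_lt (by simp)).ne
    refine ⟨ht, ?_, ?_, by rw [ENNReal.toReal_inv, one_div]⟩
    · simpa using ENNReal.toReal_mono ht ht1
    · simpa using ENNReal.toReal_mono (by simp) ht2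
  suffices H : ∃ t : ℝ≥0∞, 1 ≤ r ∧ r ≤ 2 ∧ 1 ≤ t ∧ t ≤ 2 ∧ t ≤ ENNReal.conjExponent s ∧
      (n : ℝ) * |α| * ((r⁻¹).toReal + (t⁻¹).toReal - 1) < b by
    obtain ⟨t, hr1, hr2, ht1, ht2, hts, hlt⟩ := H
    obtain ⟨hrt, hr1', hr2', hr'⟩ := key hr1 hr2
    obtain ⟨htt, ht1', ht2', ht'⟩ := key ht1 ht2
    rw [← hr', ← ht'] at hlt
    obtain ⟨p, q, hp1, hq1, hp, hq, hpq⟩ := exists_rat_pair_of_lt hr1' ht1' (by positivity) hlt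
    exact ⟨p, q, hp1, by exact_mod_cast hp.trans hr2', hq1, by exact_mod_cast hq.trans ht2', hpq,
      ENNReal.ofReal_le_of_le_toReal hp, (ENNReal.ofReal_le_of_le_toReal hq).trans hts⟩
  rcases h with ⟨hr1, hrs, hs2, hlt⟩ | ⟨hr1, hr2, hs2, -, hlt⟩
  -- For `s ≤ 2` the exponent `2 ≤ s'` is used for the second function, which produces the condition
  -- with `1 / r - 1 / 2`.
  · refine ⟨2, hr1, hrs.trans hs2, one_le_two, le_rfl, ?_, ?_⟩
    · have h1 : s - 1 ≤ 1 := tsub_le_iff_right.2 (by rwa [one_add_one_eq_two])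
      rw [ENNReal.conjExponent, ← one_add_one_eq_two]
      gcongr
      exact ENNReal.one_le_inv.2 h1
    · convert hlt using 2
      rw [ENNReal.toReal_inv 2, ENNReal.toReal_ofNat]
      ring
  · have hs1 : 1 ≤ s := one_le_two.trans hs2
    have hconj := ENNReal.HolderConjugate.conjExponent hs1
    -- For `2 ≤ s` the exponent `s' ≤ 2` itself lies in the Bernstein range, and `1 / s' - 1 = -1 /
    -- s`.
    refine ⟨ENNReal.conjExponent s, hr1, hr2, le_self_add, ?_, le_rfl, ?_⟩
    · have h1 : 1 ≤ s - 1 := ENNReal.le_sub_of_add_le_left (by simp) (by rwa [one_add_one_eq_two])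
      rw [ENNReal.conjExponent, ← one_add_one_eq_two]
      gcongr
      exact ENNReal.inv_le_one.2 h1
    · have h1 : (s⁻¹).toReal + ((ENNReal.conjExponent s)⁻¹).toReal = 1 := by
        rw [← ENNReal.toReal_add, hconj.inv_add_inv_eq_one, ENNReal.toReal_one]
        · exact ENNReal.inv_ne_top.2 (one_pos.trans_le hs1).ne'
        · exact ENNReal.inv_ne_top.2 (one_pos.trans_le le_self_add).ne'
      convert hlt using 2
      linarith

/-! ### The main theorem -/

theorem theorem4 (n : ℕ) (hn : 0 < n) :
    ∃ η : ℝ, 0 < η ∧ η < 1 ∧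
    ∀ (α β : ℝ) (_ : α ≠ 0) (hαβ : 0 < α * β) (A : ℕ → ℝ),
    ∃ C : ℝ≥0∞ → ℝ≥0∞ → ℝ≥0,
    ∀ (m : EuclideanSpace ℝ (Fin n) → ℂ) (hm : IsMiyachiMultiplier α β A m)
      (f g : EuclideanSpace ℝ (Fin n) → ℂ)
      (hf : MemLp f ∞ volume) (hfs : HasCompactSupport f)
      (_ : MemLp g ∞ volume) (_ : HasCompactSupport g),
    ∃ S S' : Set (Set (EuclideanSpace ℝ (Fin n))),
      IsSparse η S ∧ IsSparse η S' ∧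
      ∀ r s : ℝ≥0∞,
        ((1 ≤ r ∧ r ≤ s ∧ s ≤ 2 ∧ (n : ℝ) * |α| * ((r⁻¹).toReal - 1 / 2) < |β|) ∨
          (1 ≤ r ∧ r ≤ 2 ∧ 2 ≤ s ∧ s ≤ ENNReal.conjExponent r ∧
            (n : ℝ) * |α| * ((r⁻¹).toReal - (s⁻¹).toReal) < |β|)) →
        (sparseForm S r (ENNReal.conjExponent s) f g < ∞ ∧
          ‖∫ x, multiplierOp m (hm.memLp_rescaled hn hαβ)
              ((memLp_two_of_bounded hf hfs).toLp f) x * conj (g x)‖ₑ ≤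
            C r s * sparseForm S r (ENNReal.conjExponent s) f g) ∧
        (sparseForm S' (ENNReal.conjExponent s) r f g < ∞ ∧
          ‖∫ x, multiplierOp m (hm.memLp_rescaled hn hαβ)
              ((memLp_two_of_bounded hf hfs).toLp f) x * conj (g x)‖ₑ ≤
            C r s * sparseForm S' (ENNReal.conjExponent s) r f g) := by
  refine ⟨1 / (4 * 8 ^ n), by positivity, ?_, ?_⟩
  · rw [div_lt_one (by positivity)]
    have : (1 : ℝ) ≤ 8 ^ n := one_le_pow₀ (by norm_num)
    linarith
  intro α β hα hαβ A
  obtain ⟨C, hC⟩ := exists_sparse_bound n hn hα hαβ A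
  -- The rational exponents are fixed from `r` and `s` before `m`, `f` and `g` appear, which makes
  -- the constant uniform; it covers both orders of the pair.
  have hchoice : ∀ r s : ℝ≥0∞, ∃ c : ℝ≥0,
      ((1 ≤ r ∧ r ≤ s ∧ s ≤ 2 ∧ (n : ℝ) * |α| * ((r⁻¹).toReal - 1 / 2) < |β|) ∨
          (1 ≤ r ∧ r ≤ 2 ∧ 2 ≤ s ∧ s ≤ ENNReal.conjExponent r ∧
            (n : ℝ) * |α| * ((r⁻¹).toReal - (s⁻¹).toReal) < |β|)) →
      ∃ p q : ℚ, 1 ≤ p ∧ p ≤ 2 ∧ 1 ≤ q ∧ q ≤ 2 ∧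
        (n : ℝ) * |α| * (1 / (p : ℝ) + 1 / (q : ℝ) - 1) < |β| ∧
        ENNReal.ofReal p ≤ r ∧ ENNReal.ofReal q ≤ ENNReal.conjExponent s ∧
        C p q ≤ c ∧ C q p ≤ c := by
    intro r s
    by_cases h : (1 ≤ r ∧ r ≤ s ∧ s ≤ 2 ∧ (n : ℝ) * |α| * ((r⁻¹).toReal - 1 / 2) < |β|) ∨
          (1 ≤ r ∧ r ≤ 2 ∧ 2 ≤ s ∧ s ≤ ENNReal.conjExponent r ∧
            (n : ℝ) * |α| * ((r⁻¹).toReal - (s⁻¹).toReal) < |β|)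
    · obtain ⟨p, q, h1, h2, h3, h4, h5, h6, h7⟩ := exists_rat_pair_of_admissible h
      exact ⟨max (C p q) (C q p), fun _ =>
        ⟨p, q, h1, h2, h3, h4, h5, h6, h7, le_max_left _ _, le_max_right _ _⟩⟩
    · exact ⟨0, fun h' => absurd h' h⟩
  choose c hc using hchoice
  refine ⟨c, ?_⟩
  intro m hm f g hf hfs hg hgs
  have hf2 := memLp_two_of_bounded hf hfs
  have hg2 := memLp_two_of_bounded hg hgs
  have hf1 := integrable_of_bounded hf hfs
  have hg1 := integrable_of_bounded hg hgs
  obtain ⟨S, hS, hSfin, hSvol, hSdom⟩ := hC m hm f g hf hfs hg hgs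
  -- One collection serves both forms: it dominates for every admissible rational pair, and `(q, p)`
  -- is admissible together with `(p, q)`.
  refine ⟨S, S, hS, hS, fun r s hrs => ?_⟩
  obtain ⟨p, q, hp1, hp2, hq1, hq2, hpq, hpr, hqs, hc1, hc2⟩ := hc r s hrs
  rw [integral_multiplierOp (hm.memLp_rescaled hn hαβ) hf1 hf2 hg1 hg2]
  refine ⟨⟨sparseForm_lt_top hSfin hSvol _ _ hf hg, ?_⟩,
    ⟨sparseForm_lt_top hSfin hSvol _ _ hf hg, ?_⟩⟩
  · refine (hSdom p q hp1 hp2 hq1 hq2 hpq).trans (mul_le_mul' (by exact_mod_cast hc1) ?_)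
    exact sparseForm_mono hSvol hpr hqs hf.1 hg.1
  · refine (hSdom q p hq1 hq2 hp1 hp2 (by rwa [add_comm (1 / (q : ℝ))])).trans
      (mul_le_mul' (by exact_mod_cast hc2) ?_)
    exact sparseForm_mono hSvol hqs hpr hf.1 hg.1
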